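/- All algebras are unital over $\mathbb C$. A dga $\Omega\mathcal A=\bigoplus_{k\ge 0}\Omega^k\mathcal A$ is a graded algebra with a linear map $d$ of degree $+1$, $d^2=0$, $d(\alpha\beta)=d\alpha\,\beta+(-1)^{|\alpha|}\alpha\,d\beta$; write $\mathcal A=\Omega^0\mathcal A$. A $*$-dga is a dga with a degree-preserving conjugate-linear involution $*$ such that $d(\alpha^*)=(d\alpha)^*$ and $(\alpha\beta)^*=\eta^{|\alpha||\beta|}\beta^*\alpha^*$ for homogeneous $\alpha,\beta$, where $\eta\in\{1,-1\}$ is a fixed sign. With $[\alpha,\epsilon]=\alpha\epsilon-(-1)^{|\alpha||\epsilon|}\epsilon\alpha$ the graded commutator, the graded centre is $Z_g(\Omega\mathcal A)=\{\alpha:[\alpha,\nu]=0\ \forall \nu\in\Omega\mathcal A\}$; it is again a $*$-dga. The graded centre $Z_g(\Omega\mathcal E)$ of a graded $\Omega\mathcal A$-bimodule is defined in the same way; write $Z_g(\mathcal A)=Z_g(\Omega\mathcal A)^0$ and $Z_g(\mathcal E)=Z_g(\Omega\mathcal E)^0$ for the degree $0$ parts. A $*$-dga $\Omega\mathcal B$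 with $\mathcal B=\Omega^0\mathcal B$ embedded as a dense $*$-subalgebra of a unital $C^*$-algebra $B$ has property Q if for all $a\in\mathcal B$ with $a\ge 0$, all $a_1,\dots,a_s\in\mathcal B$ with $|a_i|\le a$ and all $\omega_1,\dots,\omega_s\in\Omega^1\mathcal B$: if $da=\sum_i a_i\omega_i$, then $a=0$ or $a$ is invertible in $\mathcal B$. Let $\mathcal C_\flat(\Omega\mathcal A)$ be the category of pairs $(\Omega\mathcal E,\nabla)$ where $\Omega\mathcal E$ is a graded $\Omega\mathcal A$-bimodule that is fgp (that is, $\Omega\mathcal E\oplus\Omega\mathcal F\cong\Omega\mathcal A^n$ as graded bimodules for some graded bimodule $\Omega\mathcal F$ and some $n$) and $\nabla:\Omega\mathcal E\to\Omega\mathcal E$ is a $\mathbb C$-linear map of degree $+1$ with $\nabla(\epsilon\alpha)=\nabla(\epsilon)\alpha+(-1)^{|\epsilon|}\epsilon\,d\alpha$, $\nabla(\alpha\epsilon)=d\alpha\,\epsilon+(-1)^{|\alpha|}\alpha\nabla(\epsilon)$ and $\nabla^2=0$; morphisms are the bimodule maps of degree $0$ that commute with the connections. **Theorem.** Let $\Omega\mathcal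 A$ be a $*$-dga such that $Z_g(\mathcal A)$ is a dense $*$-subalgebra of a nonzero commutative unital $C^*$-algebra $B$ and $Z_g(\Omega\mathcal A)\ (\text{with } Z_g(\mathcal A)\subseteq B)$ satisfies property Q. Then $\mathcal C_\flat(\Omega\mathcal A)$ is a neutral Tannakian category over $\mathbb C$ for the following tensor structure: the unit object is $(\Omega\mathcal A,d)$; the tensor product is $\Omega\mathcal E\otimes_{\Omega\mathcal A}\Omega\mathcal F$ with $\nabla(\epsilon\otimes\zeta)=\nabla\epsilon\otimes\zeta+(-1)^{|\epsilon|}\epsilon\otimes\nabla\zeta$, with the usual associativity and unit isomorphisms; the symmetry sends $\epsilon\otimes\zeta$ to $(-1)^{|\epsilon||\zeta|}\zeta\otimes\epsilon$ for homogeneous $\epsilon\in Z_g(\Omega\mathcal E)$, $\zeta\in Z_g(\Omega\mathcal F)$. That is: with this structure $\mathcal C_\flat(\Omega\mathcal A)$ is an abelian, rigid, symmetric monoidal, $\mathbb C$-linear category with $\mathbb C$-bilinear tensor product, $\mathrm{End}(\mathbf 1)=\mathbb C$, and it has a fibre functor (a faithful exact $\mathbb C$-linear symmetric monoidal functor to finite-dimensional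 vector spaces). More precisely, for every point $p$ of the Gelfand spectrum of $B$, localisation at $p$, $\Omega\mathcal E\mapsto Z_g(\mathcal E)\otimes_{Z_g(\mathcal A)}\mathbb C_p$ (where $\mathbb C_p$ is $\mathbb C$ with $Z_g(\mathcal A)$ acting through $p$), with its evident tensor structure, is such a fibre functor $\omega_p$, and the group functor $\pi^1(\Omega\mathcal A,p):=\mathrm{Aut}^{\otimes}(\omega_p)$ on commutative $\mathbb C$-algebras, $R\mapsto$ the group of $R$-linear tensor automorphisms of $R\otimes\omega_p$, depends up to isomorphism only on $\Omega\mathcal A$, $B$, the tensor structure and $p$ (not on the chosen realisation of $\omega_p$). -/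

import Mathlib

open CategoryTheory MonoidalCategory TensorProduct MulOpposite

universe u v w

namespace FlatBimod

/-! ### Differential graded algebras -/

/-- A differential graded algebra over `ℂ`, graded by `ℕ`. -/
structure DGAlgebra where
  carrier : Type u
  [ring : Ring carrier]
  [algebra : Algebra ℂ carrier]
  gr : ℕ → Submodule ℂ carrier
  [graded : GradedAlgebra gr]
  d : carrier →ₗ[ℂ] carrier
  d_mem : ∀ {n : ℕ} {a : carrier}, a ∈ gr n → d a ∈ gr (n + 1)
  leibniz : ∀ {n : ℕ} {a : carrier}, a ∈ gr n → ∀ b : carrier,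
    d (a * b) = d a * b + (-1 : ℂ) ^ n • (a * d b)
  d_d : ∀ a : carrier, d (d a) = 0

namespace DGAlgebra

instance : CoeSort DGAlgebra.{u} (Type u) := ⟨carrier⟩

attribute [instance] ring algebra graded

/-- The algebra of elements of degree zero. -/
abbrev degZero (Ω : DGAlgebra.{u}) : Type u := ↥(Ω.gr 0)

/-- The homogeneous elements of degree `k` of the graded centre: those `a` of degree `k` whose
graded commutator with every homogeneous element vanishes. -/
def centreGr (Ω : DGAlgebra.{u}) (k : ℕ) : Submodule ℂ Ω where
  carrier := {a | a ∈ Ω.gr k ∧ ∀ (l : ℕ) (b : Ω), b ∈ Ω.gr l →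
    a * b = (-1 : ℂ) ^ (k * l) • (b * a)}
  zero_mem' := ⟨zero_mem _, fun l b _ => by simp⟩
  add_mem' := by
    rintro a a' ⟨ha, h⟩ ⟨ha', h'⟩
    exact ⟨add_mem ha ha', fun l b hb => by rw [add_mul, mul_add, smul_add, h l b hb, h' l b hb]⟩
  smul_mem' := by
    rintro c a ⟨ha, h⟩
    exact ⟨Submodule.smul_mem _ c ha, fun l b hb => by
      rw [smul_mul_assoc, mul_smul_comm, h l b hb, smul_comm]⟩

theorem mul_mem_centreGr {Ω : DGAlgebra.{u}} {i j : ℕ} {a b : Ω} (ha : a ∈ Ω.centreGr i)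
    (hb : b ∈ Ω.centreGr j) : a * b ∈ Ω.centreGr (i + j) := by
  refine ⟨SetLike.mul_mem_graded ha.1 hb.1, fun l c hc => ?_⟩
  rw [mul_assoc, hb.2 l c hc, mul_smul_comm, ← mul_assoc, ha.2 l c hc, smul_mul_assoc, smul_smul,
    mul_assoc, ← pow_add]
  congr 2
  ring

theorem one_mem_centreGr (Ω : DGAlgebra.{u}) : (1 : Ω) ∈ Ω.centreGr 0 :=
  ⟨SetLike.one_mem_graded _, fun l b _ => by simp⟩

theorem d_mem_centreGr {Ω : DGAlgebra.{u}} {k : ℕ} {a : Ω} (ha : a ∈ Ω.centreGr k) :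
    Ω.d a ∈ Ω.centreGr (k + 1) := by
  refine ⟨Ω.d_mem ha.1, fun l b hb => ?_⟩
  have h1 := Ω.leibniz ha.1 b
  have h2 := Ω.leibniz hb a
  have h3 := ha.2 (l + 1) _ (Ω.d_mem hb)
  rw [ha.2 l b hb, map_smul, h2, h3] at h1
  have h4 : Ω.d a * b = (-1 : ℂ) ^ (k * l) • (Ω.d b * a + (-1 : ℂ) ^ l • (b * Ω.d a)) -
      (-1 : ℂ) ^ k • (-1 : ℂ) ^ (k * (l + 1)) • (Ω.d b * a) := by
    rw [h1]; abel
  have e1 : (-1 : ℂ) ^ k * (-1 : ℂ) ^ (k * (l + 1)) = (-1 : ℂ) ^ (k * l) := by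
    rw [← pow_add, show k + k * (l + 1) = k * l + 2 * k by ring, pow_add, pow_mul (-1 : ℂ) 2 k]
    simp
  rw [h4, smul_smul, e1, smul_add, smul_smul, ← pow_add, add_sub_cancel_left]
  congr 2
  ring

/-- The graded centre `Z_g(Ω)`: the elements all of whose homogeneous components graded-commute
with all homogeneous elements. By bilinearity of the graded commutator, which maps degrees
`(k, l)` to `k + l`, these are the elements whose graded commutator with every element is zero. -/
def centre (Ω : DGAlgebra.{u}) : Submodule ℂ Ω where
  carrier := {a | ∀ k : ℕ, (DirectSum.decompose Ω.gr a k : Ω) ∈ Ω.centreGr k}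
  zero_mem' := fun k => by simp
  add_mem' := fun ha hb k => by
    rw [DirectSum.decompose_add]
    exact add_mem (ha k) (hb k)
  smul_mem' := fun c a ha k => by
    rw [DirectSum.decompose_smul]
    exact Submodule.smul_mem _ c (ha k)

theorem mem_centre_of_mem_gr {Ω : DGAlgebra.{u}} {k : ℕ} {a : Ω} (ha : a ∈ Ω.gr k) :
    a ∈ Ω.centre ↔ a ∈ Ω.centreGr k := by
  constructor
  · intro h
    have := h k
    rwa [DirectSum.decompose_of_mem_same _ ha] at this
  · intro h l
    by_cases hl : k = l
    · subst hl
      rwa [DirectSum.decompose_of_mem_same _ ha]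
    · rw [DirectSum.decompose_of_mem_ne _ ha hl]
      exact zero_mem _

theorem centreGr_le_centre (Ω : DGAlgebra.{u}) (k : ℕ) : Ω.centreGr k ≤ Ω.centre :=
  fun _ ha => (mem_centre_of_mem_gr ha.1).2 ha

theorem centre_eq_iSup (Ω : DGAlgebra.{u}) : Ω.centre = ⨆ k, Ω.centreGr k := by
  classical
  apply le_antisymm
  · intro a ha
    rw [← DirectSum.sum_support_decompose Ω.gr a]
    exact Submodule.sum_mem _ fun k _ => Submodule.mem_iSup_of_mem k (ha k)
  · exact iSup_le Ω.centreGr_le_centre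

theorem mul_mem_centre {Ω : DGAlgebra.{u}} {a b : Ω} (ha : a ∈ Ω.centre) (hb : b ∈ Ω.centre) :
    a * b ∈ Ω.centre := by
  rw [centre_eq_iSup] at ha hb
  induction ha using Submodule.iSup_induction' with
  | mem i x hx =>
    induction hb using Submodule.iSup_induction' with
    | mem j y hy => exact Ω.centreGr_le_centre _ (mul_mem_centreGr hx hy)
    | zero => simp
    | add y y' _ _ h h' => rw [mul_add]; exact add_mem h h'
  | zero => simp
  | add x x' _ _ h h' => rw [add_mul]; exact add_mem h h'

theorem d_mem_centre {Ω : DGAlgebra.{u}} {a : Ω} (ha : a ∈ Ω.centre) : Ω.d a ∈ Ω.centre := by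
  rw [centre_eq_iSup] at ha
  induction ha using Submodule.iSup_induction' with
  | mem i x hx => exact Ω.centreGr_le_centre _ (d_mem_centreGr hx)
  | zero => simp
  | add x x' _ _ h h' => rw [map_add]; exact add_mem h h'

/-- The graded centre as a subalgebra. -/
def centreSubalgebra (Ω : DGAlgebra.{u}) : Subalgebra ℂ Ω where
  carrier := Ω.centre
  mul_mem' := mul_mem_centre
  add_mem' := add_mem
  algebraMap_mem' := fun c => by
    rw [Algebra.algebraMap_eq_smul_one]
    exact Submodule.smul_mem _ c (Ω.centreGr_le_centre 0 Ω.one_mem_centreGr)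

/-- The induced grading on the graded centre. -/
def centreGrading (Ω : DGAlgebra.{u}) (k : ℕ) : Submodule ℂ Ω.centreSubalgebra :=
  (Ω.gr k).comap Ω.centreSubalgebra.val.toLinearMap

instance (Ω : DGAlgebra.{u}) : SetLike.GradedMonoid Ω.centreGrading where
  one_mem := SetLike.one_mem_graded Ω.gr
  mul_mem := fun _ _ _ _ ha hb => SetLike.mul_mem_graded (A := Ω.gr) ha hb

theorem centreGrading_isInternal (Ω : DGAlgebra.{u}) :
    DirectSum.IsInternal Ω.centreGrading := by
  classical
  rw [DirectSum.isInternal_submodule_iff_iSupIndep_and_iSup_eq_top]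
  constructor
  · have h := (DirectSum.Decomposition.isInternal Ω.gr).submodule_iSupIndep
    intro i
    rw [Submodule.disjoint_def]
    intro x hx hx'
    apply Subtype.ext
    refine Submodule.disjoint_def.1 (h i) x.1 hx ?_
    have h1 := Submodule.mem_map_of_mem (f := Ω.centreSubalgebra.val.toLinearMap) hx'
    simp only [Submodule.map_iSup] at h1
    exact iSup₂_mono (fun j _ => Submodule.map_comap_le _ _) h1
  · rw [eq_top_iff]
    rintro ⟨a, ha⟩ -
    have : (⟨a, ha⟩ : Ω.centreSubalgebra) = ∑ k ∈ (DirectSum.decompose Ω.gr a).support,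
        ⟨_, Ω.centreGr_le_centre k (ha k)⟩ := by
      apply Subtype.ext
      rw [AddSubmonoidClass.coe_finsetSum]
      exact (DirectSum.sum_support_decompose Ω.gr a).symm
    rw [this]
    exact Submodule.sum_mem _ fun k _ => Submodule.mem_iSup_of_mem k
      (show _ ∈ Ω.gr k from SetLike.coe_mem _)

noncomputable instance (Ω : DGAlgebra.{u}) : GradedAlgebra Ω.centreGrading where
  __ := Ω.centreGrading_isInternal.chooseDecomposition

/-- The graded centre `Z_g(Ω)` as a differential graded algebra. -/
noncomputable def gradedCentre (Ω : DGAlgebra.{u}) : DGAlgebra.{u} where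
  carrier := Ω.centreSubalgebra
  gr := Ω.centreGrading
  d := Ω.d.restrict fun _ ha => d_mem_centre ha
  d_mem := fun ha => Ω.d_mem ha
  leibniz := fun ha b => Subtype.ext (Ω.leibniz ha b.1)
  d_d := fun a => Subtype.ext (Ω.d_d a.1)

end DGAlgebra

/-! ### `*`-dgas, dense embeddings into `C*`-algebras, and property Q -/

/-- A `*`-dga: a dga with a degree preserving conjugate-linear involution commuting with `d`,
such that `(a b)^* = η ^ (|a| |b|) b^* a^*` for homogeneous `a`, `b`, where `η = ±1` is a fixed
sign. For `η = 1` this reads `(a b)^* = b^* a^*`; complex conjugation of differential forms on a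
manifold satisfies the rule with `η = -1`. -/
structure StarDGAlgebra extends DGAlgebra.{u} where
  conj : carrier →ₗ⋆[ℂ] carrier
  conj_conj : ∀ a : carrier, conj (conj a) = a
  conj_mem : ∀ {n : ℕ} {a : carrier}, a ∈ gr n → conj a ∈ gr n
  conj_mul : ∃ η : ℂ, (η = 1 ∨ η = -1) ∧ ∀ {i j : ℕ} {a b : carrier}, a ∈ gr i → b ∈ gr j →
    conj (a * b) = η ^ (i * j) • (conj b * conj a)
  conj_d : ∀ a : carrier, conj (d a) = d (conj a)

namespace StarDGAlgebra

variable (Ω : StarDGAlgebra.{u})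

instance : StarRing Ω.degZero where
  star a := ⟨Ω.conj a.1, Ω.conj_mem a.2⟩
  star_involutive a := Subtype.ext (Ω.conj_conj a.1)
  star_mul a b := Subtype.ext (by
    obtain ⟨η, -, h⟩ := Ω.conj_mul
    simpa using h a.2 b.2)
  star_add a b := Subtype.ext (map_add Ω.conj a.1 b.1)

instance : StarModule ℂ Ω.degZero where
  star_smul c a := Subtype.ext (Ω.conj.map_smulₛₗ c a.1)

variable {Ω}

theorem conj_mem_centreGr {k : ℕ} {a : Ω.carrier} (ha : a ∈ Ω.centreGr k) :
    Ω.conj a ∈ Ω.centreGr k := by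
  refine ⟨Ω.conj_mem ha.1, fun l b hb => ?_⟩
  obtain ⟨η, hη, h⟩ := Ω.conj_mul
  have hb' := Ω.conj_mem hb
  have h1 := h hb' ha.1
  have h2 := h ha.1 hb'
  rw [ha.2 l _ hb', LinearMap.map_smulₛₗ, h1, Ω.conj_conj, mul_comm l k] at h2
  have hu : η ^ (k * l) ≠ 0 := pow_ne_zero _ (by rcases hη with rfl | rfl <;> norm_num)
  have hs : (starRingEnd ℂ) ((-1 : ℂ) ^ (k * l)) = (-1 : ℂ) ^ (k * l) := by simp
  rw [hs, smul_comm] at h2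
  have h3 := smul_right_injective _ hu h2
  rw [← h3, smul_smul, ← pow_add, ← two_mul, pow_mul]
  simp

theorem conj_mem_centre {a : Ω.carrier} (ha : a ∈ Ω.centre) : Ω.conj a ∈ Ω.centre := by
  rw [DGAlgebra.centre_eq_iSup] at ha
  induction ha using Submodule.iSup_induction' with
  | mem i x hx => exact Ω.centreGr_le_centre _ (conj_mem_centreGr hx)
  | zero => simp
  | add x x' _ _ h h' => rw [map_add]; exact add_mem h h'

variable (Ω)

/-- The graded centre of a `*`-dga, as a `*`-dga. -/
noncomputable def gradedCentre : StarDGAlgebra.{u} where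
  toDGAlgebra := Ω.toDGAlgebra.gradedCentre
  conj :=
    { toFun := fun a => ⟨Ω.conj a.1, conj_mem_centre a.2⟩
      map_add' := fun a b => Subtype.ext (map_add Ω.conj a.1 b.1)
      map_smul' := fun c a => Subtype.ext (Ω.conj.map_smulₛₗ c a.1) }
  conj_conj := fun a => Subtype.ext (Ω.conj_conj a.1)
  conj_mem := fun ha => Ω.conj_mem ha
  conj_mul := by
    obtain ⟨η, hη, h⟩ := Ω.conj_mul
    exact ⟨η, hη, fun ha hb => Subtype.ext (h ha hb)⟩
  conj_d := fun a => Subtype.ext (Ω.conj_d a.1)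

/-- `ι` identifies the degree zero part of the `*`-dga `Ω` with a dense `*`-subalgebra of `A`. -/
structure IsDenseEmbedding {Ω : StarDGAlgebra.{u}} {A : Type v} [CStarAlgebra A]
    (ι : Ω.degZero →⋆ₐ[ℂ] A) : Prop where
  injective : Function.Injective ι
  dense : DenseRange ι

/-- Property Q of a `*`-dga `Ω` whose degree zero part is embedded by `ι` in a `C*`-algebra:
if `a ≥ 0`, `|b i| ≤ a` and `d a = ∑ i, b i * ω i` with `ω i` of degree one, then `a` is zero or
invertible. -/
def PropertyQ {Ω : StarDGAlgebra.{u}} {A : Type v} [CStarAlgebra A] [PartialOrder A]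
    [StarOrderedRing A] (ι : Ω.degZero →⋆ₐ[ℂ] A) : Prop :=
  ∀ (a : Ω.degZero) (s : ℕ) (b : Fin s → Ω.degZero) (ω : Fin s → Ω.gr 1),
    0 ≤ ι a → (∀ i, CFC.abs (ι (b i)) ≤ ι a) →
    Ω.d (a : Ω.carrier) = ∑ i, (b i : Ω.carrier) * (ω i : Ω.carrier) →
    a = 0 ∨ IsUnit a

end StarDGAlgebra

/-! ### Graded bimodules and flat connections -/

/-- A graded bimodule over a dga (the right action of `a` is the action of `op a`). -/
structure GradedBimodule (Ω : DGAlgebra.{u}) where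
  carrier : Type u
  [addCommGroup : AddCommGroup carrier]
  [module : Module ℂ carrier]
  [leftModule : Module Ω carrier]
  [rightModule : Module Ωᵐᵒᵖ carrier]
  [towerLeft : IsScalarTower ℂ Ω carrier]
  [towerRight : IsScalarTower ℂ Ωᵐᵒᵖ carrier]
  [smulComm : SMulCommClass Ω Ωᵐᵒᵖ carrier]
  gr : ℕ → Submodule ℂ carrier
  [decomposition : DirectSum.Decomposition gr]
  smul_mem : ∀ {i j : ℕ} {a : Ω} {x : carrier}, a ∈ Ω.gr i → x ∈ gr j → a • x ∈ gr (i + j)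
  op_smul_mem : ∀ {i j : ℕ} {x : carrier} {a : Ω}, x ∈ gr i → a ∈ Ω.gr j → op a • x ∈ gr (i + j)

namespace GradedBimodule

variable {Ω : DGAlgebra.{u}}

instance : CoeSort (GradedBimodule Ω) (Type u) := ⟨carrier⟩

attribute [instance] addCommGroup module leftModule rightModule towerLeft towerRight smulComm
  decomposition

/-- A graded bimodule `E` is finitely generated projective if `E ⊕ F ≅ Ω ^ n` as graded bimodules
for some graded bimodule `F` and some `n`. -/
def IsFGP (E : GradedBimodule Ω) : Prop :=
  ∃ (F : GradedBimodule Ω) (n : ℕ) (e : (E × F) ≃ₗ[ℂ] (Fin n → Ω)),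
    (∀ (a : Ω) (x : E × F), e (a • x) = a • e x) ∧
    (∀ (a : Ω) (x : E × F), e (op a • x) = op a • e x) ∧
    ∀ (k : ℕ) (x : E) (y : F), (x ∈ E.gr k ∧ y ∈ F.gr k) ↔ ∀ i, e (x, y) i ∈ Ω.gr k

/-- The homogeneous elements of degree `k` of the graded centre of a graded bimodule. -/
def centreGr (E : GradedBimodule Ω) (k : ℕ) : Submodule ℂ E where
  carrier := {x | x ∈ E.gr k ∧ ∀ (l : ℕ) (a : Ω), a ∈ Ω.gr l →
    op a • x = (-1 : ℂ) ^ (k * l) • (a • x)}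
  zero_mem' := ⟨zero_mem _, fun l b _ => by simp⟩
  add_mem' := by
    rintro x x' ⟨hx, h⟩ ⟨hx', h'⟩
    exact ⟨add_mem hx hx', fun l b hb => by
      rw [smul_add, smul_add, smul_add, h l b hb, h' l b hb]⟩
  smul_mem' := by
    rintro c x ⟨hx, h⟩
    refine ⟨Submodule.smul_mem _ c hx, fun l b hb => ?_⟩
    rw [smul_algebra_smul_comm, smul_algebra_smul_comm, h l b hb, smul_comm]

/-- The dga `Ω` as a graded bimodule over itself. -/
noncomputable def regular (Ω : DGAlgebra.{u}) : GradedBimodule Ω where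
  carrier := Ω
  gr := Ω.gr
  smul_mem := fun ha hx => SetLike.mul_mem_graded ha hx
  op_smul_mem := fun hx ha => SetLike.mul_mem_graded hx ha

theorem regular_isFGP (Ω : DGAlgebra.{u}) : (regular Ω).IsFGP := by
  refine ⟨regular Ω, 2, (LinearEquiv.finTwoArrow ℂ Ω).symm, fun a x => ?_, fun a x => ?_,
    fun k x y => ?_⟩
  · ext i; fin_cases i <;> rfl
  · ext i; fin_cases i <;> rfl
  · rw [Fin.forall_fin_two]; rfl

end GradedBimodule

/-- A flat connection: a graded fgp bimodule `E` with a `ℂ`-linear map `∇ : E → E` of degree one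
satisfying the right and left Leibniz rules and `∇ ∘ ∇ = 0`. -/
structure FlatConn (Ω : DGAlgebra.{u}) extends GradedBimodule Ω where
  isFGP : toGradedBimodule.IsFGP
  conn : carrier →ₗ[ℂ] carrier
  conn_mem : ∀ {n : ℕ} {x : carrier}, x ∈ gr n → conn x ∈ gr (n + 1)
  conn_right : ∀ {n : ℕ} {x : carrier}, x ∈ gr n → ∀ a : Ω,
    conn (op a • x) = op a • conn x + (-1 : ℂ) ^ n • (op (Ω.d a) • x)
  conn_left : ∀ {n : ℕ} {a : Ω}, a ∈ Ω.gr n → ∀ x : carrier,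
    conn (a • x) = Ω.d a • x + (-1 : ℂ) ^ n • (a • conn x)
  flat : ∀ x : carrier, conn (conn x) = 0

namespace FlatConn

variable {Ω : DGAlgebra.{u}}

instance : CoeSort (FlatConn Ω) (Type u) := ⟨fun X => X.carrier⟩

/-- Morphisms of flat connections: bimodule maps of degree zero which commute with the
connections. -/
@[ext]
structure Hom (X Y : FlatConn Ω) where
  toLin : X →ₗ[ℂ] Y
  map_smul : ∀ (a : Ω) (x : X), toLin (a • x) = a • toLin x
  map_op_smul : ∀ (a : Ω) (x : X), toLin (op a • x) = op a • toLin x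
  map_mem : ∀ {n : ℕ} {x : X}, x ∈ X.gr n → toLin x ∈ Y.gr n
  map_conn : ∀ x : X, toLin (X.conn x) = Y.conn (toLin x)

/-- The category of graded fgp bimodules with a flat connection. -/
instance : Category.{u} (FlatConn Ω) where
  Hom := Hom
  id X := ⟨LinearMap.id, fun _ _ => rfl, fun _ _ => rfl, fun h => h, fun _ => rfl⟩
  comp f g := ⟨g.toLin ∘ₗ f.toLin, fun a x => by simp [f.map_smul, g.map_smul],
    fun a x => by simp [f.map_op_smul, g.map_op_smul], fun h => g.map_mem (f.map_mem h),
    fun x => by simp [f.map_conn, g.map_conn]⟩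

/-- The `ℂ`-linear map underlying a morphism. -/
def lin {X Y : FlatConn Ω} (f : X ⟶ Y) : X →ₗ[ℂ] Y := Hom.toLin f

theorem lin_injective (X Y : FlatConn Ω) :
    Function.Injective (lin : (X ⟶ Y) → (X →ₗ[ℂ] Y)) := fun _ _ h => Hom.ext h

section Linear

variable (X Y : FlatConn Ω)

instance : Zero (X ⟶ Y) := ⟨(⟨0, fun _ _ => by simp, fun _ _ => by simp, fun _ => zero_mem _,
  fun _ => by simp⟩ : Hom X Y)⟩

instance : Add (X ⟶ Y) := ⟨fun f g => (⟨lin f + lin g,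
  fun a x => by simp [lin, Hom.map_smul], fun a x => by simp [lin, Hom.map_op_smul],
  fun h => add_mem (Hom.map_mem f h) (Hom.map_mem g h),
  fun x => by simp [lin, Hom.map_conn]⟩ : Hom X Y)⟩

instance : Neg (X ⟶ Y) := ⟨fun f => (⟨-lin f,
  fun a x => by simp [lin, Hom.map_smul], fun a x => by simp [lin, Hom.map_op_smul],
  fun h => neg_mem (Hom.map_mem f h), fun x => by simp [lin, Hom.map_conn]⟩ : Hom X Y)⟩

instance : Sub (X ⟶ Y) := ⟨fun f g => (⟨lin f - lin g,
  fun a x => by simp [lin, Hom.map_smul, smul_sub],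
  fun a x => by simp [lin, Hom.map_op_smul, smul_sub],
  fun h => sub_mem (Hom.map_mem f h) (Hom.map_mem g h),
  fun x => by simp [lin, Hom.map_conn]⟩ : Hom X Y)⟩

instance : SMul ℂ (X ⟶ Y) := ⟨fun c f => (⟨c • lin f,
  fun a x => by simp [lin, Hom.map_smul, smul_algebra_smul_comm],
  fun a x => by simp [lin, Hom.map_op_smul, smul_algebra_smul_comm],
  fun h => Submodule.smul_mem _ c (Hom.map_mem f h),
  fun x => by simp [lin, Hom.map_conn]⟩ : Hom X Y)⟩

instance : AddCommGroup (X ⟶ Y) :=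
  letI : SMul ℕ (X ⟶ Y) := ⟨fun n f => (n : ℂ) • f⟩
  letI : SMul ℤ (X ⟶ Y) := ⟨fun n f => (n : ℂ) • f⟩
  Function.Injective.addCommGroup lin (lin_injective X Y) rfl (fun _ _ => rfl) (fun _ => rfl)
    (fun _ _ => rfl) (fun f n => Nat.cast_smul_eq_nsmul ℂ n (lin f))
    (fun f n => Int.cast_smul_eq_zsmul ℂ n (lin f))

instance homModule : Module ℂ (X ⟶ Y) :=
  Function.Injective.module ℂ ⟨⟨lin, rfl⟩, fun _ _ => rfl⟩ (lin_injective X Y) (fun _ _ => rfl)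

end Linear

instance : Preadditive (FlatConn Ω) where
  homGroup _ _ := inferInstance
  add_comp _ _ _ f f' g := Hom.ext (LinearMap.comp_add (lin f) (lin f') (lin g))
  comp_add _ _ _ f g g' := Hom.ext (LinearMap.add_comp (lin f) (lin g') (lin g))

instance : Linear ℂ (FlatConn Ω) where
  homModule := homModule
  smul_comp _ _ _ c f g := Hom.ext (LinearMap.comp_smul (lin g) c (lin f))
  comp_smul _ _ _ f c g := Hom.ext (LinearMap.smul_comp c (lin g) (lin f))

/-- The unit object `(Ω, d)`. -/
noncomputable def unit (Ω : DGAlgebra.{u}) : FlatConn Ω where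
  toGradedBimodule := GradedBimodule.regular Ω
  isFGP := GradedBimodule.regular_isFGP Ω
  conn := Ω.d
  conn_mem := Ω.d_mem
  conn_right := fun hx a => Ω.leibniz hx a
  conn_left := Ω.leibniz
  flat := Ω.d_d

/-! ### The tensor product of flat connections -/

/-- A symmetric monoidal structure on the category of flat connections is standard if
* the unit object is `(Ω, d)`, via an isomorphism `unitIso`;
* `X ⊗ Y` is the tensor product of `X` and `Y` over `Ω`: `tmul x y` stands for the class of
  `x ⊗ y`, and `tmul` identifies the quotient of `X ⊗_ℂ Y` by the span of all
  `x a ⊗ y - x ⊗ a y` with the object `X ⊗ Y`; the actions of `Ω`, the grading and the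
  connection are the usual ones;
* tensor products of morphisms, associators and unitors are the usual ones;
* the symmetry maps `x ⊗ y` to `(-1) ^ (|x| |y|) y ⊗ x` for homogeneous `x`, `y` in the graded
  centres. -/
structure StandardTensor (Ω : DGAlgebra.{u}) [MonoidalCategory (FlatConn Ω)]
    [SymmetricCategory (FlatConn Ω)] where
  unitIso : unit Ω ≅ 𝟙_ (FlatConn Ω)
  tmul : ∀ X Y : FlatConn Ω, X →ₗ[ℂ] Y →ₗ[ℂ] (MonoidalCategory.tensorObj X Y : FlatConn Ω)
  tmul_surjective : ∀ X Y : FlatConn Ω, Function.Surjective (TensorProduct.lift (tmul X Y))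
  ker_tmul : ∀ X Y : FlatConn Ω, LinearMap.ker (TensorProduct.lift (tmul X Y)) =
    Submodule.span ℂ {t | ∃ (x : X) (a : Ω) (y : Y),
      t = (op a • x) ⊗ₜ[ℂ] y - x ⊗ₜ[ℂ] (a • y)}
  smul_tmul : ∀ (X Y : FlatConn Ω) (a : Ω) (x : X) (y : Y), a • tmul X Y x y = tmul X Y (a • x) y
  op_smul_tmul : ∀ (X Y : FlatConn Ω) (a : Ω) (x : X) (y : Y),
    op a • tmul X Y x y = tmul X Y x (op a • y)
  tmul_mem : ∀ (X Y : FlatConn Ω) {i j : ℕ} {x : X} {y : Y}, x ∈ X.gr i → y ∈ Y.gr j →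
    tmul X Y x y ∈ (MonoidalCategory.tensorObj X Y : FlatConn Ω).gr (i + j)
  conn_tmul : ∀ (X Y : FlatConn Ω) {i : ℕ} {x : X}, x ∈ X.gr i → ∀ y : Y,
    (MonoidalCategory.tensorObj X Y : FlatConn Ω).conn (tmul X Y x y) =
      tmul X Y (X.conn x) y + (-1 : ℂ) ^ i • tmul X Y x (Y.conn y)
  tensorHom_tmul : ∀ {X X' Y Y' : FlatConn Ω} (f : X ⟶ X') (g : Y ⟶ Y') (x : X) (y : Y),
    lin (MonoidalCategory.tensorHom f g) (tmul X Y x y) = tmul X' Y' (lin f x) (lin g y)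
  associator_tmul : ∀ (X Y W : FlatConn Ω) (x : X) (y : Y) (w : W),
    lin (α_ X Y W).hom (tmul _ W (tmul X Y x y) w) = tmul X _ x (tmul Y W y w)
  leftUnitor_tmul : ∀ (X : FlatConn Ω) (a : Ω) (x : X),
    lin (λ_ X).hom (tmul _ X (lin unitIso.hom a) x) = a • x
  rightUnitor_tmul : ∀ (X : FlatConn Ω) (x : X) (a : Ω),
    lin (ρ_ X).hom (tmul X _ x (lin unitIso.hom a)) = op a • x
  braiding_tmul : ∀ (X Y : FlatConn Ω) {i j : ℕ} {x : X} {y : Y}, x ∈ X.centreGr i →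
    y ∈ Y.centreGr j → lin (β_ X Y).hom (tmul X Y x y) = (-1 : ℂ) ^ (i * j) • tmul Y X y x

end FlatConn

/-! ### Neutral Tannakian categories -/

/-- A (neutral) fibre functor: a faithful exact `ℂ`-linear symmetric monoidal functor to
finite-dimensional vector spaces. -/
structure FibreFunctor (C : Type w) [Category.{u} C] [Preadditive C] [Linear ℂ C]
    [MonoidalCategory C] [SymmetricCategory C] where
  functor : C ⥤ FGModuleCat.{0} ℂ
  [braided : functor.Braided]
  [additive : functor.Additive]
  [linear : functor.Linear ℂ]
  [faithful : functor.Faithful]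
  [preservesFiniteLimits : Limits.PreservesFiniteLimits functor]
  [preservesFiniteColimits : Limits.PreservesFiniteColimits functor]

attribute [instance] FibreFunctor.braided FibreFunctor.additive FibreFunctor.linear
  FibreFunctor.faithful FibreFunctor.preservesFiniteLimits FibreFunctor.preservesFiniteColimits

/-- A neutral Tannakian category over `ℂ`: a rigid abelian `ℂ`-linear symmetric monoidal category
with `ℂ`-bilinear tensor product and `End(𝟙) = ℂ` which has a fibre functor. -/
structure IsNeutralTannakian (C : Type w) [Category.{u} C] [P : Preadditive C] [Linear ℂ C]
    [MonoidalCategory C] [SymmetricCategory C] : Prop where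
  abelian : ∃ a : Abelian C, a.toPreadditive = P
  rigid : Nonempty (RigidCategory C)
  monoidalPreadditive : MonoidalPreadditive C
  monoidalLinear : MonoidalLinear ℂ C
  end_unit : Function.Bijective (fun c : ℂ => c • 𝟙 (𝟙_ C))
  fibreFunctor : Nonempty (FibreFunctor C)

namespace FibreFunctor

variable {C : Type w} [Category.{u} C] [Preadditive C] [Linear ℂ C] [MonoidalCategory C]
  [SymmetricCategory C] (ω : FibreFunctor C)

/-- The vector space `ω(X)`. -/
abbrev fib (X : C) : Type := ω.functor.obj X

/-- The linear map `ω(f)`. -/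
def map {X Y : C} (f : X ⟶ Y) : ω.fib X →ₗ[ℂ] ω.fib Y := (ω.functor.map f).hom.hom

/-- The bilinear map `ω(X) × ω(Y) → ω(X ⊗ Y)` of the tensor functor `ω`. -/
def mul (X Y : C) : ω.fib X →ₗ[ℂ] ω.fib Y →ₗ[ℂ] ω.fib (MonoidalCategory.tensorObj X Y) :=
  TensorProduct.curry (Functor.LaxMonoidal.μ ω.functor X Y).hom.hom

/-- The image of `1` under the isomorphism `ℂ → ω(𝟙)` of the tensor functor `ω`. -/
def one : ω.fib (𝟙_ C) := (Functor.LaxMonoidal.ε ω.functor).hom.hom (1 : ℂ)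

end FibreFunctor

/-! ### Fundamental group -/

section BaseChange

variable {R S T : Type v} [CommRing R] [Algebra ℂ R] [CommRing S] [Algebra ℂ S]
  [CommRing T] [Algebra ℂ T] {V W : Type} [AddCommGroup V] [Module ℂ V]
  [AddCommGroup W] [Module ℂ W]

/-- The map `R ⊗ V → S ⊗ V` induced by a homomorphism `R → S`. -/
def scalarMap (V : Type) [AddCommGroup V] [Module ℂ V] (φ : R →ₐ[ℂ] S) :
    R ⊗[ℂ] V →ₗ[ℂ] S ⊗[ℂ] V := LinearMap.rTensor V φ.toLinearMap

theorem scalarMap_smul (φ : R →ₐ[ℂ] S) (r : R) (u : R ⊗[ℂ] V) :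
    scalarMap V φ (r • u) = φ r • scalarMap V φ u := by
  induction u using TensorProduct.induction_on with
  | zero => simp
  | tmul a v => simp [scalarMap, TensorProduct.smul_tmul']
  | add x y hx hy => rw [smul_add, map_add, hx, hy, map_add, smul_add]

/-- The extension of scalars along `R → S` of an `R`-linear map `R ⊗ V → R ⊗ W`. -/
noncomputable def extendScalars (φ : R →ₐ[ℂ] S) (g : R ⊗[ℂ] V →ₗ[R] R ⊗[ℂ] W) :
    S ⊗[ℂ] V →ₗ[S] S ⊗[ℂ] W :=
  LinearMap.liftBaseChange S
    (scalarMap W φ ∘ₗ g.restrictScalars ℂ ∘ₗ TensorProduct.mk ℂ R V 1)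

theorem extendScalars_scalarMap (φ : R →ₐ[ℂ] S) (g : R ⊗[ℂ] V →ₗ[R] R ⊗[ℂ] W)
    (u : R ⊗[ℂ] V) : extendScalars φ g (scalarMap V φ u) = scalarMap W φ (g u) := by
  induction u using TensorProduct.induction_on with
  | zero => simp
  | tmul r v =>
    have : r ⊗ₜ[ℂ] v = r • ((1 : R) ⊗ₜ[ℂ] v) := by simp [TensorProduct.smul_tmul']
    rw [this, scalarMap_smul, map_smul, map_smul, scalarMap_smul]
    simp [scalarMap, extendScalars]
  | add x y hx hy => simp only [map_add, hx, hy]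

theorem linearMap_ext_scalarMap (φ : R →ₐ[ℂ] S) {M : Type*} [AddCommGroup M] [Module S M]
    {f g : S ⊗[ℂ] V →ₗ[S] M} (h : ∀ u, f (scalarMap V φ u) = g (scalarMap V φ u)) : f = g := by
  have h1 : ∀ v : V, f ((1 : S) ⊗ₜ[ℂ] v) = g ((1 : S) ⊗ₜ[ℂ] v) := fun v => by
    simpa [scalarMap] using h ((1 : R) ⊗ₜ[ℂ] v)
  refine LinearMap.ext fun u => ?_
  induction u using TensorProduct.induction_on with
  | zero => simp
  | add x y hx hy => rw [map_add, map_add, hx, hy]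
  | tmul s v =>
    have : s ⊗ₜ[ℂ] v = s • ((1 : S) ⊗ₜ[ℂ] v) := by simp [TensorProduct.smul_tmul']
    rw [this, map_smul, map_smul, h1]

/-- The extension of scalars along `R → S` of an automorphism of `R ⊗ V`. -/
noncomputable def extendScalarsEquiv (φ : R →ₐ[ℂ] S) (g : (R ⊗[ℂ] V) ≃ₗ[R] (R ⊗[ℂ] V)) :
    (S ⊗[ℂ] V) ≃ₗ[S] (S ⊗[ℂ] V) :=
  LinearEquiv.ofLinearMap (extendScalars φ g.toLinearMap) (extendScalars φ g.symm.toLinearMap)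
    (linearMap_ext_scalarMap φ fun u => by simp [extendScalars_scalarMap])
    (linearMap_ext_scalarMap φ fun u => by simp [extendScalars_scalarMap])

theorem extendScalarsEquiv_scalarMap (φ : R →ₐ[ℂ] S) (g : (R ⊗[ℂ] V) ≃ₗ[R] (R ⊗[ℂ] V))
    (u : R ⊗[ℂ] V) : extendScalarsEquiv φ g (scalarMap V φ u) = scalarMap V φ (g u) :=
  extendScalars_scalarMap φ _ u

theorem linearEquiv_ext_scalarMap (φ : R →ₐ[ℂ] S) {f g : (S ⊗[ℂ] V) ≃ₗ[S] (S ⊗[ℂ] V)}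
    (h : ∀ u, f (scalarMap V φ u) = g (scalarMap V φ u)) : f = g :=
  LinearEquiv.toLinearMap_injective (linearMap_ext_scalarMap φ h)

theorem extendScalarsEquiv_id (g : (R ⊗[ℂ] V) ≃ₗ[R] (R ⊗[ℂ] V)) :
    extendScalarsEquiv (AlgHom.id ℂ R) g = g :=
  linearEquiv_ext_scalarMap (AlgHom.id ℂ R) fun u => by
    have h : ∀ w : R ⊗[ℂ] V, scalarMap V (AlgHom.id ℂ R) w = w :=
      fun w => LinearMap.rTensor_id_apply _ _ w
    rw [extendScalarsEquiv_scalarMap, h, h]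

theorem extendScalarsEquiv_comp (φ : R →ₐ[ℂ] S) (ψ : S →ₐ[ℂ] T)
    (g : (R ⊗[ℂ] V) ≃ₗ[R] (R ⊗[ℂ] V)) :
    extendScalarsEquiv (ψ.comp φ) g = extendScalarsEquiv ψ (extendScalarsEquiv φ g) :=
  linearEquiv_ext_scalarMap (ψ.comp φ) fun u => by
    have h : ∀ w : R ⊗[ℂ] V, scalarMap V (ψ.comp φ) w = scalarMap V ψ (scalarMap V φ w) :=
      fun w => by
        induction w using TensorProduct.induction_on with
        | zero => simp
        | tmul r v => simp [scalarMap]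
        | add x y hx hy => simp only [map_add, hx, hy]
    calc extendScalarsEquiv (ψ.comp φ) g (scalarMap V (ψ.comp φ) u)
        = scalarMap V (ψ.comp φ) (g u) := extendScalarsEquiv_scalarMap (ψ.comp φ) g u
      _ = scalarMap V ψ (scalarMap V φ (g u)) := h (g u)
      _ = scalarMap V ψ (extendScalarsEquiv φ g (scalarMap V φ u)) := by
        rw [extendScalarsEquiv_scalarMap φ g u]
      _ = extendScalarsEquiv ψ (extendScalarsEquiv φ g) (scalarMap V ψ (scalarMap V φ u)) :=
        (extendScalarsEquiv_scalarMap ψ (extendScalarsEquiv φ g) (scalarMap V φ u)).symm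
      _ = extendScalarsEquiv ψ (extendScalarsEquiv φ g) (scalarMap V (ψ.comp φ) u) := by
        rw [h u]

end BaseChange

namespace FibreFunctor

variable {C : Type w} [Category.{u} C] [Preadditive C] [Linear ℂ C] [MonoidalCategory C]
  [SymmetricCategory C] (ω : FibreFunctor C)

/-- The `R`-bilinear map `(R ⊗ ω(X)) × (R ⊗ ω(Y)) → R ⊗ ω(X ⊗ Y)`, given by
`(r ⊗ x, s ⊗ y) ↦ r s ⊗ x y`. -/
noncomputable def mulBaseChange (R : Type v) [CommRing R] [Algebra ℂ R] (X Y : C) :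
    R ⊗[ℂ] ω.fib X →ₗ[R] R ⊗[ℂ] ω.fib Y →ₗ[R]
      R ⊗[ℂ] ω.fib (MonoidalCategory.tensorObj X Y) :=
  TensorProduct.curry ((TensorProduct.lift (ω.mul X Y)).baseChange R ∘ₗ
    (TensorProduct.AlgebraTensorModule.distribBaseChange ℂ R (ω.fib X) (ω.fib Y)).symm.toLinearMap)

theorem mulBaseChange_tmul (R : Type v) [CommRing R] [Algebra ℂ R] (X Y : C) (r s : R)
    (x : ω.fib X) (y : ω.fib Y) :
    ω.mulBaseChange R X Y (r ⊗ₜ x) (s ⊗ₜ y) = (r * s) ⊗ₜ ω.mul X Y x y := by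
  simp [mulBaseChange, TensorProduct.AlgebraTensorModule.distribBaseChange, TensorProduct.smul_tmul',
    mul_comm]

theorem scalarMap_mulBaseChange {R S : Type v} [CommRing R] [Algebra ℂ R] [CommRing S]
    [Algebra ℂ S] (φ : R →ₐ[ℂ] S) (X Y : C) (x : R ⊗[ℂ] ω.fib X) (y : R ⊗[ℂ] ω.fib Y) :
    scalarMap _ φ (ω.mulBaseChange R X Y x y) =
      ω.mulBaseChange S X Y (scalarMap _ φ x) (scalarMap _ φ y) := by
  induction x using TensorProduct.induction_on with
  | zero => simp
  | add x x' h h' => simp only [map_add, LinearMap.add_apply, h, h']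
  | tmul r x =>
    induction y using TensorProduct.induction_on with
    | zero => simp
    | add y y' h h' => simp only [map_add, h, h']
    | tmul s y =>
      rw [mulBaseChange_tmul]
      simp only [scalarMap, LinearMap.rTensor_tmul]
      rw [mulBaseChange_tmul]
      simp

/-- The group `Aut^⊗(ω)(R)` of `R`-linear automorphisms of the functor `X ↦ R ⊗ ω(X)` which are
compatible with the tensor products. -/
def tensorAutSubgroup (R : Type v) [CommRing R] [Algebra ℂ R] :
    Subgroup (∀ X : C, (R ⊗[ℂ] ω.fib X) ≃ₗ[R] (R ⊗[ℂ] ω.fib X)) where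
  carrier := {g |
    (∀ (X Y : C) (f : X ⟶ Y) (u : R ⊗[ℂ] ω.fib X),
      g Y ((ω.map f).baseChange R u) = (ω.map f).baseChange R (g X u)) ∧
    (∀ (X Y : C) (x : R ⊗[ℂ] ω.fib X) (y : R ⊗[ℂ] ω.fib Y),
      g _ (ω.mulBaseChange R X Y x y) = ω.mulBaseChange R X Y (g X x) (g Y y)) ∧
    g (𝟙_ C) (1 ⊗ₜ ω.one) = 1 ⊗ₜ ω.one}
  one_mem' := ⟨fun _ _ _ _ => rfl, fun _ _ _ _ => rfl, rfl⟩
  mul_mem' := by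
    rintro g h ⟨g1, g2, g3⟩ ⟨h1, h2, h3⟩
    refine ⟨fun X Y f u => ?_, fun X Y x y => ?_, ?_⟩
    · simp only [Pi.mul_apply, LinearEquiv.mul_apply, h1, g1]
    · simp only [Pi.mul_apply, LinearEquiv.mul_apply, h2, g2]
    · simp only [Pi.mul_apply, LinearEquiv.mul_apply, h3, g3]
  inv_mem' := by
    rintro g ⟨g1, g2, g3⟩
    refine ⟨fun X Y f u => ?_, fun X Y x y => ?_, ?_⟩
    · change (g Y).symm _ = LinearMap.baseChange R _ ((g X).symm u)
      rw [LinearEquiv.symm_apply_eq, g1, LinearEquiv.apply_symm_apply]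
    · change (g _).symm _ = ω.mulBaseChange R X Y ((g X).symm x) ((g Y).symm y)
      rw [LinearEquiv.symm_apply_eq, g2, LinearEquiv.apply_symm_apply,
        LinearEquiv.apply_symm_apply]
    · change (g _).symm _ = _
      rw [LinearEquiv.symm_apply_eq, g3]

theorem scalarMap_baseChange {R S : Type v} [CommRing R] [Algebra ℂ R] [CommRing S]
    [Algebra ℂ S] (φ : R →ₐ[ℂ] S) {V W : Type} [AddCommGroup V] [Module ℂ V] [AddCommGroup W]
    [Module ℂ W] (f : V →ₗ[ℂ] W) (u : R ⊗[ℂ] V) :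
    scalarMap W φ (f.baseChange R u) = f.baseChange S (scalarMap V φ u) := by
  induction u using TensorProduct.induction_on with
  | zero => simp
  | add x x' h h' => simp only [map_add, h, h']
  | tmul r x => simp [scalarMap]

/-- Extension of scalars `Aut^⊗(ω)(R) → Aut^⊗(ω)(S)` along `R → S`. -/
noncomputable def tensorAutMap {R S : Type v} [CommRing R] [Algebra ℂ R] [CommRing S]
    [Algebra ℂ S] (φ : R →ₐ[ℂ] S) : ω.tensorAutSubgroup R →* ω.tensorAutSubgroup S where
  toFun g := ⟨fun X => extendScalarsEquiv φ (g.1 X), by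
    obtain ⟨g, g1, g2, g3⟩ := g
    refine ⟨fun X Y f u => ?_, fun X Y x y => ?_, ?_⟩
    · refine LinearMap.congr_fun (f := (extendScalarsEquiv φ (g Y)).toLinearMap ∘ₗ
        (ω.map f).baseChange S) (g := (ω.map f).baseChange S ∘ₗ
        (extendScalarsEquiv φ (g X)).toLinearMap) (linearMap_ext_scalarMap φ fun u => ?_) u
      simp only [LinearMap.comp_apply, LinearEquiv.coe_coe]
      rw [← scalarMap_baseChange, extendScalarsEquiv_scalarMap, extendScalarsEquiv_scalarMap,
        g1, scalarMap_baseChange]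
    · refine LinearMap.congr_fun₂ (f := (ω.mulBaseChange S X Y).compr₂
        (extendScalarsEquiv φ (g _)).toLinearMap) (g := (ω.mulBaseChange S X Y).compl₁₂
        (extendScalarsEquiv φ (g X)).toLinearMap (extendScalarsEquiv φ (g Y)).toLinearMap)
        (linearMap_ext_scalarMap φ fun x => linearMap_ext_scalarMap φ fun y => ?_) x y
      simp only [LinearMap.compr₂_apply, LinearMap.compl₁₂_apply, LinearEquiv.coe_coe]
      rw [← scalarMap_mulBaseChange, extendScalarsEquiv_scalarMap, extendScalarsEquiv_scalarMap,
        extendScalarsEquiv_scalarMap, g2, scalarMap_mulBaseChange]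
    · have h : (1 : S) ⊗ₜ[ℂ] ω.one = scalarMap _ φ (1 ⊗ₜ ω.one) := by simp [scalarMap]
      rw [h, extendScalarsEquiv_scalarMap, g3]⟩
  map_one' := Subtype.ext <| funext fun X => linearEquiv_ext_scalarMap φ fun u => by
    rw [extendScalarsEquiv_scalarMap]; rfl
  map_mul' g h := Subtype.ext <| funext fun X => linearEquiv_ext_scalarMap φ fun u => by
    change _ = extendScalarsEquiv φ (g.1 X) (extendScalarsEquiv φ (h.1 X) _)
    rw [extendScalarsEquiv_scalarMap, extendScalarsEquiv_scalarMap, extendScalarsEquiv_scalarMap]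
    rfl

/-- The group functor `Aut^⊗(ω) : R ↦ Aut^⊗(ω)(R)` of tensor automorphisms of `ω` on commutative
`ℂ`-algebras. -/
noncomputable def tensorAut : CommAlgCat.{v} ℂ ⥤ GrpCat where
  obj R := GrpCat.of (ω.tensorAutSubgroup R)
  map φ := GrpCat.ofHom (ω.tensorAutMap φ.hom)
  map_id _ := GrpCat.hom_ext <| MonoidHom.ext fun g => Subtype.ext <| funext fun X =>
    extendScalarsEquiv_id (g.1 X)
  map_comp φ ψ := GrpCat.hom_ext <| MonoidHom.ext fun g => Subtype.ext <| funext fun X =>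
    extendScalarsEquiv_comp φ.hom ψ.hom (g.1 X)

end FibreFunctor

/-! ### Localisation at a point -/

section Localisation

variable (Ω : DGAlgebra.{u})

/-- The degree zero part `Z_g(Ω)^0` of the graded centre. -/
abbrev CentreZero : Type u := Ω.gradedCentre.degZero

variable {Ω}

/-- The inclusion of `Z_g(Ω)^0` in `Ω`. -/
def CentreZero.val (z : CentreZero Ω) : Ω := Subtype.val (p := (· ∈ Ω.centreSubalgebra)) z.1

theorem CentreZero.val_mem (z : CentreZero Ω) : z.val ∈ Ω.centreGr 0 :=
  (DGAlgebra.mem_centre_of_mem_gr (show z.val ∈ Ω.gr 0 from z.2)).1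
    (Subtype.property (p := (· ∈ Ω.centreSubalgebra)) z.1)

theorem CentreZero.val_comm (z : CentreZero Ω) {l : ℕ} {a : Ω} (ha : a ∈ Ω.gr l) :
    z.val * a = a * z.val := by
  simpa using z.val_mem.2 l a ha

noncomputable instance : CommRing (CentreZero Ω) where
  __ := (inferInstance : Ring (CentreZero Ω))
  mul_comm a b := Subtype.ext <| Subtype.ext <| a.val_comm b.val_mem.1

noncomputable instance (X : GradedBimodule Ω) : Module (CentreZero Ω) (X.centreGr 0) where
  smul z x := ⟨z.val • (x : X), by
    refine ⟨by simpa using X.smul_mem z.val_mem.1 x.2.1, fun l a ha => ?_⟩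
    have hx := x.2.2 l a ha
    simp only [zero_mul, pow_zero, one_smul] at hx ⊢
    rw [← smul_comm z.val (op a) (x : X), hx, smul_smul, z.val_comm ha, smul_smul]⟩
  one_smul x := Subtype.ext (one_smul Ω (x : X))
  mul_smul z z' x := Subtype.ext (mul_smul z.val z'.val (x : X))
  smul_zero z := Subtype.ext (smul_zero z.val)
  smul_add z x y := Subtype.ext (smul_add z.val (x : X) y)
  add_smul z z' x := Subtype.ext (add_smul z.val z'.val (x : X))
  zero_smul x := Subtype.ext (zero_smul Ω (x : X))

/-- The field `ℂ`, on which `Z_g(Ω)^0` acts through the character `p`. -/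
def CharField (_ : CentreZero Ω →ₐ[ℂ] ℂ) : Type := ℂ

section

variable (p : CentreZero Ω →ₐ[ℂ] ℂ)

noncomputable instance : Field (CharField p) := inferInstanceAs (Field ℂ)

noncomputable instance : Module ℂ (CharField p) := inferInstanceAs (Module ℂ ℂ)

noncomputable instance : Module (CentreZero Ω) (CharField p) := Module.compHom ℂ p.toRingHom

instance : SMulCommClass (CentreZero Ω) ℂ (CharField p) :=
  ⟨fun z c x => mul_left_comm (p z : ℂ) c x⟩

/-- The localisation `ℂ_p ⊗ Z_g(X)^0` of the centre of `X` at the character `p`. -/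
abbrev LocalFibre (X : FlatConn Ω) : Type u :=
  CharField p ⊗[CentreZero Ω] X.centreGr 0

end

/-- The value `1 ⊗ x` at `p` of a central element `x` of degree zero. -/
noncomputable def germ (p : CentreZero Ω →ₐ[ℂ] ℂ) (X : FlatConn Ω) (x : X.centreGr 0) :
    LocalFibre p X := (1 : CharField p) ⊗ₜ x

namespace FlatConn

theorem lin_mem_centreGr {X Y : FlatConn Ω} (f : X ⟶ Y) {k : ℕ} {x : X}
    (hx : x ∈ X.centreGr k) : lin f x ∈ Y.centreGr k := by
  refine ⟨Hom.map_mem f hx.1, fun l a ha => ?_⟩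
  have h := congrArg (lin f) (hx.2 l a ha)
  rw [LinearMap.map_smul] at h
  exact (Hom.map_op_smul f a x).symm.trans (h.trans (congrArg _ (Hom.map_smul f a x)))

/-- The action of a morphism on the central elements of degree zero. -/
def centreMap {X Y : FlatConn Ω} (f : X ⟶ Y) (x : X.centreGr 0) : Y.centreGr 0 :=
  ⟨lin f x, lin_mem_centreGr f x.2⟩

variable [MonoidalCategory (FlatConn Ω)] [SymmetricCategory (FlatConn Ω)]

/-- The element `1` of the unit object `(Ω, d)`. -/
noncomputable def StandardTensor.centreOne (T : StandardTensor Ω) :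
    (𝟙_ (FlatConn Ω)).centreGr 0 :=
  centreMap T.unitIso.hom ⟨(1 : Ω), SetLike.one_mem_graded Ω.gr,
    fun l a _ => by
      change (1 : Ω) * a = (-1 : ℂ) ^ (0 * l) • (a * (1 : Ω))
      rw [zero_mul, pow_zero, one_smul, one_mul, mul_one]⟩

/-- The element `x ⊗ y`, for central elements `x` and `y` of degree zero. -/
def StandardTensor.centreTmul (T : StandardTensor Ω) {X Y : FlatConn Ω} (x : X.centreGr 0)
    (y : Y.centreGr 0) : (MonoidalCategory.tensorObj X Y : FlatConn Ω).centreGr 0 :=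
  ⟨T.tmul X Y x y, T.tmul_mem X Y x.2.1 y.2.1, fun l a ha => by
    have hx := x.2.2 l a ha
    have hy := y.2.2 l a ha
    have hb : T.tmul X Y (op a • (x : X)) y = T.tmul X Y x (a • (y : Y)) := by
      have h : (op a • (x : X)) ⊗ₜ[ℂ] (y : Y) - (x : X) ⊗ₜ[ℂ] (a • (y : Y)) ∈
          LinearMap.ker (TensorProduct.lift (T.tmul X Y)) := by
        rw [T.ker_tmul]
        exact Submodule.subset_span ⟨x, a, y, rfl⟩
      rw [LinearMap.mem_ker, map_sub, TensorProduct.lift.tmul, TensorProduct.lift.tmul] at h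
      exact sub_eq_zero.1 h
    simp only [zero_mul, pow_zero, one_smul] at hx hy ⊢
    rw [T.op_smul_tmul, hy, ← hb, hx, T.smul_tmul]⟩

/-- The fibre functor `ω` is the localisation at `p`: there are isomorphisms
`θ X : ω(X) ≃ ℂ_p ⊗ Z_g(X)^0`, natural in `X` and compatible with the tensor structures, where
the localisations carry the tensor structure `(1 ⊗ x, 1 ⊗ y) ↦ 1 ⊗ (x ⊗ y)`. -/
def StandardTensor.IsLocalisationAt (T : StandardTensor Ω) (p : CentreZero Ω →ₐ[ℂ] ℂ)
    (ω : FibreFunctor (FlatConn Ω)) : Prop :=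
  ∃ θ : ∀ X : FlatConn Ω, ω.fib X ≃ₗ[ℂ] LocalFibre p X,
    (∀ (X Y : FlatConn Ω) (f : X ⟶ Y) (x : X.centreGr 0),
      θ Y (ω.map f ((θ X).symm (germ p X x))) = germ p Y (centreMap f x)) ∧
    (∀ (X Y : FlatConn Ω) (x : X.centreGr 0) (y : Y.centreGr 0),
      θ _ (ω.mul X Y ((θ X).symm (germ p X x)) ((θ Y).symm (germ p Y y))) =
        germ p _ (T.centreTmul x y)) ∧
    θ _ ω.one = germ p _ T.centreOne

end FlatConn

end Localisation

/-- The character of `Z_g(Ω)^0` given by a point `p` of the Gelfand spectrum of the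
`C*`-algebra `B` in which `Z_g(Ω)^0` is embedded by `ι`. -/
noncomputable def charAt {Ω : StarDGAlgebra.{u}} {B : Type v} [CommCStarAlgebra B]
    (ι : Ω.gradedCentre.degZero →⋆ₐ[ℂ] B) (p : WeakDual.characterSpace ℂ B) :
    CentreZero Ω.toDGAlgebra →ₐ[ℂ] ℂ :=
  (WeakDual.CharacterSpace.toAlgHom p).comp ι.toAlgHom

end FlatBimod

/-! Write Z for the degree zero part of the graded centre and Z¹ for its degree one part. An fgp
graded bimodule is a summand of some Ω^n, so it is generated by central elements of degree zero (the
images of the standard basis), with coordinate functions that are bimodule maps (`DualBasis`).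
Bimodule maps of degree zero therefore become matrices over the commutative ring Z. A morphism of
flat connections satisfies one more condition: its matrix f obeys df = fΓ + θf with Γ, θ over Z¹
(`FlatConn.diff_matrix`).

This equation makes every ideal of minors stable, d I_k(f) ⊆ I_k(f) Z¹
(`Matrix.derivation_minorIdeal`). Property Q excludes nontrivial finitely generated stable ideals:
for I = (m_i), apply it to a = ∑ m_i^* m_i (`isDiffSimple_of_propertyQ`). So each I_k(f) is 0 or Z,
which says that f has constant rank, and the adjugates of its largest nonvanishing minors assemble
to a matrix g with f g f = f (`Matrix.exists_generalised_inverse`). The idempotents g f and f g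
split off kernel and cokernel as direct summands, hence as fgp bimodules; compressing ∇ to them
gives flat connections. The category is abelian, although g itself need not commute with the
connections.

The fibre at a character p is the image of the idempotent matrix of the dual basis after applying p.
It is functorial for all bimodule maps, so the splittings coming from f g f = f survive on fibres,
and the functor is exact. It is faithful because I_1(f) is 0 or Z, and it cannot be Z when p kills
all entries of f. Applied to f - p(f(1)), the same argument gives End(𝟙) = ℂ.

Tensor products and duals are realised as fixed points of endomorphisms of free bimodules built from
dual bases. The identities of the symmetry need only be checked on tensors of central elements of
degree zero, where no signs occur; the connection sends such elements to central elements of degree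
one. Finally, the localisation is spanned by germs of central elements, so two realisations of it
are related by a tensor isomorphism, and conjugation identifies their automorphism functors. -/

namespace Matrix

/-! ### Ideals of minors and generalised inverses over a commutative ring -/

section Minors

variable {R : Type*} [CommRing R] {m n l : Type*}

/-- The ideal generated by the minors of size `k` of a matrix. -/
def minorIdeal (f : Matrix m n R) (k : ℕ) : Ideal R :=
  Ideal.span (Set.range fun I : (Fin k → m) × (Fin k → n) => (f.submatrix I.1 I.2).det)

theorem det_submatrix_mem_minorIdeal (f : Matrix m n R) {k : ℕ} (I : Fin k → m) (J : Fin k → n) :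
    (f.submatrix I J).det ∈ f.minorIdeal k :=
  Ideal.subset_span ⟨(I, J), rfl⟩

theorem minorIdeal_zero (f : Matrix m n R) : f.minorIdeal 0 = ⊤ := by
  rw [Ideal.eq_top_iff_one]
  simpa using f.det_submatrix_mem_minorIdeal (k := 0) Fin.elim0 Fin.elim0

/-- Minors are indexed by arbitrary tuples, not only injective ones; with more indices than rows
some row is repeated. -/
theorem minorIdeal_of_card_lt [Fintype m] (f : Matrix m n R) {k : ℕ} (hk : Fintype.card m < k) :
    f.minorIdeal k = ⊥ := by
  rw [minorIdeal, Ideal.span_eq_bot]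
  rintro _ ⟨⟨I, J⟩, rfl⟩
  obtain ⟨i, j, hij, h⟩ := Fintype.exists_ne_map_eq_of_card_lt I (by simpa using hk)
  refine det_zero_of_row_eq hij ?_
  ext q
  simp [h]

theorem minorIdeal_one (f : Matrix m n R) : f.minorIdeal 1 = Ideal.span (Set.range fun p : m × n =>
    f p.1 p.2) := by
  apply le_antisymm
  · rw [minorIdeal, Ideal.span_le]
    rintro _ ⟨⟨I, J⟩, rfl⟩
    exact Ideal.subset_span ⟨(I 0, J 0), by simp⟩
  · rw [Ideal.span_le]
    rintro _ ⟨⟨p, q⟩, rfl⟩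
    simpa using f.det_submatrix_mem_minorIdeal (k := 1) (fun _ => p) (fun _ => q)

theorem minorIdeal_fg [Finite m] [Finite n] (f : Matrix m n R) (k : ℕ) : (f.minorIdeal k).FG :=
  Submodule.fg_span (Set.finite_range _)

/-- The rows of AB are combinations of rows of B, so multilinearity of the determinant in the rows
expands a minor of AB into minors of B. Tuples with repeated rows need no separate treatment, since
they too index minors. -/
theorem minorIdeal_mul_le_right [Fintype l] (A : Matrix m l R) (B : Matrix l n R) (k : ℕ) :
    (A * B).minorIdeal k ≤ B.minorIdeal k := by
  classical
  rw [minorIdeal, Ideal.span_le]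
  rintro _ ⟨⟨I, J⟩, rfl⟩
  have h : (A * B).submatrix I J = fun i => ∑ r, A (I i) r • fun j => B r (J j) := by
    ext i j
    simp [mul_apply, Finset.sum_apply]
  have h2 : ((A * B).submatrix I J).det = ∑ r : Fin k → l, (∏ i, A (I i) (r i)) •
      (B.submatrix r J).det := by
    rw [h]
    change detRowAlternating.toMultilinearMap _ = _
    rw [MultilinearMap.map_sum]
    refine Finset.sum_congr rfl fun r _ => ?_
    rw [MultilinearMap.map_smul_univ]
    rfl
  simp only [h2]
  exact Submodule.sum_mem _ fun r _ => Submodule.smul_mem _ _ (det_submatrix_mem_minorIdeal _ _ _)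

theorem minorIdeal_transpose (A : Matrix m n R) (k : ℕ) : Aᵀ.minorIdeal k = A.minorIdeal k := by
  rw [minorIdeal, minorIdeal]
  congr 1
  ext x
  constructor
  · rintro ⟨⟨I, J⟩, rfl⟩
    exact ⟨⟨J, I⟩, by simp only [← transpose_submatrix, det_transpose]⟩
  · rintro ⟨⟨I, J⟩, rfl⟩
    exact ⟨⟨J, I⟩, by simp only [← transpose_submatrix, det_transpose]⟩

theorem minorIdeal_mul_le_left [Fintype l] (A : Matrix m l R) (B : Matrix l n R) (k : ℕ) :
    (A * B).minorIdeal k ≤ A.minorIdeal k := by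
  rw [← minorIdeal_transpose, transpose_mul, ← minorIdeal_transpose A]
  exact minorIdeal_mul_le_right _ _ _

theorem minorIdeal_map {S : Type*} [CommRing S] (φ : R →+* S) (A : Matrix m n R) (k : ℕ) :
    (A.map φ).minorIdeal k = (A.minorIdeal k).map φ := by
  rw [minorIdeal, minorIdeal, Ideal.map_span, ← Set.range_comp]
  congr 2
  ext I
  simp [RingHom.map_det, submatrix_map]

/-- Multiplication by a block matrix built from the adjugate makes the bordered matrix block
triangular. Comparing determinants gives the identity multiplied by a power of det A, which is
cancelled by regularity. -/
theorem det_fromBlocks_adjugate_of_isRegular {ι : Type*} [Fintype ι] [DecidableEq ι]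
    (A : Matrix ι ι R) (hA : IsRegular A.det)
    (B : Matrix ι (Fin 1) R) (C : Matrix (Fin 1) ι R) (D : Matrix (Fin 1) (Fin 1) R) :
    (fromBlocks A B C D).det = (A.det • D - C * A.adjugate * B).det := by
  have h : fromBlocks A B C D * fromBlocks A.adjugate (-(A.adjugate * B)) 0 (A.det • 1) =
      fromBlocks (A.det • 1) 0 (C * A.adjugate) (A.det • D - C * A.adjugate * B) := by
    rw [fromBlocks_multiply]
    congr 1
    · simp [mul_adjugate]
    · rw [Matrix.mul_neg, ← Matrix.mul_assoc, mul_adjugate]; simp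
    · simp
    · rw [Matrix.mul_neg, ← Matrix.mul_assoc]; simp [sub_eq_neg_add]
  have h2 := congrArg det h
  rw [det_mul, det_fromBlocks_zero₂₁, det_fromBlocks_zero₁₂] at h2
  have h3 : A.adjugate.det * A.det = A.det ^ Fintype.card ι := by
    rw [← det_mul, adjugate_mul, det_smul, det_one, mul_one]
  simp only [det_smul, det_one, mul_one, Fintype.card_fin, pow_one, h3] at h2
  rw [mul_comm] at h2
  exact (hA.pow _).left h2

/-- The determinant of a matrix with one additional row and column. -/
theorem det_fromBlocks_adjugate {ι : Type*} [Fintype ι] [DecidableEq ι] (A : Matrix ι ι R)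
    (B : Matrix ι (Fin 1) R) (C : Matrix (Fin 1) ι R) (D : Matrix (Fin 1) (Fin 1) R) :
    (fromBlocks A B C D).det = (A.det • D - C * A.adjugate * B).det := by
  -- Over R[X] the determinant of A + X is monic, hence regular, so the regular case applies; the
  -- general identity follows by setting X = 0.
  let A' : Matrix ι ι (Polynomial R) := A.map Polynomial.C + (Polynomial.X : Polynomial R) • 1
  let e := Polynomial.evalRingHom (0 : R)
  have hA : A'.map e = A := by
    ext i j
    simp [A', e]
  have hA' : IsRegular A'.det := by
    refine Polynomial.Monic.isRegular ?_
    simp only [A', Polynomial.Monic.def, ← Polynomial.leadingCoeff_det_X_one_add_C A, add_comm]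
  have h := congrArg e (det_fromBlocks_adjugate_of_isRegular A' hA' (B.map Polynomial.C)
    (C.map Polynomial.C) (D.map Polynomial.C))
  have hB : (B.map Polynomial.C).map e = B := by ext; simp [e]
  have hC : (C.map Polynomial.C).map e = C := by ext; simp [e]
  have hD : (D.map Polynomial.C).map e = D := by ext; simp [e]
  have hdet : e A'.det = A.det := by
    rw [RingHom.map_det, RingHom.mapMatrix_apply, hA]
  have hadj : A'.adjugate.map e = A.adjugate := by
    rw [← RingHom.mapMatrix_apply, RingHom.map_adjugate, RingHom.mapMatrix_apply, hA]
  rw [RingHom.map_det, RingHom.map_det, RingHom.mapMatrix_apply, RingHom.mapMatrix_apply,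
    fromBlocks_map, hA, hB, hC, hD] at h
  rw [h]
  congr 1
  ext i j
  have h1 := congrFun (congrFun hD i) j
  simp only [map_apply] at h1
  have h2 : e ((C.map Polynomial.C * A'.adjugate * B.map Polynomial.C) i j) =
      (C * A.adjugate * B) i j := by
    rw [← map_apply (f := e), Matrix.map_mul, Matrix.map_mul, hadj, hC, hB]
  simp only [map_apply, sub_apply, smul_apply, smul_eq_mul, map_sub, map_mul, hdet, h1, h2]

/-- Border the block (I, J) by row p and column q. The resulting minor has size k + 1 and vanishes;
expanding it along the border gives the entry (p, q) of the identity. -/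
theorem submatrix_mul_adjugate_mul_submatrix (f : Matrix m n R) {k : ℕ}
    (hf : f.minorIdeal (k + 1) = ⊥) (I : Fin k → m) (J : Fin k → n) :
    f.submatrix id J * (f.submatrix I J).adjugate * f.submatrix I id =
      (f.submatrix I J).det • f := by
  ext p q
  have h := det_submatrix_mem_minorIdeal f (k := k + 1)
    (Sum.elim I (fun _ : Fin 1 => p) ∘ finSumFinEquiv.symm)
    (Sum.elim J (fun _ : Fin 1 => q) ∘ finSumFinEquiv.symm)
  rw [hf, Ideal.mem_bot, ← submatrix_submatrix, det_submatrix_equiv_self] at h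
  have h2 : f.submatrix (Sum.elim I (fun _ : Fin 1 => p)) (Sum.elim J (fun _ : Fin 1 => q)) =
      fromBlocks (f.submatrix I J) (f.submatrix I fun _ => q) (f.submatrix (fun _ => p) J)
        (f.submatrix (fun _ => p) (fun _ => q)) := by
    ext (i | i) (j | j) <;> rfl
  rw [h2, det_fromBlocks_adjugate, det_unique] at h
  exact (sub_eq_zero.1 h).symm

/-- If all ideals of minors of a matrix are trivial, then it has a generalised inverse. -/
theorem exists_generalised_inverse [Nontrivial R] [Fintype m] [Fintype n]
    (f : Matrix m n R) (hf : ∀ k, f.minorIdeal k = ⊥ ∨ f.minorIdeal k = ⊤) :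
    ∃ g : Matrix n m R, f * g * f = f := by
  classical
  have hex : ∃ k, f.minorIdeal k = ⊥ := ⟨_, f.minorIdeal_of_card_lt (Nat.lt_succ_self _)⟩
  -- The first size whose minors all vanish is not 0, because the empty minor is 1. So it is k + 1,
  -- where k plays the role of the rank and the minors of size k generate the unit ideal.
  obtain ⟨k, hk⟩ : ∃ k, Nat.find hex = k + 1 := by
    refine Nat.exists_eq_succ_of_ne_zero fun h0 => ?_
    have := Nat.find_spec hex
    rw [h0, minorIdeal_zero] at this
    exact top_ne_bot this
  have h1 : f.minorIdeal (k + 1) = ⊥ := hk ▸ Nat.find_spec hex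
  have h2 : f.minorIdeal k = ⊤ :=
    (hf k).resolve_left (Nat.find_min hex (by omega))
  -- The scalars a for which a f has the form f g f are an ideal. It is enough to put every minor of
  -- size k in it, since these minors generate 1.
  let S : Submodule R R :=
    { carrier := {a | ∃ g : Matrix n m R, f * g * f = a • f}
      zero_mem' := ⟨0, by simp⟩
      add_mem' := by
        rintro a b ⟨g, hg⟩ ⟨g', hg'⟩
        exact ⟨g + g', by rw [Matrix.mul_add, Matrix.add_mul, hg, hg', add_smul]⟩
      smul_mem' := by
        rintro c a ⟨g, hg⟩
        exact ⟨c • g, by rw [Matrix.mul_smul, Matrix.smul_mul, hg, smul_smul, smul_eq_mul]⟩ }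
  have hS : f.minorIdeal k ≤ S := by
    rw [minorIdeal, Ideal.span, Submodule.span_le]
    rintro _ ⟨⟨I, J⟩, rfl⟩
    -- The witness is the adjugate of the block, placed by selection matrices in the rows J and
    -- columns I.
    refine ⟨(1 : Matrix n n R).submatrix id J * (f.submatrix I J).adjugate *
      (1 : Matrix m m R).submatrix I id, ?_⟩
    rw [← submatrix_mul_adjugate_mul_submatrix f h1 I J]
    have e1 : f * (1 : Matrix n n R).submatrix id J = f.submatrix id J := by
      ext i j; simp [mul_apply, one_apply]
    have e2 : (1 : Matrix m m R).submatrix I id * f = f.submatrix I id := by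
      ext i j; simp [mul_apply, one_apply]
    rw [← e1, ← e2]
    simp only [Matrix.mul_assoc]
  obtain ⟨g, hg⟩ := hS (h2 ▸ Submodule.mem_top : (1 : R) ∈ f.minorIdeal k)
  exact ⟨g, by rw [hg, one_smul]⟩

end Minors

/-! ### Stability of ideals of minors under a derivation -/

section Derivation

variable {R M : Type*} [CommRing R] [AddCommGroup M] [Module R M]

/-- If the derivative of a matrix `f` is of the form `f Γ + θ f`, then its ideals of minors are
stable under the derivation. -/
theorem derivation_minorIdeal {m n : Type*} [Fintype m] [Fintype n] (D : R →+ M)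
    (hD : ∀ a b, D (a * b) = a • D b + b • D a) (f : Matrix m n R)
    (Γ : Matrix n n M) (θ : Matrix m m M)
    (hf : ∀ i j, D (f i j) = ∑ l, f i l • Γ l j + ∑ l, f l j • θ i l) (k : ℕ) {a : R}
    (ha : a ∈ f.minorIdeal k) : D a ∈ f.minorIdeal k • (⊤ : Submodule R M) := by
  classical
  let _ : Module Rᵐᵒᵖ M := Module.compHom M ((RingHom.id R).fromOpposite mul_comm)
  have : IsCentralScalar R M := ⟨fun r m => rfl⟩
  have hD1 : D 1 = 0 := by
    have := hD 1 1
    rw [mul_one, one_smul] at this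
    exact left_eq_add.1 this
  -- A derivation is the same as the ring homomorphism a ↦ a + D a to the square-zero extension. The
  -- differential equation for f becomes φ(f) = (1 + θ) f (1 + Γ), so the minors of φ(f) lie in the
  -- ideal generated by those of f.
  let φ : R →+* TrivSqZeroExt R M :=
    { toFun := fun a => TrivSqZeroExt.inl a + TrivSqZeroExt.inr (D a)
      map_one' := by rw [hD1]; simp
      map_mul' := fun a b => by
        ext <;> simp [hD]
      map_zero' := by simp
      map_add' := fun a b => by ext <;> simp }
  let inl : R →+* TrivSqZeroExt R M := TrivSqZeroExt.inlHom R M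
  let Γ' : Matrix n n (TrivSqZeroExt R M) := Γ.map TrivSqZeroExt.inr
  let θ' : Matrix m m (TrivSqZeroExt R M) := θ.map TrivSqZeroExt.inr
  -- The entries of θ' and Γ' lie in the square-zero part, so the only term quadratic in them
  -- vanishes.
  have h0 : θ' * f.map inl * Γ' = 0 := by
    ext i j <;> simp [mul_apply, θ', Γ', inl, TrivSqZeroExt.fst_sum, TrivSqZeroExt.snd_sum]
  have hφ : f.map φ = (1 + θ') * f.map inl * (1 + Γ') := by
    rw [Matrix.mul_add, Matrix.add_mul, Matrix.add_mul, Matrix.add_mul, h0, Matrix.mul_one, Matrix.one_mul]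
    ext i j <;> simp [mul_apply, θ', Γ', inl, φ, hf, TrivSqZeroExt.fst_sum, TrivSqZeroExt.snd_sum]
    abel
  have h1 : φ a ∈ (f.minorIdeal k).map inl := by
    have h : φ a ∈ (f.map φ).minorIdeal k := by
      rw [minorIdeal_map]; exact Ideal.mem_map_of_mem _ ha
    rw [hφ] at h
    rw [← minorIdeal_map]
    exact minorIdeal_mul_le_right _ _ _ (minorIdeal_mul_le_left _ _ _ h)
  -- The extension of an ideal I to the square-zero extension is contained in I ⊕ I M; the second
  -- component of φ(a) is D a.
  have h2 : ∀ x ∈ (f.minorIdeal k).map inl,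
      x.fst ∈ f.minorIdeal k ∧ x.snd ∈ f.minorIdeal k • (⊤ : Submodule R M) := by
    intro x hx
    rw [Ideal.map] at hx
    induction hx using Submodule.span_induction with
    | mem x hx =>
      obtain ⟨y, hy, rfl⟩ := hx
      exact ⟨hy, by simp [inl]⟩
    | zero => simp
    | add x y _ _ hx hy => exact ⟨add_mem hx.1 hy.1, add_mem hx.2 hy.2⟩
    | smul c x _ hx =>
      refine ⟨Ideal.mul_mem_left _ _ hx.1, ?_⟩
      rw [smul_eq_mul, TrivSqZeroExt.snd_mul, op_smul_eq_smul]
      exact add_mem (Submodule.smul_mem _ _ hx.2) (Submodule.smul_mem_smul hx.1 trivial)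
  simpa [φ] using (h2 _ h1).2

end Derivation
end Matrix

/-! ### The degree zero part of the graded centre and its differential -/

namespace FlatBimod

namespace DGAlgebra

variable {Ω : DGAlgebra.{u}}

theorem comm_of_mem_centreGr_zero {a : Ω} (ha : a ∈ Ω.centreGr 0) (b : Ω) : a * b = b * a := by
  induction b using DirectSum.Decomposition.inductionOn Ω.gr with
  | zero => simp
  | homogeneous b => simpa using ha.2 _ _ b.2
  | add b c hb hc => rw [mul_add, add_mul, hb, hc]

end DGAlgebra

namespace CentreZero

variable {Ω : DGAlgebra.{u}}

/-- The element of `Z_g(Ω)^0` given by a central element of degree zero. -/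
def mk (a : Ω) (ha : a ∈ Ω.centreGr 0) : CentreZero Ω :=
  ⟨⟨a, Ω.centreGr_le_centre 0 ha⟩, ha.1⟩

@[simp] theorem val_mk (a : Ω) (ha : a ∈ Ω.centreGr 0) : (mk a ha).val = a := rfl

theorem val_injective : Function.Injective (val : CentreZero Ω → Ω) :=
  fun _ _ h => Subtype.ext (Subtype.ext h)

/-- The inclusion of `Z_g(Ω)^0` in `Ω` as a homomorphism of algebras. -/
def valHom (Ω : DGAlgebra.{u}) : CentreZero Ω →ₐ[ℂ] Ω where
  toFun := val
  map_one' := rfl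
  map_mul' _ _ := rfl
  map_zero' := rfl
  map_add' _ _ := rfl
  commutes' _ := rfl

@[simp] theorem val_zero : (0 : CentreZero Ω).val = 0 := rfl
@[simp] theorem val_one : (1 : CentreZero Ω).val = 1 := rfl
@[simp] theorem val_add (a b : CentreZero Ω) : (a + b).val = a.val + b.val := rfl
@[simp] theorem val_sub (a b : CentreZero Ω) : (a - b).val = a.val - b.val := rfl
@[simp] theorem val_mul (a b : CentreZero Ω) : (a * b).val = a.val * b.val := rfl
@[simp] theorem val_smul (c : ℂ) (a : CentreZero Ω) : (c • a).val = c • a.val := rfl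
@[simp] theorem val_sum {ι : Type*} (s : Finset ι) (f : ι → CentreZero Ω) :
    (∑ i ∈ s, f i).val = ∑ i ∈ s, (f i).val := map_sum (valHom Ω) f s

theorem val_commute (z : CentreZero Ω) (a : Ω) : z.val * a = a * z.val :=
  DGAlgebra.comm_of_mem_centreGr_zero z.val_mem a

noncomputable instance : Module (CentreZero Ω) (Ω.centreGr 1) where
  smul z x := ⟨z.val * x, by simpa using DGAlgebra.mul_mem_centreGr z.val_mem x.2⟩
  one_smul x := Subtype.ext (one_mul (x : Ω))
  mul_smul z z' x := Subtype.ext (mul_assoc z.val z'.val (x : Ω))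
  smul_zero z := Subtype.ext (mul_zero z.val)
  smul_add z x y := Subtype.ext (mul_add z.val (x : Ω) y)
  add_smul z z' x := Subtype.ext (add_mul z.val z'.val (x : Ω))
  zero_smul x := Subtype.ext (zero_mul (x : Ω))

theorem coe_smul_centreGr_one (z : CentreZero Ω) (x : Ω.centreGr 1) :
    ((z • x : Ω.centreGr 1) : Ω) = z.val * x := rfl

/-- The differential `Z_g(Ω)^0 → Z_g(Ω)^1`. -/
noncomputable def diff (Ω : DGAlgebra.{u}) : CentreZero Ω →+ Ω.centreGr 1 where
  toFun z := ⟨Ω.d z.val, DGAlgebra.d_mem_centreGr z.val_mem⟩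
  map_zero' := Subtype.ext (map_zero Ω.d)
  map_add' a b := Subtype.ext (map_add Ω.d a.val b.val)

theorem coe_diff (z : CentreZero Ω) : (diff Ω z : Ω) = Ω.d z.val := rfl

theorem diff_mul (a b : CentreZero Ω) :
    diff Ω (a * b) = a • diff Ω b + b • diff Ω a := by
  apply Subtype.ext
  change Ω.d (a.val * b.val) = a.val * Ω.d b.val + b.val * Ω.d a.val
  rw [Ω.leibniz a.val_mem.1, b.val_commute, pow_zero, one_smul, add_comm]

end CentreZero

/-- A dga is differentially simple if `Z_g(Ω)^0` has no finitely generated ideals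
which are stable under the differential, except for the trivial ones. -/
def DGAlgebra.IsDiffSimple (Ω : DGAlgebra.{u}) : Prop :=
  ∀ I : Ideal (CentreZero Ω), I.FG →
    (∀ a ∈ I, CentreZero.diff Ω a ∈ I • (⊤ : Submodule (CentreZero Ω) (Ω.centreGr 1))) →
    I = ⊥ ∨ I = ⊤

/-! ### Property Q implies differential simplicity -/

section PropertyQ

open StarDGAlgebra

theorem nonneg_mul_of_commute {B : Type v} [CommCStarAlgebra B] [PartialOrder B] [StarOrderedRing B]
    {x y : B} (hx : 0 ≤ x) (hy : 0 ≤ y) : 0 ≤ x * y := Commute.mul_nonneg hx hy (Commute.all _ _)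

/-- By commutativity |x^* y|² = |x|² |y|², and a² - |x|² |y|² = (a - |x|²) a + |x|² (a - |y|²) is a
sum of products of positive elements. Taking square roots is monotone. -/
theorem abs_star_mul_le {B : Type v} [CommCStarAlgebra B] [PartialOrder B] [StarOrderedRing B]
    {a x y : B} (hx : star x * x ≤ a) (hy : star y * y ≤ a) : CFC.abs (star x * y) ≤ a := by
  have ha : 0 ≤ a := (star_mul_self_nonneg x).trans hx
  have h : star (star x * y) * (star x * y) ≤ a * a := by
    have e : a * a - star (star x * y) * (star x * y) =
        (a - star x * x) * a + (star x * x) * (a - star y * y) := by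
      rw [star_mul, star_star]; ring
    rw [← sub_nonneg, e]
    exact add_nonneg (nonneg_mul_of_commute (sub_nonneg.2 hx) ha)
      (nonneg_mul_of_commute (star_mul_self_nonneg x) (sub_nonneg.2 hy))
  calc CFC.abs (star x * y) ≤ CFC.sqrt (a * a) := CFC.sqrt_le_sqrt _ _ h
    _ = a := CFC.sqrt_mul_self a ha

theorem exists_sum_of_mem_span_smul_top {R M ι : Type*} [CommRing R] [AddCommGroup M] [Module R M]
    [Fintype ι] (m : ι → R) {x : M}
    (hx : x ∈ Ideal.span (Set.range m) • (⊤ : Submodule R M)) :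
    ∃ ω : ι → M, x = ∑ i, m i • ω i := by
  induction hx using Submodule.smul_induction_on' with
  | smul r hr y _ =>
    obtain ⟨c, rfl⟩ := (Submodule.mem_span_range_iff_exists_fun R).1 hr
    refine ⟨fun i => c i • y, ?_⟩
    rw [Finset.sum_smul]
    exact Finset.sum_congr rfl fun i _ => by rw [smul_eq_mul, mul_comm, mul_smul]
  | add x _ y _ hx hy =>
    obtain ⟨ω, rfl⟩ := hx
    obtain ⟨ω', rfl⟩ := hy
    exact ⟨fun i => ω i + ω' i, by simp only [smul_add, Finset.sum_add_distrib]⟩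

variable {Ω : StarDGAlgebra.{u}} {B : Type v} [CommCStarAlgebra B]

/-- The adjoint of an element of `Z_g(Ω)^0`. -/
def CentreZero.conj (z : CentreZero Ω.toDGAlgebra) : CentreZero Ω.toDGAlgebra :=
  CentreZero.mk (Ω.conj z.val) (conj_mem_centreGr z.val_mem)

/-- The homomorphism `Z_g(Ω)^0 → B`. -/
def CentreZero.embed (ι : Ω.gradedCentre.degZero →⋆ₐ[ℂ] B) : CentreZero Ω.toDGAlgebra →ₐ[ℂ] B :=
  ι.toAlgHom

theorem CentreZero.embed_conj (ι : Ω.gradedCentre.degZero →⋆ₐ[ℂ] B)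
    (z : CentreZero Ω.toDGAlgebra) : CentreZero.embed ι z.conj = star (CentreZero.embed ι z) :=
  map_star ι (show Ω.gradedCentre.degZero from z)

/-- Property Q in the form used below: any finite index type is allowed, and the one-forms are taken
in `centreGr 1` instead of in the degree one part of the graded centre as a dga of its own. -/
theorem PropertyQ_apply [PartialOrder B] [StarOrderedRing B] {ι : Ω.gradedCentre.degZero →⋆ₐ[ℂ] B}
    (hQ : PropertyQ ι) {κ : Type*} [Fintype κ] (a : CentreZero Ω.toDGAlgebra)
    (b : κ → CentreZero Ω.toDGAlgebra) (ω : κ → Ω.toDGAlgebra.centreGr 1)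
    (ha : 0 ≤ CentreZero.embed ι a)
    (hb : ∀ i, CFC.abs (CentreZero.embed ι (b i)) ≤ CentreZero.embed ι a)
    (hd : CentreZero.diff Ω.toDGAlgebra a = ∑ i, b i • ω i) : a = 0 ∨ IsUnit a := by
  let e := Fintype.equivFin κ
  refine hQ a (Fintype.card κ) (fun i => b (e.symm i))
    (fun i => ⟨⟨(ω (e.symm i)).1, Ω.centreGr_le_centre 1 (ω (e.symm i)).2⟩, (ω (e.symm i)).2.1⟩)
    ha (fun i => hb _) ?_
  apply Subtype.ext
  have h := congrArg (Subtype.val) hd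
  rw [← e.symm.sum_comp] at h
  refine h.trans ?_
  rw [AddSubmonoidClass.coe_finsetSum]
  symm
  exact map_sum (Ω.toDGAlgebra.centreSubalgebra.val) _ _

/-- For generators m_i of a stable ideal take a = ∑ m_i^* m_i. It dominates every |m_i|², hence
every |m_i^* m_j|, and by stability da is a combination of these products, so property Q applies. If
a = 0, all m_i vanish; if a is invertible, the ideal contains a unit. -/
theorem isDiffSimple_of_propertyQ [PartialOrder B] [StarOrderedRing B]
    (ι : Ω.gradedCentre.degZero →⋆ₐ[ℂ] B)
    (hι : Function.Injective ι) (hQ : PropertyQ ι) : Ω.toDGAlgebra.IsDiffSimple := by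
  classical
  intro I hI hD
  obtain ⟨s, m, hm⟩ : ∃ (s : ℕ) (m : Fin s → CentreZero Ω.toDGAlgebra),
      I = Ideal.span (Set.range m) := by
    obtain ⟨s, m, hm⟩ := Submodule.fg_iff_exists_fin_generating_family.1 hI
    exact ⟨s, m, hm.symm⟩
  subst hm
  choose ω hω using fun i => exists_sum_of_mem_span_smul_top m
    (hD (m i) (Ideal.subset_span ⟨i, rfl⟩))
  let φ := CentreZero.embed ι
  let a : CentreZero Ω.toDGAlgebra := ∑ i, (m i).conj * m i
  have hle : ∀ i, star (φ (m i)) * φ (m i) ≤ φ a := by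
    intro i
    simp only [a, map_sum, map_mul, φ, CentreZero.embed_conj]
    exact Finset.single_le_sum (f := fun i => star (φ (m i)) * φ (m i))
      (fun j _ => star_mul_self_nonneg _) (Finset.mem_univ i)
  have ha0 : 0 ≤ φ a := by
    simp only [a, map_sum, map_mul, φ, CentreZero.embed_conj]
    exact Finset.sum_nonneg fun i _ => star_mul_self_nonneg _
  let ω' : Fin s → Fin s → Ω.toDGAlgebra.centreGr 1 := fun i j =>
    ⟨Ω.conj (ω i j), conj_mem_centreGr (ω i j).2⟩
  -- The adjoint of the equation for d m_i. The sign η does not appear because the coefficients m_j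
  -- have degree zero.
  have hω' : ∀ i, CentreZero.diff _ (m i).conj = ∑ j, (m j).conj • ω' i j := by
    intro i
    apply Subtype.ext
    have h := congrArg Subtype.val (hω i)
    rw [CentreZero.coe_diff, AddSubmonoidClass.coe_finsetSum] at h ⊢
    change Ω.d (Ω.conj (m i).val) = _
    rw [← Ω.conj_d, h, map_sum]
    refine Finset.sum_congr rfl fun j _ => ?_
    obtain ⟨η, -, hη⟩ := Ω.conj_mul
    rw [CentreZero.coe_smul_centreGr_one, CentreZero.coe_smul_centreGr_one,
      hη (m j).val_mem.1 (ω i j).2.1, zero_mul, pow_zero, one_smul]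
    exact ((m j).conj.val_commute _).symm
  -- The two copies of the index set come from the two Leibniz terms m_i^* d m_i and m_i d m_i^*.
  have hd : CentreZero.diff _ a = ∑ p : (Fin s × Fin s) ⊕ (Fin s × Fin s),
      Sum.elim (fun p => (m p.1).conj * m p.2) (fun p => (m p.2).conj * m p.1) p •
        Sum.elim (fun p => ω p.1 p.2) (fun p => ω' p.1 p.2) p := by
    rw [Fintype.sum_sum_type]
    simp only [Sum.elim_inl, Sum.elim_inr, Fintype.sum_prod_type]
    rw [map_sum, ← Finset.sum_add_distrib]
    refine Finset.sum_congr rfl fun i _ => ?_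
    rw [CentreZero.diff_mul, hω, hω', Finset.smul_sum, Finset.smul_sum]
    congr 1
    · exact Finset.sum_congr rfl fun j _ => (mul_smul _ _ _).symm
    · exact Finset.sum_congr rfl fun j _ => by rw [mul_comm, mul_smul]
  rcases PropertyQ_apply hQ a _ _ ha0 (by
    rintro (p | p) <;> simp only [Sum.elim_inl, Sum.elim_inr, map_mul, CentreZero.embed_conj] <;>
      exact abs_star_mul_le (hle _) (hle _)) hd with h | h
  · left
    rw [Ideal.span_eq_bot]
    rintro _ ⟨i, rfl⟩
    have h1 := hle i
    rw [h, map_zero] at h1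
    have h2 := (CStarRing.star_mul_self_eq_zero_iff _).1
      (le_antisymm h1 (star_mul_self_nonneg (φ (m i))))
    exact hι (h2.trans (map_zero ι).symm)
  · right
    refine Ideal.eq_top_of_isUnit_mem _ ?_ h
    exact Submodule.sum_mem _ fun i _ => Ideal.mul_mem_left _ _ (Ideal.subset_span ⟨i, rfl⟩)

end PropertyQ
/-! ### The parity involution -/

section Parity

variable {M N : Type*} [AddCommGroup M] [Module ℂ M] [AddCommGroup N] [Module ℂ N]
  (gr : ℕ → Submodule ℂ M) [DirectSum.Decomposition gr]
  (gr' : ℕ → Submodule ℂ N) [DirectSum.Decomposition gr']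

/-- The projection to the component of degree `k`. -/
def gradeProj (k : ℕ) : M →ₗ[ℂ] M :=
  (gr k).subtype ∘ₗ DirectSum.component ℂ ℕ (fun k => gr k) k ∘ₗ
    (DirectSum.decomposeLinearEquiv gr).toLinearMap

theorem gradeProj_mem (k : ℕ) (x : M) : gradeProj gr k x ∈ gr k := SetLike.coe_mem _

variable {gr} in
theorem gradeProj_of_mem {k : ℕ} {x : M} (hx : x ∈ gr k) : gradeProj gr k x = x :=
  DirectSum.decompose_of_mem_same _ hx

variable {gr} in
theorem gradeProj_of_mem_ne {k l : ℕ} {x : M} (hx : x ∈ gr k) (h : k ≠ l) :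
    gradeProj gr l x = 0 :=
  DirectSum.decompose_of_mem_ne _ hx h

theorem sum_gradeProj (x : M) : ∃ s : Finset ℕ, ∑ k ∈ s, gradeProj gr k x = x := by
  classical
  exact ⟨_, DirectSum.sum_support_decompose gr x⟩

theorem eq_of_homogeneous {f g : M →ₗ[ℂ] N} (h : ∀ k, ∀ x ∈ gr k, f x = g x) (x : M) :
    f x = g x := by
  induction x using DirectSum.Decomposition.inductionOn gr with
  | zero => simp
  | homogeneous x => exact h _ _ x.2
  | add x y hx hy => rw [map_add, map_add, hx, hy]

/-- The involution `x ↦ (-1) ^ |x| x`. -/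
noncomputable def parity : M →ₗ[ℂ] M :=
  DirectSum.toModule ℂ ℕ M (fun k => (-1 : ℂ) ^ k • (gr k).subtype) ∘ₗ
    (DirectSum.decomposeLinearEquiv gr).toLinearMap

variable {gr gr'}

theorem parity_of_mem {k : ℕ} {x : M} (hx : x ∈ gr k) : parity gr x = (-1 : ℂ) ^ k • x := by
  rw [parity, LinearMap.comp_apply, LinearEquiv.coe_coe, DirectSum.decomposeLinearEquiv_apply,
    DirectSum.decompose_of_mem _ hx, ← DirectSum.lof_eq_of ℂ, DirectSum.toModule_lof]
  rfl

theorem parity_of_mem_zero {x : M} (hx : x ∈ gr 0) : parity gr x = x := by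
  rw [parity_of_mem hx, pow_zero, one_smul]

theorem parity_mem {k : ℕ} {x : M} (hx : x ∈ gr k) : parity gr x ∈ gr k := by
  rw [parity_of_mem hx]
  exact Submodule.smul_mem _ _ hx

theorem parity_parity (x : M) : parity gr (parity gr x) = x := by
  refine eq_of_homogeneous gr (f := parity gr ∘ₗ parity gr) (g := LinearMap.id)
    (fun k x hx => ?_) x
  rw [LinearMap.comp_apply, parity_of_mem hx, map_smul, parity_of_mem hx, smul_smul, ← pow_add,
    ← two_mul, pow_mul]
  simp

theorem map_gradeProj {f : M →ₗ[ℂ] N} (hf : ∀ k x, x ∈ gr k → f x ∈ gr' k) (k : ℕ) (x : M) :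
    f (gradeProj gr k x) = gradeProj gr' k (f x) := by
  refine eq_of_homogeneous gr (f := f ∘ₗ gradeProj gr k) (g := gradeProj gr' k ∘ₗ f)
    (fun l x hx => ?_) x
  simp only [LinearMap.comp_apply]
  by_cases h : l = k
  · subst h
    rw [gradeProj_of_mem hx, gradeProj_of_mem (hf _ _ hx)]
  · rw [gradeProj_of_mem_ne hx h, gradeProj_of_mem_ne (hf _ _ hx) h, map_zero]

theorem map_parity {f : M →ₗ[ℂ] N} (hf : ∀ k x, x ∈ gr k → f x ∈ gr' k) (x : M) :
    f (parity gr x) = parity gr' (f x) := by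
  refine eq_of_homogeneous gr (f := f ∘ₗ parity gr) (g := parity gr' ∘ₗ f) (fun k x hx => ?_) x
  simp only [LinearMap.comp_apply]
  rw [parity_of_mem hx, parity_of_mem (hf _ _ hx), map_smul]

/-- Raising the degree by one flips the sign. Applied to connections, this cancels the cross terms
in the square of a tensor product or dual connection. -/
theorem parity_map_of_degree_one {f : M →ₗ[ℂ] N} (hf : ∀ k x, x ∈ gr k → f x ∈ gr' (k + 1)) (x : M) :
    parity gr' (f x) = -f (parity gr x) := by
  refine eq_of_homogeneous gr (f := parity gr' ∘ₗ f) (g := -(f ∘ₗ parity gr))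
    (fun k x hx => ?_) x
  simp only [LinearMap.comp_apply, LinearMap.neg_apply]
  rw [parity_of_mem hx, parity_of_mem (hf _ _ hx), map_smul, pow_succ, mul_neg_one, neg_smul]

/-- The map π_k fixes the k-th piece and kills the sum of the others, so the two meet only in 0.
This provides the gradings on sub-bimodules, free bimodules and direct sums. -/
theorem isInternal_of_projections {M : Type*} [AddCommGroup M] [Module ℂ M]
    {gr : ℕ → Submodule ℂ M} (π : ℕ → M →ₗ[ℂ] M)
    (h1 : ∀ k x, x ∈ gr k → π k x = x) (h2 : ∀ k l x, x ∈ gr k → k ≠ l → π l x = 0)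
    (h3 : ∀ x, x ∈ ⨆ k, gr k) : DirectSum.IsInternal gr := by
  classical
  rw [DirectSum.isInternal_submodule_iff_iSupIndep_and_iSup_eq_top]
  refine ⟨fun k => ?_, eq_top_iff.2 fun x _ => h3 x⟩
  rw [Submodule.disjoint_def]
  intro x hx hx'
  rw [← h1 k x hx]
  have h : ⨆ j, ⨆ (_ : j ≠ k), gr j ≤ LinearMap.ker (π k) :=
    iSup₂_le fun j hj y hy => h2 j k y hy hj
  exact h hx'

end Parity

/-! ### Differential graded algebras -/

namespace DGAlgebra

variable (Ω : DGAlgebra.{u})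

/-- The involution `a ↦ (-1) ^ |a| a` of a dga. -/
noncomputable abbrev par : Ω →ₗ[ℂ] Ω := parity Ω.gr

variable {Ω}

/-- With the sign absorbed in the parity operator both sides are linear in a, so the rule no longer
needs a homogeneous. The same device is used for connections. -/
theorem d_mul (a b : Ω) : Ω.d (a * b) = Ω.d a * b + Ω.par a * Ω.d b := by
  refine eq_of_homogeneous Ω.gr (f := Ω.d ∘ₗ LinearMap.mulRight ℂ b)
    (g := LinearMap.mulRight ℂ b ∘ₗ Ω.d + LinearMap.mulRight ℂ (Ω.d b) ∘ₗ Ω.par)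
    (fun k a ha => ?_) a
  simp only [LinearMap.comp_apply, LinearMap.mulRight_apply, LinearMap.add_apply]
  rw [parity_of_mem ha, Ω.leibniz ha, smul_mul_assoc]

theorem d_one : Ω.d 1 = 0 := by
  have h := d_mul (Ω := Ω) 1 1
  rw [parity_of_mem_zero (SetLike.one_mem_graded Ω.gr), mul_one, mul_one, one_mul] at h
  exact left_eq_add.1 h

end DGAlgebra

/-! ### Graded bimodules -/

namespace GradedBimodule

variable {Ω : DGAlgebra.{u}}

instance (E : GradedBimodule Ω) : SMulCommClass Ω ℂ E :=
  ⟨fun a c x => smul_algebra_smul_comm c a x⟩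

instance (E : GradedBimodule Ω) : SMulCommClass Ωᵐᵒᵖ ℂ E :=
  ⟨fun a c x => smul_algebra_smul_comm c a x⟩

instance (E : GradedBimodule Ω) : SMulCommClass Ωᵐᵒᵖ Ω E := SMulCommClass.symm _ _ _

variable (E : GradedBimodule Ω)

/-- The involution `x ↦ (-1) ^ |x| x` of a graded bimodule. -/
noncomputable abbrev par : E →ₗ[ℂ] E := parity E.gr

/-- The left action as a bilinear map. -/
noncomputable def lact : Ω →ₗ[ℂ] E →ₗ[ℂ] E :=
  LinearMap.mk₂ ℂ (fun a x => a • x) (fun _ _ _ => add_smul _ _ _) (fun _ _ _ => smul_assoc _ _ _)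
    (fun _ _ _ => smul_add _ _ _) (fun _ _ _ => smul_comm _ _ _)

/-- The right action as a bilinear map. -/
noncomputable def ract : Ω →ₗ[ℂ] E →ₗ[ℂ] E :=
  LinearMap.mk₂ ℂ (fun a x => op a • x) (fun _ _ _ => by rw [MulOpposite.op_add, add_smul])
    (fun _ _ _ => by rw [MulOpposite.op_smul, smul_assoc])
    (fun _ _ _ => smul_add _ _ _) (fun _ _ _ => smul_comm _ _ _)

@[simp] theorem lact_apply (a : Ω) (x : E) : E.lact a x = a • x := rfl
@[simp] theorem ract_apply (a : Ω) (x : E) : E.ract a x = op a • x := rfl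

variable {E}

theorem par_smul (a : Ω) (x : E) : E.par (a • x) = Ω.par a • E.par x := by
  refine eq_of_homogeneous Ω.gr (f := E.par ∘ₗ E.lact.flip x)
    (g := E.lact.flip (E.par x) ∘ₗ Ω.par) (fun k a ha => ?_) a
  refine eq_of_homogeneous E.gr (f := E.par ∘ₗ E.lact a)
    (g := E.lact (Ω.par a) ∘ₗ E.par) (fun l x hx => ?_) x
  simp only [LinearMap.comp_apply, lact_apply]
  rw [parity_of_mem ha, parity_of_mem hx, parity_of_mem (E.smul_mem ha hx), smul_assoc,
    smul_comm a, smul_smul, pow_add]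

theorem par_op_smul (a : Ω) (x : E) : E.par (op a • x) = op (Ω.par a) • E.par x := by
  refine eq_of_homogeneous Ω.gr (f := E.par ∘ₗ E.ract.flip x)
    (g := E.ract.flip (E.par x) ∘ₗ Ω.par) (fun k a ha => ?_) a
  refine eq_of_homogeneous E.gr (f := E.par ∘ₗ E.ract a)
    (g := E.ract (Ω.par a) ∘ₗ E.par) (fun l x hx => ?_) x
  simp only [LinearMap.comp_apply, ract_apply]
  rw [parity_of_mem ha, parity_of_mem hx, parity_of_mem (E.op_smul_mem hx ha), MulOpposite.op_smul, smul_assoc,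
    smul_comm (op a), smul_smul, pow_add, mul_comm]

theorem op_smul_of_mem_centreGr_zero {x : E} (hx : x ∈ E.centreGr 0) (a : Ω) :
    op a • x = a • x := by
  refine eq_of_homogeneous Ω.gr (f := E.ract.flip x) (g := E.lact.flip x) (fun k a ha => ?_) a
  simpa using hx.2 k a ha

theorem mem_centreGr_zero {x : E} (h : x ∈ E.gr 0) (hx : ∀ a : Ω, op a • x = a • x) :
    x ∈ E.centreGr 0 :=
  ⟨h, fun l a _ => by rw [zero_mul, pow_zero, one_smul, hx]⟩

/-! ### Bimodule maps -/

/-- Bimodule maps of degree zero. -/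
structure IsBimodMap {E F : GradedBimodule Ω} (f : E →ₗ[ℂ] F) : Prop where
  smul : ∀ (a : Ω) (x : E), f (a • x) = a • f x
  op_smul : ∀ (a : Ω) (x : E), f (op a • x) = op a • f x
  mem : ∀ (k : ℕ) (x : E), x ∈ E.gr k → f x ∈ F.gr k

namespace IsBimodMap

variable {F G : GradedBimodule Ω}

theorem id (E : GradedBimodule Ω) : IsBimodMap (LinearMap.id : E →ₗ[ℂ] E) :=
  ⟨fun _ _ => rfl, fun _ _ => rfl, fun _ _ h => h⟩

theorem comp {f : E →ₗ[ℂ] F} {g : F →ₗ[ℂ] G} (hg : IsBimodMap g) (hf : IsBimodMap f) :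
    IsBimodMap (g ∘ₗ f) :=
  ⟨fun a x => by simp [hf.smul, hg.smul], fun a x => by simp [hf.op_smul, hg.op_smul],
    fun k x h => hg.mem k _ (hf.mem k x h)⟩

theorem sub {f g : E →ₗ[ℂ] F} (hf : IsBimodMap f) (hg : IsBimodMap g) : IsBimodMap (f - g) :=
  ⟨fun a x => by simp [hf.smul, hg.smul, smul_sub],
    fun a x => by simp [hf.op_smul, hg.op_smul, smul_sub],
    fun k x h => sub_mem (hf.mem k x h) (hg.mem k x h)⟩

theorem par {f : E →ₗ[ℂ] F} (hf : IsBimodMap f) (x : E) : f (E.par x) = F.par (f x) :=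
  map_parity hf.mem x

theorem mem_centreGr {f : E →ₗ[ℂ] F} (hf : IsBimodMap f) {k : ℕ} {x : E}
    (hx : x ∈ E.centreGr k) : f x ∈ F.centreGr k :=
  ⟨hf.mem k x hx.1, fun l a ha => by
    rw [← hf.op_smul, hx.2 l a ha, LinearMap.map_smul, hf.smul]⟩

end IsBimodMap

/-! ### Constructions of graded bimodules -/

/-- The left action on a sub-bimodule. -/
abbrev subLeftModule (E : GradedBimodule Ω) (S : Submodule ℂ E)
    (hl : ∀ (a : Ω), ∀ x ∈ S, a • x ∈ S) : Module Ω S where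
  smul := fun a x => ⟨a • (x : E), hl a x x.2⟩
  one_smul := fun x => Subtype.ext (one_smul Ω (x : E))
  mul_smul := fun a b x => Subtype.ext (mul_smul a b (x : E))
  smul_zero := fun a => Subtype.ext (smul_zero a)
  smul_add := fun a x y => Subtype.ext (smul_add a (x : E) y)
  add_smul := fun a b x => Subtype.ext (add_smul a b (x : E))
  zero_smul := fun x => Subtype.ext (zero_smul Ω (x : E))

/-- The right action on a sub-bimodule. -/
abbrev subRightModule (E : GradedBimodule Ω) (S : Submodule ℂ E)
    (hr : ∀ (a : Ω), ∀ x ∈ S, op a • x ∈ S) : Module Ωᵐᵒᵖ S where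
  smul := fun a x => ⟨a • (x : E), hr a.unop x x.2⟩
  one_smul := fun x => Subtype.ext (one_smul Ωᵐᵒᵖ (x : E))
  mul_smul := fun a b x => Subtype.ext (mul_smul a b (x : E))
  smul_zero := fun a => Subtype.ext (smul_zero a)
  smul_add := fun a x y => Subtype.ext (smul_add a (x : E) y)
  add_smul := fun a b x => Subtype.ext (add_smul a b (x : E))
  zero_smul := fun x => Subtype.ext (zero_smul Ωᵐᵒᵖ (x : E))

/-- A graded sub-bimodule. -/
noncomputable def sub (E : GradedBimodule Ω) (S : Submodule ℂ E)
    (hl : ∀ (a : Ω), ∀ x ∈ S, a • x ∈ S) (hr : ∀ (a : Ω), ∀ x ∈ S, op a • x ∈ S)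
    (hp : ∀ k, ∀ x ∈ S, gradeProj E.gr k x ∈ S) : GradedBimodule Ω where
  carrier := S
  leftModule := subLeftModule E S hl
  rightModule := subRightModule E S hr
  towerLeft :=
    let _ := subLeftModule E S hl
    ⟨fun c a x => Subtype.ext (smul_assoc c a (x : E))⟩
  towerRight :=
    let _ := subRightModule E S hr
    ⟨fun c a x => Subtype.ext (smul_assoc c a (x : E))⟩
  smulComm :=
    let _ := subLeftModule E S hl
    let _ := subRightModule E S hr
    ⟨fun a b x => Subtype.ext (smul_comm a b (x : E))⟩
  gr k := (E.gr k).comap S.subtype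
  decomposition := (isInternal_of_projections (gr := fun k => (E.gr k).comap S.subtype)
    (fun k => (gradeProj E.gr k).restrict (hp k))
    (fun k x hx => Subtype.ext (gradeProj_of_mem hx))
    (fun k l x hx h => Subtype.ext (gradeProj_of_mem_ne hx h))
    (fun x => by
      obtain ⟨s, hs⟩ := sum_gradeProj E.gr (x : E)
      have : x = ∑ k ∈ s, (gradeProj E.gr k).restrict (hp k) x := by
        apply Subtype.ext
        rw [AddSubmonoidClass.coe_finsetSum]
        exact hs.symm
      rw [this]
      exact Submodule.sum_mem _ fun k _ => Submodule.mem_iSup_of_mem k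
        (gradeProj_mem E.gr k _))).chooseDecomposition
  smul_mem := fun ha hx => E.smul_mem ha hx
  op_smul_mem := fun hx ha => E.op_smul_mem hx ha

/-- The kernel of a bimodule map. -/
noncomputable def ker {E F : GradedBimodule Ω} (f : E →ₗ[ℂ] F) (hf : IsBimodMap f) :
    GradedBimodule Ω :=
  E.sub (LinearMap.ker f) (fun a x hx => by rw [LinearMap.mem_ker] at *; rw [hf.smul, hx, smul_zero])
    (fun a x hx => by rw [LinearMap.mem_ker] at *; rw [hf.op_smul, hx, smul_zero])
    (fun k x hx => by
      rw [LinearMap.mem_ker] at *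
      rw [map_gradeProj hf.mem, hx, map_zero])

/-- The inclusion of the kernel of a bimodule map. -/
noncomputable def kerIncl {E F : GradedBimodule Ω} (f : E →ₗ[ℂ] F) (hf : IsBimodMap f) :
    ker f hf →ₗ[ℂ] E := (LinearMap.ker f).subtype

theorem isBimodMap_kerIncl {E F : GradedBimodule Ω} (f : E →ₗ[ℂ] F) (hf : IsBimodMap f) :
    IsBimodMap (kerIncl f hf) := ⟨fun _ _ => rfl, fun _ _ => rfl, fun _ _ h => h⟩

theorem kerIncl_injective {E F : GradedBimodule Ω} (f : E →ₗ[ℂ] F) (hf : IsBimodMap f) :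
    Function.Injective (kerIncl f hf) := Subtype.val_injective

theorem kerIncl_mem {E F : GradedBimodule Ω} (f : E →ₗ[ℂ] F) (hf : IsBimodMap f)
    (x : ker f hf) : f (kerIncl f hf x) = 0 := x.2

theorem mem_ker_gr {E F : GradedBimodule Ω} (f : E →ₗ[ℂ] F) (hf : IsBimodMap f) {k : ℕ}
    {x : ker f hf} : x ∈ (ker f hf).gr k ↔ kerIncl f hf x ∈ E.gr k := Iff.rfl

/-- The factorisation of a linear map through the kernel of a bimodule map. -/
noncomputable def kerLift {E F G : GradedBimodule Ω} (f : E →ₗ[ℂ] F) (hf : IsBimodMap f)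
    (g : G →ₗ[ℂ] E) (h : ∀ x, f (g x) = 0) : G →ₗ[ℂ] ker f hf :=
  LinearMap.codRestrict (LinearMap.ker f) g h

theorem kerIncl_kerLift {E F G : GradedBimodule Ω} (f : E →ₗ[ℂ] F) (hf : IsBimodMap f)
    (g : G →ₗ[ℂ] E) (h : ∀ x, f (g x) = 0) (x : G) : kerIncl f hf (kerLift f hf g h x) = g x := rfl

theorem isBimodMap_kerLift {E F G : GradedBimodule Ω} (f : E →ₗ[ℂ] F) (hf : IsBimodMap f)
    (g : G →ₗ[ℂ] E) (hg : IsBimodMap g) (h : ∀ x, f (g x) = 0) : IsBimodMap (kerLift f hf g h) :=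
  ⟨fun a x => Subtype.ext (hg.smul a x), fun a x => Subtype.ext (hg.op_smul a x), hg.mem⟩

/-- The free graded bimodule `Ω ^ ι`. -/
noncomputable def free (Ω : DGAlgebra.{u}) (ι : Type) [Fintype ι] : GradedBimodule Ω where
  carrier := ι → Ω
  gr k := Submodule.pi Set.univ fun _ => Ω.gr k
  decomposition := (isInternal_of_projections (gr := fun k => Submodule.pi Set.univ fun _ => Ω.gr k)
    (fun k => LinearMap.pi fun i => gradeProj Ω.gr k ∘ₗ LinearMap.proj i)
    (fun k x hx => funext fun i => gradeProj_of_mem (hx i trivial))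
    (fun k l x hx h => funext fun i => gradeProj_of_mem_ne (hx i trivial) h)
    (fun x => by
      classical
      rw [← Finset.univ_sum_single x]
      refine Submodule.sum_mem _ fun i _ => ?_
      obtain ⟨s, hs⟩ := sum_gradeProj Ω.gr (x i)
      rw [← hs, ← LinearMap.coe_single ℂ (fun _ => Ω.carrier) i, map_sum]
      refine Submodule.sum_mem _ fun k _ => Submodule.mem_iSup_of_mem k fun j _ => ?_
      by_cases hj : j = i
      · subst hj
        simpa using gradeProj_mem Ω.gr k (x j)
      · simp [hj])).chooseDecomposition
  smul_mem := fun ha hx i _ => SetLike.mul_mem_graded ha (hx i trivial)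
  op_smul_mem := fun hx ha i _ => SetLike.mul_mem_graded (hx i trivial) ha

/-- The direct sum of two graded bimodules. -/
noncomputable def prod (E F : GradedBimodule Ω) : GradedBimodule Ω where
  carrier := E × F
  gr k := (E.gr k).prod (F.gr k)
  decomposition := (isInternal_of_projections (gr := fun k => (E.gr k).prod (F.gr k))
    (fun k => (gradeProj E.gr k).prodMap (gradeProj F.gr k))
    (fun k x hx => Prod.ext (gradeProj_of_mem hx.1) (gradeProj_of_mem hx.2))
    (fun k l x hx h => Prod.ext (gradeProj_of_mem_ne hx.1 h) (gradeProj_of_mem_ne hx.2 h))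
    (fun x => by
      have hx : x = LinearMap.inl ℂ E F x.1 + LinearMap.inr ℂ E F x.2 := by simp
      rw [hx]
      obtain ⟨s, hs⟩ := sum_gradeProj E.gr x.1
      obtain ⟨t, ht⟩ := sum_gradeProj F.gr x.2
      rw [← hs, ← ht, map_sum, map_sum]
      refine add_mem (Submodule.sum_mem _ fun k _ => Submodule.mem_iSup_of_mem k ?_)
        (Submodule.sum_mem _ fun k _ => Submodule.mem_iSup_of_mem k ?_)
      · exact ⟨gradeProj_mem E.gr k _, zero_mem _⟩
      · exact ⟨zero_mem _, gradeProj_mem F.gr k _⟩)).chooseDecomposition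
  smul_mem := fun ha hx => ⟨E.smul_mem ha hx.1, F.smul_mem ha hx.2⟩
  op_smul_mem := fun hx ha => ⟨E.op_smul_mem hx.1 ha, F.op_smul_mem hx.2 ha⟩

end GradedBimodule

/-! ### Direct sums and dual bases -/

namespace GradedBimodule

variable {Ω : DGAlgebra.{u}}

section Prod

variable (E F : GradedBimodule Ω)

/-- The first projection. -/
noncomputable def prodFst : prod E F →ₗ[ℂ] E := LinearMap.fst ℂ E F
/-- The second projection. -/
noncomputable def prodSnd : prod E F →ₗ[ℂ] F := LinearMap.snd ℂ E F
/-- The first inclusion. -/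
noncomputable def prodInl : E →ₗ[ℂ] prod E F := LinearMap.inl ℂ E F
/-- The second inclusion. -/
noncomputable def prodInr : F →ₗ[ℂ] prod E F := LinearMap.inr ℂ E F

theorem isBimodMap_prodFst : IsBimodMap (prodFst E F) :=
  ⟨fun _ _ => rfl, fun _ _ => rfl, fun _ _ h => h.1⟩

theorem isBimodMap_prodSnd : IsBimodMap (prodSnd E F) :=
  ⟨fun _ _ => rfl, fun _ _ => rfl, fun _ _ h => h.2⟩

theorem isBimodMap_prodInl : IsBimodMap (prodInl E F) :=
  ⟨fun a _ => Prod.ext rfl (smul_zero a).symm, fun a _ => Prod.ext rfl (smul_zero (op a)).symm,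
    fun _ _ h => ⟨h, zero_mem _⟩⟩

theorem isBimodMap_prodInr : IsBimodMap (prodInr E F) :=
  ⟨fun a _ => Prod.ext (smul_zero a).symm rfl, fun a _ => Prod.ext (smul_zero (op a)).symm rfl,
    fun _ _ h => ⟨zero_mem _, h⟩⟩

theorem prodInl_add_prodInr (x : prod E F) :
    prodInl E F (prodFst E F x) + prodInr E F (prodSnd E F x) = x :=
  Prod.ext (add_zero _) (zero_add _)

end Prod

/-- A dual basis of a graded bimodule consists of central elements `vec i` of degree zero and
bimodule maps `coord i` to `Ω` of degree zero such that `x = ∑ i, coord i x • vec i`. -/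
structure DualBasis (E : GradedBimodule Ω) (ι : Type) [Fintype ι] where
  vec : ι → E
  vec_mem : ∀ i, vec i ∈ E.centreGr 0
  coord : ι → E →ₗ[ℂ] Ω
  coord_smul : ∀ i (a : Ω) (x : E), coord i (a • x) = a * coord i x
  coord_op_smul : ∀ i (a : Ω) (x : E), coord i (op a • x) = coord i x * a
  coord_mem : ∀ i (k : ℕ) (x : E), x ∈ E.gr k → coord i x ∈ Ω.gr k
  sum_coord : ∀ x, ∑ i, coord i x • vec i = x

namespace DualBasis

variable {E F : GradedBimodule Ω} {ι κ : Type} [Fintype ι] [Fintype κ] (b : DualBasis E ι)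

theorem par_vec (i : ι) : E.par (b.vec i) = b.vec i := parity_of_mem_zero (b.vec_mem i).1

theorem op_smul_vec (i : ι) (a : Ω) : op a • b.vec i = a • b.vec i :=
  op_smul_of_mem_centreGr_zero (b.vec_mem i) a

theorem coord_par (i : ι) (x : E) : b.coord i (E.par x) = Ω.par (b.coord i x) :=
  map_parity (b.coord_mem i) x

theorem coord_mem_centreGr (i : ι) {k : ℕ} {x : E} (hx : x ∈ E.centreGr k) :
    b.coord i x ∈ Ω.centreGr k :=
  ⟨b.coord_mem i k x hx.1, fun l a ha => by
    rw [← b.coord_op_smul, hx.2 l a ha, LinearMap.map_smul, b.coord_smul]⟩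

theorem map_eq_sum {f : E →ₗ[ℂ] F} (hf : ∀ (a : Ω) (x : E), f (a • x) = a • f x) (x : E) :
    f x = ∑ i, b.coord i x • f (b.vec i) := by
  conv_lhs => rw [← b.sum_coord x, map_sum]
  simp only [hf]

theorem ext_coord {x y : E} (h : ∀ i, b.coord i x = b.coord i y) : x = y := by
  rw [← b.sum_coord x, ← b.sum_coord y]
  simp only [h]

/-- The bimodule map `v ↦ ∑ i, v i • x i` for central elements `x i` of degree zero. -/
noncomputable def ofCentral (x : ι → E) : free Ω ι →ₗ[ℂ] E where
  toFun v := ∑ i, (show ι → Ω from v) i • x i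
  map_add' v w := by
    rw [← Finset.sum_add_distrib]
    exact Finset.sum_congr rfl fun i _ => add_smul _ _ _
  map_smul' c v := by
    rw [Finset.smul_sum]
    exact Finset.sum_congr rfl fun i _ => smul_assoc _ _ _

theorem isBimodMap_ofCentral (x : ι → E) (hx : ∀ i, x i ∈ E.centreGr 0) :
    IsBimodMap (ofCentral x) where
  smul a v := by
    change ∑ i, (a * (show ι → Ω from v) i) • x i = a • ∑ i, (show ι → Ω from v) i • x i
    simp only [mul_smul, Finset.smul_sum]
  op_smul a v := by
    change ∑ i, ((show ι → Ω from v) i * a) • x i = op a • ∑ i, (show ι → Ω from v) i • x i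
    rw [Finset.smul_sum]
    refine Finset.sum_congr rfl fun i _ => ?_
    rw [smul_comm, op_smul_of_mem_centreGr_zero (hx i), mul_smul]
  mem k v hv := by
    refine Submodule.sum_mem _ fun i _ => ?_
    simpa using E.smul_mem (hv i trivial) (hx i).1

/-- The coordinates as a bimodule map. -/
noncomputable def toFree : E →ₗ[ℂ] free Ω ι := LinearMap.pi b.coord

theorem isBimodMap_toFree : IsBimodMap b.toFree :=
  ⟨fun a x => funext fun i => b.coord_smul i a x, fun a x => funext fun i => b.coord_op_smul i a x,
    fun k x hx i _ => b.coord_mem i k x hx⟩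

/-- A retract of a graded bimodule with a dual basis has a dual basis. -/
def retract {G : GradedBimodule Ω} {s : G →ₗ[ℂ] E} {r : E →ₗ[ℂ] G} (hs : IsBimodMap s)
    (hr : IsBimodMap r) (h : ∀ x, r (s x) = x) : DualBasis G ι where
  vec i := r (b.vec i)
  vec_mem i := hr.mem_centreGr (b.vec_mem i)
  coord i := b.coord i ∘ₗ s
  coord_smul i a x := by simp [hs.smul, b.coord_smul]
  coord_op_smul i a x := by simp [hs.op_smul, b.coord_op_smul]
  coord_mem i k x hx := b.coord_mem i k _ (hs.mem k x hx)
  sum_coord x := by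
    conv_rhs => rw [← h x, b.map_eq_sum hr.smul]
    rfl

/-- The dual basis of a direct sum. -/
noncomputable def prod (b : DualBasis E ι) (c : DualBasis F κ) :
    DualBasis (GradedBimodule.prod E F) (ι ⊕ κ) where
  vec := Sum.elim (fun i => prodInl E F (b.vec i)) fun j => prodInr E F (c.vec j)
  vec_mem := by
    rintro (i | j)
    · exact (isBimodMap_prodInl E F).mem_centreGr (b.vec_mem i)
    · exact (isBimodMap_prodInr E F).mem_centreGr (c.vec_mem j)
  coord := Sum.elim (fun i => b.coord i ∘ₗ prodFst E F) fun j => c.coord j ∘ₗ prodSnd E F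
  coord_smul := by
    rintro (i | j) a x
    · exact b.coord_smul i a x.1
    · exact c.coord_smul j a x.2
  coord_op_smul := by
    rintro (i | j) a x
    · exact b.coord_op_smul i a x.1
    · exact c.coord_op_smul j a x.2
  coord_mem := by
    rintro (i | j) k x hx
    · exact b.coord_mem i k _ hx.1
    · exact c.coord_mem j k _ hx.2
  sum_coord x := by
    rw [Fintype.sum_sum_type]
    conv_rhs => rw [← prodInl_add_prodInr E F x, b.map_eq_sum (isBimodMap_prodInl E F).smul,
      c.map_eq_sum (isBimodMap_prodInr E F).smul]
    rfl

/-- The map v ↦ ∑ v_i vec_i is a retraction of the free bimodule onto E, with the coordinates as a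
section. Its kernel is the complement, and x ↦ x - s(r(x)) projects onto it. -/
theorem isFGP (b : DualBasis E ι) : E.IsFGP := by
  let r := ofCentral b.vec
  have hr : IsBimodMap r := isBimodMap_ofCentral b.vec b.vec_mem
  have hrc : ∀ x, r (b.toFree x) = x := b.sum_coord
  let π : GradedBimodule.free Ω ι →ₗ[ℂ] GradedBimodule.free Ω ι := LinearMap.id - b.toFree ∘ₗ r
  have hπ : IsBimodMap π := (IsBimodMap.id _).sub (b.isBimodMap_toFree.comp hr)
  have hrπ : ∀ v, r (π v) = 0 := fun v => by simp [π, hrc]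
  let i := kerIncl r hr
  have hi := isBimodMap_kerIncl r hr
  have hri : ∀ y, r (i y) = 0 := kerIncl_mem r hr
  let e₁ : (E × ker r hr) ≃ₗ[ℂ] GradedBimodule.free Ω ι :=
    LinearEquiv.ofLinearMap (LinearMap.coprod b.toFree i)
      (LinearMap.prod r (kerLift r hr π hrπ))
      (LinearMap.ext fun v => by
        change b.toFree (r v) + (v - b.toFree (r v)) = v
        abel)
      (LinearMap.ext fun x => by
        refine Prod.ext ?_ (kerIncl_injective r hr ?_)
        · simp [hrc, hri]
        · change b.toFree x.1 + i x.2 - b.toFree (r (b.toFree x.1 + i x.2)) = i x.2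
          rw [map_add, hrc, hri, add_zero, add_sub_cancel_left])
  have he₁ : ∀ x y, e₁ (x, y) = b.toFree x + i y := fun _ _ => rfl
  let e₂ : GradedBimodule.free Ω ι ≃ₗ[ℂ] (Fin (Fintype.card ι) → Ω) :=
    LinearEquiv.funCongrLeft ℂ Ω (Fintype.equivFin ι).symm
  refine ⟨ker r hr, Fintype.card ι, e₁.trans e₂, fun a x => ?_, fun a x => ?_, fun k x y => ?_⟩
  · obtain ⟨x, y⟩ := x
    have h : e₁ (a • (x, y)) = a • e₁ (x, y) := by
      change e₁ (a • x, a • y) = _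
      rw [he₁, he₁, b.isBimodMap_toFree.smul, hi.smul, smul_add]
    rw [LinearEquiv.trans_apply, h]
    rfl
  · obtain ⟨x, y⟩ := x
    have h : e₁ (op a • (x, y)) = op a • e₁ (x, y) := by
      change e₁ (op a • x, op a • y) = _
      rw [he₁, he₁, b.isBimodMap_toFree.op_smul, hi.op_smul, smul_add]
    rw [LinearEquiv.trans_apply, h]
    rfl
  · have h2 : (∀ j, (e₁.trans e₂) (x, y) j ∈ Ω.gr k) ↔ e₁ (x, y) ∈ (GradedBimodule.free Ω ι).gr k := by
      constructor
      · intro h j _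
        have h3 := h (Fintype.equivFin ι j)
        change (show ι → Ω from e₁ (x, y)) ((Fintype.equivFin ι).symm (Fintype.equivFin ι j)) ∈ _ at h3
        rwa [Equiv.symm_apply_apply] at h3
      · intro h j
        exact h _ trivial
    rw [h2, he₁]
    constructor
    · rintro ⟨hx, hy⟩
      exact add_mem (b.isBimodMap_toFree.mem k x hx) (hi.mem k y hy)
    · intro h
      have hx : x ∈ E.gr k := by
        have := hr.mem k _ h
        rwa [map_add, hrc, hri, add_zero] at this
      refine ⟨hx, ?_⟩
      have := sub_mem h (b.isBimodMap_toFree.mem k x hx)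
      rwa [add_sub_cancel_left] at this

/-- The standard basis vectors of Ω^n are central of degree zero, so their components in E are too;
the coordinates are those of Ω^n restricted to E. Thus fgp bimodules are generated by central
elements, on which all later arguments rest. -/
theorem nonempty_of_isFGP (h : E.IsFGP) : ∃ n, Nonempty (DualBasis E (Fin n)) := by
  obtain ⟨F, n, e, hl, hr, hg⟩ := h
  refine ⟨n, ⟨⟨fun i => (e.symm (Pi.single i 1)).1, fun i => ?_,
    fun i => LinearMap.proj i ∘ₗ e.toLinearMap ∘ₗ LinearMap.inl ℂ E F, fun i a x => ?_,
    fun i a x => ?_, fun i k x hx => ?_, fun x => ?_⟩⟩⟩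
  · refine ⟨((hg 0 _ (e.symm (Pi.single i 1)).2).2 fun j => ?_).1, fun l a ha => ?_⟩
    · rw [Prod.mk.eta, e.apply_symm_apply]
      by_cases h : j = i
      · subst h
        simpa using SetLike.one_mem_graded Ω.gr
      · simp [h]
    · rw [zero_mul, pow_zero, one_smul]
      have : op a • e.symm (Pi.single i 1) = a • e.symm (Pi.single i 1) := by
        apply e.injective
        rw [hl, hr, e.apply_symm_apply, ← Pi.single_smul, ← Pi.single_smul]
        simp
      exact congrArg Prod.fst this
  · have := congrFun (hl a (x, 0)) i
    rw [Prod.smul_mk, smul_zero] at this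
    exact this
  · have := congrFun (hr a (x, 0)) i
    rw [Prod.smul_mk, smul_zero] at this
    exact this
  · exact (hg k x 0).1 ⟨hx, zero_mem _⟩ i
  · have h : ∑ i, e (x, 0) i • e.symm (Pi.single i 1) = (x, 0) := by
      apply e.injective
      rw [map_sum]
      simp only [hl, e.apply_symm_apply, ← Pi.single_smul, smul_eq_mul, mul_one]
      exact Finset.univ_sum_single _
    have h2 := congrArg (LinearMap.fst ℂ E F) h
    rw [map_sum] at h2
    exact h2

end DualBasis

end GradedBimodule

/-! ### Connections without homogeneity assumptions, and chosen dual bases -/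

open GradedBimodule

namespace FlatConn

variable {Ω : DGAlgebra.{u}}

/-- The number of elements of a chosen dual basis. -/
noncomputable def rank (X : FlatConn Ω) : ℕ := (DualBasis.nonempty_of_isFGP X.isFGP).choose

/-- A chosen dual basis. -/
noncomputable def basis (X : FlatConn Ω) : DualBasis X.toGradedBimodule (Fin X.rank) :=
  (DualBasis.nonempty_of_isFGP X.isFGP).choose_spec.some

theorem conn_op_smul (X : FlatConn Ω) (a : Ω) (x : X) :
    X.conn (op a • x) = op a • X.conn x + op (Ω.d a) • X.par x := by
  refine eq_of_homogeneous X.gr (f := X.conn ∘ₗ X.ract a)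
    (g := X.ract a ∘ₗ X.conn + X.ract (Ω.d a) ∘ₗ X.par) (fun k x hx => ?_) x
  simp only [LinearMap.comp_apply, LinearMap.add_apply, ract_apply]
  rw [X.conn_right hx, parity_of_mem hx, smul_comm (op (Ω.d a))]

theorem conn_smul (X : FlatConn Ω) (a : Ω) (x : X) :
    X.conn (a • x) = Ω.d a • x + Ω.par a • X.conn x := by
  refine eq_of_homogeneous Ω.gr (f := X.conn ∘ₗ X.lact.flip x)
    (g := X.lact.flip x ∘ₗ Ω.d + X.lact.flip (X.conn x) ∘ₗ Ω.par) (fun k a ha => ?_) a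
  simp only [LinearMap.comp_apply, LinearMap.add_apply, LinearMap.flip_apply, lact_apply]
  rw [X.conn_left ha, parity_of_mem ha, smul_assoc]

theorem par_conn (X : FlatConn Ω) (x : X) : X.par (X.conn x) = -X.conn (X.par x) :=
  parity_map_of_degree_one (fun _ _ h => X.conn_mem h) x

/-- Apply the left and the right Leibniz rule to a x = x a. The terms containing da agree because x
is central of degree zero; what remains is the graded commutation of ∇x with a. -/
theorem conn_mem_centreGr_one (X : FlatConn Ω) {x : X} (hx : x ∈ X.centreGr 0) :
    X.conn x ∈ X.centreGr 1 := by
  refine ⟨X.conn_mem hx.1, fun l a ha => ?_⟩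
  have h1 := conn_op_smul X a x
  rw [op_smul_of_mem_centreGr_zero hx, parity_of_mem_zero hx.1, op_smul_of_mem_centreGr_zero hx,
    conn_smul, add_comm, add_right_cancel_iff, parity_of_mem ha, smul_assoc] at h1
  rw [← h1, one_mul]

theorem isBimodMap_lin {X Y : FlatConn Ω} (f : X ⟶ Y) : IsBimodMap (lin f) :=
  ⟨Hom.map_smul f, Hom.map_op_smul f, fun _ _ h => Hom.map_mem f h⟩

theorem lin_conn {X Y : FlatConn Ω} (f : X ⟶ Y) (x : X) :
    lin f (X.conn x) = Y.conn (lin f x) := Hom.map_conn f x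

end FlatConn

/-! ### Matrices of bimodule maps -/

open GradedBimodule

variable {Ω : DGAlgebra.{u}}

namespace GradedBimodule.DualBasis

variable {E F : GradedBimodule Ω} {ι κ : Type} [Fintype ι] [Fintype κ] (b : DualBasis E ι)
  (c : DualBasis F κ)

/-- The matrix of a bimodule map. -/
noncomputable def matrix (f : E →ₗ[ℂ] F) (hf : IsBimodMap f) : Matrix κ ι (CentreZero Ω) :=
  fun j i => CentreZero.mk (c.coord j (f (b.vec i)))
    (c.coord_mem_centreGr j (hf.mem_centreGr (b.vec_mem i)))

theorem val_matrix (f : E →ₗ[ℂ] F) (hf : IsBimodMap f) (j : κ) (i : ι) :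
    (b.matrix c f hf j i).val = c.coord j (f (b.vec i)) := rfl

theorem eq_zero_of_matrix (f : E →ₗ[ℂ] F) (hf : IsBimodMap f)
    (h : ∀ j i, b.matrix c f hf j i = 0) (x : E) : f x = 0 := by
  rw [b.map_eq_sum hf.smul]
  refine Finset.sum_eq_zero fun i _ => ?_
  have : f (b.vec i) = 0 := c.ext_coord fun j => by
    rw [← val_matrix b c f hf, h, map_zero, CentreZero.val_zero]
  rw [this, smul_zero]

theorem smul_vec_mem (z : CentreZero Ω) {x : E} (hx : x ∈ E.centreGr 0) :
    z.val • x ∈ E.centreGr 0 := (z • (⟨x, hx⟩ : E.centreGr 0)).2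

/-- The bimodule map of a matrix. -/
noncomputable def ofMatrix (N : Matrix κ ι (CentreZero Ω)) : E →ₗ[ℂ] F :=
  ofCentral (fun i => ∑ j, (N j i).val • c.vec j) ∘ₗ b.toFree

theorem ofMatrix_apply (N : Matrix κ ι (CentreZero Ω)) (x : E) :
    b.ofMatrix c N x = ∑ i, b.coord i x • ∑ j, (N j i).val • c.vec j := rfl

theorem isBimodMap_ofMatrix (N : Matrix κ ι (CentreZero Ω)) : IsBimodMap (b.ofMatrix c N) :=
  (isBimodMap_ofCentral _ fun _ => Submodule.sum_mem _ fun j _ =>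
    smul_vec_mem _ (c.vec_mem j)).comp b.isBimodMap_toFree

/-- The vectors of a dual basis may be linearly dependent, and the matrix of `ofMatrix N` need not
be N. Nevertheless the coordinates of f g f on the vectors are exactly the entries of the product f
N f, so the matrix identity suffices. -/
theorem generalised_inverse_of_matrix {f : E →ₗ[ℂ] F} (hf : IsBimodMap f)
    {N : Matrix ι κ (CentreZero Ω)} (hN : b.matrix c f hf * N * b.matrix c f hf = b.matrix c f hf)
    (x : E) : f (c.ofMatrix b N (f x)) = f x := by
  have hg := c.isBimodMap_ofMatrix b N
  refine (b.map_eq_sum (f := f ∘ₗ c.ofMatrix b N ∘ₗ f) (hf.comp (hg.comp hf)).smul x).trans ?_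
  rw [b.map_eq_sum hf.smul x]
  refine Finset.sum_congr rfl fun k _ => ?_
  congr 1
  refine c.ext_coord fun l => ?_
  have h := congrArg CentreZero.val (congrFun (congrFun hN l) k)
  rw [val_matrix] at h
  rw [← h]
  simp only [LinearMap.comp_apply, ofMatrix_apply, map_sum, hf.smul, c.coord_smul, Matrix.mul_apply,
    CentreZero.val_sum, CentreZero.val_mul, val_matrix]
  refine Finset.sum_congr rfl fun j _ => ?_
  rw [← val_matrix b c f hf j k, CentreZero.val_commute]
  congr 1
  refine Finset.sum_congr rfl fun i _ => ?_
  rw [CentreZero.val_commute]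

end GradedBimodule.DualBasis

namespace FlatConn

variable {X Y Z : FlatConn Ω}

@[simp] theorem lin_comp (f : X ⟶ Y) (g : Y ⟶ Z) (x : X) : lin (f ≫ g) x = lin g (lin f x) := rfl
@[simp] theorem lin_id (x : X) : lin (𝟙 X) x = x := rfl
@[simp] theorem lin_zero (x : X) : lin (0 : X ⟶ Y) x = 0 := rfl
@[simp] theorem lin_add (f g : X ⟶ Y) (x : X) : lin (f + g) x = lin f x + lin g x := rfl
@[simp] theorem lin_smul (c : ℂ) (f : X ⟶ Y) (x : X) : lin (c • f) x = c • lin f x := rfl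

theorem hom_ext {f g : X ⟶ Y} (h : ∀ x, lin f x = lin g x) : f = g :=
  lin_injective X Y (LinearMap.ext h)

theorem lin_congr {f g : X ⟶ Y} (h : f = g) (x : X) : lin f x = lin g x := by rw [h]

/-- A morphism from a bimodule map which commutes with the connections. -/
def homOfBimodMap (f : X →ₗ[ℂ] Y) (hf : IsBimodMap f)
    (hc : ∀ x, f (X.conn x) = Y.conn (f x)) : X ⟶ Y :=
  (⟨f, hf.smul, hf.op_smul, fun h => hf.mem _ _ h, hc⟩ : Hom X Y)

@[simp] theorem lin_homOfBimodMap (f : X →ₗ[ℂ] Y) (hf : IsBimodMap f)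
    (hc : ∀ x, f (X.conn x) = Y.conn (f x)) (x : X) : lin (homOfBimodMap f hf hc) x = f x := rfl

/-! ### Generalised inverses of morphisms -/

/-- The matrix of a morphism. -/
noncomputable abbrev matrix (f : X ⟶ Y) : Matrix (Fin Y.rank) (Fin X.rank) (CentreZero Ω) :=
  X.basis.matrix Y.basis (lin f) (isBimodMap_lin f)

/-- Coordinates do not intertwine ∇ and d. Expanding y in the dual basis and comparing the two
Leibniz rules leaves a defect linear in the coordinates of y. It includes d(coord_j(vec_l)), because
coord_j(vec_l) is an idempotent matrix and not the identity. -/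
theorem d_coord (j : Fin Y.rank) {y : Y} (hy : y ∈ Y.centreGr 0) :
    Ω.d (Y.basis.coord j y) = Y.basis.coord j (Y.conn y) +
      ∑ l, Y.basis.coord l y * (Ω.d (Y.basis.coord j (Y.basis.vec l)) -
        Y.basis.coord j (Y.conn (Y.basis.vec l))) := by
  have h1 : Y.basis.coord j y = ∑ l, Y.basis.coord l y * Y.basis.coord j (Y.basis.vec l) := by
    conv_lhs => rw [← Y.basis.sum_coord y]
    simp only [map_sum, Y.basis.coord_smul]
  have h2 : Y.conn y = ∑ l, (Ω.d (Y.basis.coord l y) • Y.basis.vec l +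
      Y.basis.coord l y • Y.conn (Y.basis.vec l)) := by
    conv_lhs => rw [← Y.basis.sum_coord y]
    simp only [map_sum, conn_smul]
    refine Finset.sum_congr rfl fun l _ => ?_
    rw [parity_of_mem_zero (Y.basis.coord_mem l 0 y hy.1)]
  rw [h2, h1]
  simp only [map_sum, map_add, Y.basis.coord_smul]
  rw [← Finset.sum_add_distrib]
  refine Finset.sum_congr rfl fun l _ => ?_
  rw [DGAlgebra.d_mul, parity_of_mem_zero (Y.basis.coord_mem l 0 y hy.1)]
  noncomm_ring

/-- The relation f∇ = ∇f in coordinates. Γ is the connection matrix of X, and θ is the defect of the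
coordinates of Y from `d_coord`; both have entries in the graded centre because ∇ sends central
elements of degree zero to central elements. -/
theorem diff_matrix (f : X ⟶ Y) : ∃ (Γ : Matrix (Fin X.rank) (Fin X.rank) (Ω.centreGr 1))
    (θ : Matrix (Fin Y.rank) (Fin Y.rank) (Ω.centreGr 1)),
    ∀ j i, CentreZero.diff Ω (matrix f j i) =
      ∑ l, matrix f j l • Γ l i + ∑ l, matrix f l i • θ j l := by
  refine ⟨fun l i => ⟨X.basis.coord l (X.conn (X.basis.vec i)),
      X.basis.coord_mem_centreGr l (X.conn_mem_centreGr_one (X.basis.vec_mem i))⟩,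
    fun j l => ⟨Ω.d (Y.basis.coord j (Y.basis.vec l)) - Y.basis.coord j (Y.conn (Y.basis.vec l)),
      sub_mem (DGAlgebra.d_mem_centreGr (Y.basis.coord_mem_centreGr j (Y.basis.vec_mem l)))
        (Y.basis.coord_mem_centreGr j (Y.conn_mem_centreGr_one (Y.basis.vec_mem l)))⟩,
    fun j i => Subtype.ext ?_⟩
  rw [CentreZero.coe_diff, Submodule.coe_add, AddSubmonoidClass.coe_finsetSum,
    AddSubmonoidClass.coe_finsetSum]
  simp only [CentreZero.coe_smul_centreGr_one, DualBasis.val_matrix]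
  rw [d_coord j ((isBimodMap_lin f).mem_centreGr (X.basis.vec_mem i)), ← lin_conn]
  congr 1
  conv_lhs => rw [X.basis.map_eq_sum (isBimodMap_lin f).smul]
  simp only [map_sum, Y.basis.coord_smul]
  refine Finset.sum_congr rfl fun l _ => ?_
  rw [← DualBasis.val_matrix X.basis Y.basis (lin f) (isBimodMap_lin f), CentreZero.val_commute]

/-- This is the constancy of the rank of a parallel map: the ideals of minors are finitely generated
and, by `diff_matrix`, stable under d. -/
theorem minorIdeal_matrix (hΩ : Ω.IsDiffSimple) (f : X ⟶ Y) (k : ℕ) :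
    (matrix f).minorIdeal k = ⊥ ∨ (matrix f).minorIdeal k = ⊤ := by
  obtain ⟨Γ, θ, h⟩ := diff_matrix f
  exact hΩ _ (Matrix.minorIdeal_fg _ _) fun a ha =>
    Matrix.derivation_minorIdeal (CentreZero.diff Ω) CentreZero.diff_mul (matrix f) Γ θ h k ha

/-- Constant rank yields g over the centre. It is only a bimodule map and need not be parallel,
which is why kernels and cokernels require compressed connections. -/
theorem exists_generalised_inverse [Nontrivial (CentreZero Ω)] (hΩ : Ω.IsDiffSimple) (f : X ⟶ Y) :
    ∃ g : Y →ₗ[ℂ] X, IsBimodMap g ∧ ∀ x, lin f (g (lin f x)) = lin f x := by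
  obtain ⟨N, hN⟩ := Matrix.exists_generalised_inverse (matrix f) (minorIdeal_matrix hΩ f)
  exact ⟨_, Y.basis.isBimodMap_ofMatrix X.basis N,
    X.basis.generalised_inverse_of_matrix Y.basis (isBimodMap_lin f) hN⟩

/-- The ideal generated by the entries is zero or everything. Being contained in the kernel of the
unital map p, it is proper, hence zero. -/
theorem eq_zero_of_matrix_character (hΩ : Ω.IsDiffSimple) (p : CentreZero Ω →ₐ[ℂ] ℂ) (f : X ⟶ Y)
    (h : ∀ j i, p (matrix f j i) = 0) : f = 0 := by
  have h1 := minorIdeal_matrix hΩ f 1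
  rw [Matrix.minorIdeal_one] at h1
  rcases h1 with h1 | h1
  · rw [Ideal.span_eq_bot] at h1
    exact hom_ext fun x => X.basis.eq_zero_of_matrix Y.basis _ (isBimodMap_lin f)
      (fun j i => h1 _ ⟨(j, i), rfl⟩) x
  · exfalso
    have h2 : Ideal.span (Set.range fun q : Fin Y.rank × Fin X.rank => matrix f q.1 q.2) ≤
        RingHom.ker p := by
      rw [Ideal.span_le]
      rintro _ ⟨⟨j, i⟩, rfl⟩
      exact h j i
    rw [h1] at h2
    have h3 : p 1 = 0 := h2 trivial
    rw [map_one] at h3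
    exact one_ne_zero h3

/-! ### Kernels and cokernels -/

/-- The kernel of an idempotent bimodule map `h`, with the connection `(1 - h) ∇`. -/
noncomputable def corner (X : FlatConn Ω) (h : X →ₗ[ℂ] X) (hh : IsBimodMap h)
    (hi : ∀ x, h (h x) = h x) (hc : ∀ x, h x = 0 → h (X.conn (h (X.conn x))) =
      X.conn (h (X.conn x))) : FlatConn Ω where
  toGradedBimodule := ker h hh
  isFGP := (X.basis.retract (isBimodMap_kerIncl h hh) (r := kerLift h hh (LinearMap.id - h)
    fun x => by simp [hi]) (isBimodMap_kerLift _ _ _ ((IsBimodMap.id _).sub hh) _)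
    (fun x => kerIncl_injective h hh (by simp [kerIncl_kerLift, kerIncl_mem]))).isFGP
  conn := kerLift h hh ((LinearMap.id - h) ∘ₗ X.conn ∘ₗ kerIncl h hh) fun x => by simp [hi]
  conn_mem := fun {n x} hx => by
    rw [mem_ker_gr, kerIncl_kerLift]
    exact ((IsBimodMap.id _).sub hh).mem _ _ (X.conn_mem ((mem_ker_gr h hh).1 hx))
  conn_right := fun {n x} hx a => kerIncl_injective h hh <| by
    have h1 := X.conn_right (x := kerIncl h hh x) hx a
    have h2 := kerIncl_mem h hh x
    simp only [map_add, map_smul, kerIncl_kerLift, (isBimodMap_kerIncl h hh).op_smul,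
      LinearMap.comp_apply, LinearMap.sub_apply, LinearMap.id_apply, h1, hh.op_smul, h2, smul_zero,
      smul_sub]
    abel
  conn_left := fun {n a} ha x => kerIncl_injective h hh <| by
    have h1 := X.conn_left ha (kerIncl h hh x)
    have h2 := kerIncl_mem h hh x
    simp only [map_add, map_smul, kerIncl_kerLift, (isBimodMap_kerIncl h hh).smul,
      LinearMap.comp_apply, LinearMap.sub_apply, LinearMap.id_apply, h1, hh.smul, h2, smul_zero,
      smul_sub]
    abel
  flat x := kerIncl_injective h hh <| by
    -- Since ∇² = 0, the curvature of (1 - h)∇ at x in the kernel of h is -(1 - h)∇h∇x, and `hc`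
    -- says that this vanishes.
    have h1 := hc _ (kerIncl_mem h hh x)
    simp only [kerIncl_kerLift, LinearMap.comp_apply, LinearMap.sub_apply, LinearMap.id_apply,
      map_sub, X.flat, map_zero, h1]
    simp

section Corner

variable (X : FlatConn Ω) (h : X →ₗ[ℂ] X) (hh : IsBimodMap h)
    (hi : ∀ x, h (h x) = h x) (hc : ∀ x, h x = 0 → h (X.conn (h (X.conn x))) =
      X.conn (h (X.conn x)))

/-- The inclusion of a corner. -/
noncomputable def cornerIncl : X.corner h hh hi hc →ₗ[ℂ] X := kerIncl h hh

/-- The projection to a corner. -/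
noncomputable def cornerProj : X →ₗ[ℂ] X.corner h hh hi hc :=
  kerLift h hh (LinearMap.id - h) fun x => by simp [hi]

theorem isBimodMap_cornerIncl : IsBimodMap (cornerIncl X h hh hi hc) := isBimodMap_kerIncl h hh

theorem isBimodMap_cornerProj : IsBimodMap (cornerProj X h hh hi hc) :=
  isBimodMap_kerLift _ _ _ ((IsBimodMap.id _).sub hh) _

theorem cornerIncl_cornerProj (x : X) :
    cornerIncl X h hh hi hc (cornerProj X h hh hi hc x) = x - h x := rfl

theorem apply_cornerIncl (x : X.corner h hh hi hc) : h (cornerIncl X h hh hi hc x) = 0 :=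
  kerIncl_mem h hh x

theorem cornerIncl_injective : Function.Injective (cornerIncl X h hh hi hc) :=
  kerIncl_injective h hh

theorem cornerProj_cornerIncl (x : X.corner h hh hi hc) :
    cornerProj X h hh hi hc (cornerIncl X h hh hi hc x) = x :=
  cornerIncl_injective X h hh hi hc <| by
    rw [cornerIncl_cornerProj, apply_cornerIncl, sub_zero]

theorem conn_corner (x : X.corner h hh hi hc) : (X.corner h hh hi hc).conn x =
    cornerProj X h hh hi hc (X.conn (cornerIncl X h hh hi hc x)) := rfl

end Corner

end FlatConn

open GradedBimodule Limits

variable {Ω : DGAlgebra.{u}}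

namespace FlatConn

variable {X Y Z : FlatConn Ω}

/-! ### Direct sums -/

/-- The direct sum of two flat connections. -/
noncomputable def prod (X Y : FlatConn Ω) : FlatConn Ω where
  toGradedBimodule := GradedBimodule.prod X.toGradedBimodule Y.toGradedBimodule
  isFGP := (X.basis.prod Y.basis).isFGP
  conn := X.conn.prodMap Y.conn
  conn_mem := fun hx => ⟨X.conn_mem hx.1, Y.conn_mem hx.2⟩
  conn_right := fun hx a => Prod.ext (X.conn_right hx.1 a) (Y.conn_right hx.2 a)
  conn_left := fun ha x => Prod.ext (X.conn_left ha x.1) (Y.conn_left ha x.2)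
  flat x := Prod.ext (X.flat x.1) (Y.flat x.2)

/-- The direct sum as a binary bicone. -/
noncomputable def binaryBicone (X Y : FlatConn Ω) : BinaryBicone X Y where
  pt := prod X Y
  fst := homOfBimodMap _ (isBimodMap_prodFst X.toGradedBimodule Y.toGradedBimodule) fun _ => rfl
  snd := homOfBimodMap _ (isBimodMap_prodSnd X.toGradedBimodule Y.toGradedBimodule) fun _ => rfl
  inl := homOfBimodMap (Y := prod X Y) _
    (isBimodMap_prodInl X.toGradedBimodule Y.toGradedBimodule)
    fun _ => Prod.ext rfl (map_zero Y.conn).symm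
  inr := homOfBimodMap (Y := prod X Y) _
    (isBimodMap_prodInr X.toGradedBimodule Y.toGradedBimodule)
    fun _ => Prod.ext (map_zero X.conn).symm rfl

instance : HasBinaryBiproducts (FlatConn Ω) where
  has_binary_biproduct X Y := hasBinaryBiproduct_of_total (binaryBicone X Y)
    (hom_ext fun x => prodInl_add_prodInr X.toGradedBimodule Y.toGradedBimodule x)

/-- The corner cut out of the unit object by h = 1 has underlying bimodule ker 1 = 0 and serves as
zero object. -/
theorem isZero_corner_id : IsZero ((unit Ω).corner LinearMap.id (IsBimodMap.id _) (fun _ => rfl)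
    fun _ _ => rfl) := by
  have h : ∀ x : (unit Ω).corner LinearMap.id (IsBimodMap.id _) (fun _ => rfl) fun _ _ => rfl,
      x = 0 := fun x => cornerIncl_injective _ _ _ _ _ ((apply_cornerIncl _ _ _ _ _ x).trans
        (map_zero _).symm)
  rw [IsZero.iff_id_eq_zero]
  exact hom_ext fun x => h x

instance : HasZeroObject (FlatConn Ω) := ⟨_, isZero_corner_id⟩

instance : HasFiniteProducts (FlatConn Ω) := hasFiniteProducts_of_has_binary_and_terminal

/-! ### Kernels and cokernels -/

section Kernel

variable (f : X ⟶ Y) (g : Y →ₗ[ℂ] X) (hg : IsBimodMap g)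
  (h : ∀ x, lin f (g (lin f x)) = lin f x)

-- The kernel of f is stable under ∇: from f x = 0 follows f∇x = ∇f x = 0. So g f kills ∇x and both
-- sides vanish.
include h in
theorem conn_kernelObj (x : X) (hx : (g ∘ₗ lin f) x = 0) :
    (g ∘ₗ lin f) (X.conn ((g ∘ₗ lin f) (X.conn x))) = X.conn ((g ∘ₗ lin f) (X.conn x)) := by
  have hx' : lin f x = 0 := by rw [← h, ← LinearMap.comp_apply g, hx, map_zero]
  simp [lin_conn, hx']

/-- The kernel of a morphism with a generalised inverse. -/
noncomputable abbrev kernelObj : FlatConn Ω :=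
  X.corner (g ∘ₗ lin f) (hg.comp (isBimodMap_lin f)) (fun x => by simp [h]) (conn_kernelObj f g h)

theorem lin_cornerIncl_kernelObj (x : kernelObj f g hg h) :
    lin f (cornerIncl _ _ _ _ _ x) = 0 := by
  rw [← h, ← LinearMap.comp_apply g, apply_cornerIncl, map_zero]

/-- The inclusion of the kernel. -/
noncomputable def kernelIncl : kernelObj f g hg h ⟶ X :=
  homOfBimodMap (cornerIncl _ _ _ _ _) (isBimodMap_cornerIncl _ _ _ _ _) fun x => by
    rw [conn_corner, cornerIncl_cornerProj, LinearMap.comp_apply, lin_conn,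
      lin_cornerIncl_kernelObj, map_zero, map_zero, sub_zero]

theorem kernelIncl_comp : kernelIncl f g hg h ≫ f = 0 :=
  hom_ext fun x => lin_cornerIncl_kernelObj f g hg h x

/-- The factorisation through the kernel. -/
noncomputable def kernelLift (k : Z ⟶ X) (hk : k ≫ f = 0) : Z ⟶ kernelObj f g hg h :=
  homOfBimodMap (cornerProj _ _ _ _ _ ∘ₗ lin k)
    ((isBimodMap_cornerProj _ _ _ _ _).comp (isBimodMap_lin k)) fun z => by
    have h1 : ∀ z, lin f (lin k z) = 0 := lin_congr hk
    have h2 : ∀ z, cornerIncl _ _ _ _ _ (cornerProj X (g ∘ₗ lin f) (hg.comp (isBimodMap_lin f))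
      (fun x => by simp [h]) (conn_kernelObj f g h) (lin k z)) = lin k z := fun z => by
        rw [cornerIncl_cornerProj, LinearMap.comp_apply, h1, map_zero, sub_zero]
    rw [conn_corner, LinearMap.comp_apply, LinearMap.comp_apply, h2, lin_conn]

/-- The kernel fork is a limit. -/
noncomputable def kernelIsLimit : IsLimit (KernelFork.ofι (kernelIncl f g hg h)
    (kernelIncl_comp f g hg h)) :=
  KernelFork.IsLimit.ofι _ _ (fun k hk => kernelLift f g hg h k hk)
    (fun k hk => hom_ext fun z => by
      have h1 : ∀ z, lin f (lin k z) = 0 := lin_congr hk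
      change lin k z - g (lin f (lin k z)) = lin k z
      rw [h1, map_zero, sub_zero])
    (fun k hk m hm => hom_ext fun z => by
      apply cornerIncl_injective
      have h1 : ∀ z, lin f (lin k z) = 0 := lin_congr hk
      refine (lin_congr hm z).trans ?_
      change lin k z = lin k z - g (lin f (lin k z))
      rw [h1, map_zero, sub_zero])

-- The image of f is stable under ∇ and f g is the identity on it. The cokernel can therefore be
-- modelled on the complement ker(f g) of the image, with the compressed connection; the projection
-- to it is then parallel, though the inclusion need not be.
include h in
theorem conn_cokernelObj (x : Y) (_ : (lin f ∘ₗ g) x = 0) :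
    (lin f ∘ₗ g) (Y.conn ((lin f ∘ₗ g) (Y.conn x))) = Y.conn ((lin f ∘ₗ g) (Y.conn x)) := by
  simp only [LinearMap.comp_apply, ← lin_conn, h]

/-- The cokernel of a morphism with a generalised inverse. -/
noncomputable abbrev cokernelObj : FlatConn Ω :=
  Y.corner (lin f ∘ₗ g) ((isBimodMap_lin f).comp hg) (fun x => by simp [h]) (conn_cokernelObj f g h)

theorem cornerProj_cokernelObj_lin (x : X) :
    cornerProj Y (lin f ∘ₗ g) ((isBimodMap_lin f).comp hg) (fun x => by simp [h])
      (conn_cokernelObj f g h) (lin f x) = 0 := by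
  apply cornerIncl_injective
  rw [cornerIncl_cornerProj, LinearMap.comp_apply, h, sub_self, map_zero]

/-- The projection to the cokernel. -/
noncomputable def cokernelProj : Y ⟶ cokernelObj f g hg h :=
  homOfBimodMap (cornerProj _ _ _ _ _) (isBimodMap_cornerProj _ _ _ _ _) fun x => by
    rw [conn_corner, cornerIncl_cornerProj, LinearMap.comp_apply, map_sub, ← lin_conn, map_sub,
      cornerProj_cokernelObj_lin f g hg h, sub_zero]

theorem comp_cokernelProj : f ≫ cokernelProj f g hg h = 0 :=
  hom_ext fun x => cornerProj_cokernelObj_lin f g hg h x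

/-- The factorisation through the cokernel. -/
noncomputable def cokernelDesc (k : Y ⟶ Z) (hk : f ≫ k = 0) : cokernelObj f g hg h ⟶ Z :=
  homOfBimodMap (lin k ∘ₗ cornerIncl _ _ _ _ _)
    ((isBimodMap_lin k).comp (isBimodMap_cornerIncl _ _ _ _ _)) fun z => by
    have h1 : ∀ z, lin k (lin f z) = 0 := lin_congr hk
    rw [conn_corner, LinearMap.comp_apply, LinearMap.comp_apply, cornerIncl_cornerProj, map_sub,
      LinearMap.comp_apply, h1, sub_zero, lin_conn]

/-- The cokernel cofork is a colimit. -/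
noncomputable def cokernelIsColimit : IsColimit (CokernelCofork.ofπ (cokernelProj f g hg h)
    (comp_cokernelProj f g hg h)) :=
  CokernelCofork.IsColimit.ofπ _ _ (fun k hk => cokernelDesc f g hg h k hk)
    (fun k hk => hom_ext fun z => by
      have h1 : ∀ z, lin k (lin f z) = 0 := lin_congr hk
      change lin k (z - lin f (g z)) = lin k z
      rw [map_sub, h1, sub_zero])
    (fun k hk m hm => hom_ext fun z => by
      refine Eq.trans ?_ (lin_congr hm _)
      change lin m z = lin m (cornerProj _ _ _ _ _ _)
      rw [cornerProj_cornerIncl])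

-- The kernel inclusion of a monomorphism is zero. Composed with the projection to the kernel it is
-- 1 - g f, so g is a left inverse of f.
include hg h in
theorem injective_of_mono [Mono f] (x : X) : g (lin f x) = x := by
  have h1 : kernelIncl f g hg h = 0 := by
    rw [← cancel_mono f, kernelIncl_comp, zero_comp]
  have h2 := lin_congr h1 (cornerProj _ _ _ _ _ x)
  have h3 : x - g (lin f x) = 0 := h2
  exact (sub_eq_zero.1 h3).symm

include hg h in
theorem surjective_of_epi [Epi f] (y : Y) : lin f (g y) = y := by
  have h1 : cokernelProj f g hg h = 0 := by
    rw [← cancel_epi f, comp_cokernelProj, comp_zero]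
  have h2 := congrArg (cornerIncl _ _ _ _ _) (lin_congr h1 y)
  have h3 : y - lin f (g y) = 0 := h2.trans (map_zero _)
  exact (sub_eq_zero.1 h3).symm

end Kernel

/-! ### The abelian structure -/

section Abelian

variable [Nontrivial (CentreZero Ω)] (hΩ : Ω.IsDiffSimple)

include hΩ

theorem hasKernels : HasKernels (FlatConn Ω) where
  has_limit f := by
    obtain ⟨g, hg, h⟩ := exists_generalised_inverse hΩ f
    exact ⟨⟨⟨_, kernelIsLimit f g hg h⟩⟩⟩

theorem hasCokernels : HasCokernels (FlatConn Ω) where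
  has_colimit f := by
    obtain ⟨g, hg, h⟩ := exists_generalised_inverse hΩ f
    exact ⟨⟨⟨_, cokernelIsColimit f g hg h⟩⟩⟩

/-- A monomorphism f is the kernel of its cokernel projection: if k is killed by that projection
then f g k = k, so k factors through g k. Although g need not be parallel, g k is, because f is
injective and f g k = k is parallel. -/
theorem isNormalMonoCategory : IsNormalMonoCategory (FlatConn Ω) where
  normalMonoOfMono {X Y} f _ := by
    obtain ⟨g, hg, h⟩ := exists_generalised_inverse hΩ f
    have hi := injective_of_mono f g hg h
    have h1 : ∀ {W} (k : W ⟶ Y) (_ : k ≫ cokernelProj f g hg h = 0) z,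
        lin f (g (lin k z)) = lin k z := fun k hk z => by
      have h2 := congrArg (cornerIncl _ _ _ _ _) (lin_congr hk z)
      have h3 : lin k z - lin f (g (lin k z)) = 0 := h2.trans (map_zero _)
      exact (sub_eq_zero.1 h3).symm
    refine ⟨⟨cokernelObj f g hg h, cokernelProj f g hg h, comp_cokernelProj f g hg h,
      KernelFork.IsLimit.ofι _ _ (fun {W} k hk => ?_) (fun {W} k hk => ?_)
      fun {W} k hk m hm => ?_⟩⟩
    · refine homOfBimodMap (g ∘ₗ lin k) (hg.comp (isBimodMap_lin k)) fun z => ?_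
      rw [LinearMap.comp_apply, LinearMap.comp_apply, ← hi (X.conn _), lin_conn, lin_conn, h1 k hk]
    · exact hom_ext (h1 k hk)
    · refine hom_ext fun z => ?_
      exact (hi _).symm.trans (congrArg g (lin_congr hm z))

/-- Dually, a map k vanishing on the kernel of an epimorphism f satisfies k g f = k and factors
through k g, which is parallel because f is surjective. -/
theorem isNormalEpiCategory : IsNormalEpiCategory (FlatConn Ω) where
  normalEpiOfEpi {X Y} f _ := by
    obtain ⟨g, hg, h⟩ := exists_generalised_inverse hΩ f
    have hi := surjective_of_epi f g hg h
    have h1 : ∀ {W} (k : X ⟶ W) (_ : kernelIncl f g hg h ≫ k = 0) z,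
        lin k (g (lin f z)) = lin k z := fun k hk z => by
      have h2 := lin_congr hk (cornerProj _ _ _ _ _ z)
      have h3 : lin k (z - g (lin f z)) = 0 := h2
      rw [map_sub] at h3
      exact (sub_eq_zero.1 h3).symm
    refine ⟨⟨kernelObj f g hg h, kernelIncl f g hg h, kernelIncl_comp f g hg h,
      CokernelCofork.IsColimit.ofπ _ _ (fun {W} k hk => ?_) (fun {W} k hk => ?_)
      fun {W} k hk m hm => ?_⟩⟩
    · refine homOfBimodMap (lin k ∘ₗ g) ((isBimodMap_lin k).comp hg) fun z => ?_
      rw [LinearMap.comp_apply, LinearMap.comp_apply, ← lin_conn]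
      conv_lhs => rw [← hi z, ← lin_conn, h1 k hk]
    · exact hom_ext (h1 k hk)
    · refine hom_ext fun z => ?_
      have h2 := lin_congr hm (g z)
      rw [lin_comp, hi] at h2
      exact h2

theorem exists_abelian : ∃ a : Abelian (FlatConn Ω),
    a.toPreadditive = (inferInstance : Preadditive (FlatConn Ω)) :=
  ⟨{ (inferInstance : Preadditive (FlatConn Ω)), isNormalMonoCategory hΩ,
      isNormalEpiCategory hΩ with
      has_finite_products := inferInstance
      has_kernels := hasKernels hΩ
      has_cokernels := hasCokernels hΩ }, rfl⟩

end Abelian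

end FlatConn

open GradedBimodule

variable {Ω : DGAlgebra.{u}}

/-! ### The tensor product of graded bimodules -/

namespace GradedBimodule.DualBasis

variable {E F : GradedBimodule Ω} {ι κ : Type} [Fintype ι] [Fintype κ] (b : DualBasis E ι)
  (c : DualBasis F κ)

/-- Expand both arguments in the dual bases. Balancedness moves the coefficient of the second
argument across, and centrality of vec_i lets it pass to the left of vec_i. So a balanced map
depends only on the products of coordinates. -/
theorem balanced_eq_sum {M : Type*} [AddCommGroup M] [Module ℂ M] (B : E →ₗ[ℂ] F →ₗ[ℂ] M)
    (hB : ∀ (a : Ω) x y, B (op a • x) y = B x (a • y)) (x : E) (y : F) :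
    B x y = ∑ q : ι × κ, B ((b.coord q.1 x * c.coord q.2 y) • b.vec q.1) (c.vec q.2) := by
  conv_lhs => rw [← b.sum_coord x, ← c.sum_coord y]
  rw [Fintype.sum_prod_type]
  simp only [map_sum, LinearMap.sum_apply]
  rw [Finset.sum_comm]
  refine Finset.sum_congr rfl fun i _ => Finset.sum_congr rfl fun j _ => ?_
  rw [← hB, smul_comm, b.op_smul_vec, mul_smul]

/-- The tensor product of two elements, in coordinates. -/
noncomputable def tmulFree : E →ₗ[ℂ] F →ₗ[ℂ] GradedBimodule.free Ω (ι × κ) :=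
  LinearMap.mk₂ ℂ (fun x y => (fun q => b.coord q.1 x * c.coord q.2 y : ι × κ → Ω))
    (fun x x' y => funext fun q => by simp [add_mul]; rfl)
    (fun r x y => funext fun q => by simp; rfl)
    (fun x y y' => funext fun q => by simp [mul_add]; rfl)
    (fun r x y => funext fun q => by simp; rfl)

theorem smul_tmulFree (a : Ω) (x : E) (y : F) :
    b.tmulFree c (a • x) y = a • b.tmulFree c x y :=
  funext fun q => by
    change b.coord q.1 (a • x) * c.coord q.2 y = a * (b.coord q.1 x * c.coord q.2 y)
    rw [b.coord_smul, mul_assoc]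

theorem tmulFree_op_smul (a : Ω) (x : E) (y : F) :
    b.tmulFree c x (op a • y) = op a • b.tmulFree c x y :=
  funext fun q => by
    change b.coord q.1 x * c.coord q.2 (op a • y) = (b.coord q.1 x * c.coord q.2 y) * a
    rw [c.coord_op_smul, mul_assoc]

theorem op_smul_tmulFree (a : Ω) (x : E) (y : F) :
    b.tmulFree c (op a • x) y = b.tmulFree c x (a • y) :=
  funext fun q => by
    change b.coord q.1 (op a • x) * c.coord q.2 y = b.coord q.1 x * c.coord q.2 (a • y)
    rw [c.coord_smul, b.coord_op_smul, mul_assoc]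

theorem tmulFree_mem {i j : ℕ} {x : E} {y : F} (hx : x ∈ E.gr i) (hy : y ∈ F.gr j) :
    b.tmulFree c x y ∈ (GradedBimodule.free Ω (ι × κ)).gr (i + j) :=
  fun q _ => SetLike.mul_mem_graded (b.coord_mem q.1 i x hx) (c.coord_mem q.2 j y hy)

theorem tmulFree_mem_centreGr {x : E} {y : F} (hx : x ∈ E.centreGr 0) (hy : y ∈ F.centreGr 0) :
    b.tmulFree c x y ∈ (GradedBimodule.free Ω (ι × κ)).centreGr 0 :=
  ⟨b.tmulFree_mem c hx.1 hy.1, fun l a _ => by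
    rw [zero_mul, pow_zero, one_smul, ← tmulFree_op_smul, op_smul_of_mem_centreGr_zero hy,
      ← op_smul_tmulFree, op_smul_of_mem_centreGr_zero hx, smul_tmulFree]⟩

/-- The idempotent endomorphism of a free bimodule whose image is the tensor product. -/
noncomputable def tensorIdem : GradedBimodule.free Ω (ι × κ) →ₗ[ℂ] GradedBimodule.free Ω (ι × κ) :=
  ofCentral fun q => b.tmulFree c (b.vec q.1) (c.vec q.2)

theorem isBimodMap_tensorIdem : IsBimodMap (b.tensorIdem c) :=
  isBimodMap_ofCentral _ fun q => b.tmulFree_mem_centreGr c (b.vec_mem q.1) (c.vec_mem q.2)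

/-- The map (x, y) ↦ (coord_i x coord_j y) is itself balanced, so `balanced_eq_sum` applies to it.
Conversely a fixed point t is ∑ t_q vec_i ⊗ vec_j by definition; this is why the fixed points model
the tensor product. -/
theorem tensorIdem_tmulFree (x : E) (y : F) : b.tensorIdem c (b.tmulFree c x y) = b.tmulFree c x y := by
  refine Eq.trans ?_ (b.balanced_eq_sum c (b.tmulFree c) (b.op_smul_tmulFree c) x y).symm
  simp only [smul_tmulFree]
  rfl

/-- The tensor product over `Ω` of two bimodules with dual bases. -/
noncomputable def tensor : GradedBimodule Ω :=
  ker (LinearMap.id - b.tensorIdem c) ((IsBimodMap.id _).sub (b.isBimodMap_tensorIdem c))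

/-- The inclusion of the tensor product in a free bimodule. -/
noncomputable def tensorIncl : b.tensor c →ₗ[ℂ] GradedBimodule.free Ω (ι × κ) := kerIncl _ _

theorem isBimodMap_tensorIncl : IsBimodMap (b.tensorIncl c) := isBimodMap_kerIncl _ _

theorem tensorIncl_injective : Function.Injective (b.tensorIncl c) := kerIncl_injective _ _

/-- The tensor product of two elements. -/
noncomputable def tmul : E →ₗ[ℂ] F →ₗ[ℂ] b.tensor c :=
  LinearMap.mk₂ ℂ (fun x y => (⟨b.tmulFree c x y, by
      rw [LinearMap.mem_ker, LinearMap.sub_apply, tensorIdem_tmulFree, LinearMap.id_apply, sub_self]⟩ :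
        LinearMap.ker (LinearMap.id - b.tensorIdem c)))
    (fun x x' y => Subtype.ext (by simp; rfl))
    (fun r x y => Subtype.ext (by simp; rfl))
    (fun x y y' => Subtype.ext (by simp; rfl))
    (fun r x y => Subtype.ext (by simp; rfl))

theorem smul_tmul (a : Ω) (x : E) (y : F) : b.tmul c (a • x) y = a • b.tmul c x y :=
  Subtype.ext (b.smul_tmulFree c a x y)

theorem tmul_op_smul (a : Ω) (x : E) (y : F) : b.tmul c x (op a • y) = op a • b.tmul c x y :=
  Subtype.ext (b.tmulFree_op_smul c a x y)

theorem op_smul_tmul (a : Ω) (x : E) (y : F) : b.tmul c (op a • x) y = b.tmul c x (a • y) :=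
  Subtype.ext (b.op_smul_tmulFree c a x y)

theorem tmul_mem {i j : ℕ} {x : E} {y : F} (hx : x ∈ E.gr i) (hy : y ∈ F.gr j) :
    b.tmul c x y ∈ (b.tensor c).gr (i + j) := b.tmulFree_mem c hx hy

/-- The coordinates on the tensor product. -/
noncomputable def tensorCoord (q : ι × κ) : b.tensor c →ₗ[ℂ] Ω :=
  (LinearMap.proj q : (ι × κ → Ω) →ₗ[ℂ] Ω) ∘ₗ b.tensorIncl c

theorem sum_tensorCoord (t : b.tensor c) :
    ∑ q, b.tensorCoord c q t • b.tmul c (b.vec q.1) (c.vec q.2) = t := by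
  apply b.tensorIncl_injective c
  have h : b.tensorIncl c t - b.tensorIdem c (b.tensorIncl c t) = 0 := kerIncl_mem _ _ t
  rw [sub_eq_zero] at h
  rw [h, map_sum]
  simp only [(b.isBimodMap_tensorIncl c).smul]
  rfl

theorem tensorCoord_smul (q : ι × κ) (a : Ω) (t : b.tensor c) :
    b.tensorCoord c q (a • t) = a * b.tensorCoord c q t := by
  change (show ι × κ → Ω from b.tensorIncl c (a • t)) q = _
  rw [(b.isBimodMap_tensorIncl c).smul]
  rfl

theorem tensorCoord_op_smul (q : ι × κ) (a : Ω) (t : b.tensor c) :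
    b.tensorCoord c q (op a • t) = b.tensorCoord c q t * a := by
  change (show ι × κ → Ω from b.tensorIncl c (op a • t)) q = _
  rw [(b.isBimodMap_tensorIncl c).op_smul]
  rfl

theorem tmul_mem_centreGr {x : E} {y : F} (hx : x ∈ E.centreGr 0) (hy : y ∈ F.centreGr 0) :
    b.tmul c x y ∈ (b.tensor c).centreGr 0 := by
  refine mem_centreGr_zero ?_ fun a => ?_
  · have := b.tmul_mem c hx.1 hy.1
    rwa [add_zero] at this
  · rw [← tmul_op_smul, op_smul_of_mem_centreGr_zero hy, ← op_smul_tmul,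
      op_smul_of_mem_centreGr_zero hx, smul_tmul]

/-- The dual basis of the tensor product. -/
noncomputable def tensorBasis : DualBasis (b.tensor c) (ι × κ) where
  vec q := b.tmul c (b.vec q.1) (c.vec q.2)
  vec_mem q := b.tmul_mem_centreGr c (b.vec_mem q.1) (c.vec_mem q.2)
  coord := b.tensorCoord c
  coord_smul := b.tensorCoord_smul c
  coord_op_smul := b.tensorCoord_op_smul c
  coord_mem q k t ht := (b.isBimodMap_tensorIncl c).mem k t ht q trivial
  sum_coord := b.sum_tensorCoord c

/-- The linear map on the tensor product given by a balanced bilinear map. -/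
noncomputable def tensorLift {M : Type*} [AddCommGroup M] [Module ℂ M]
    (B : E →ₗ[ℂ] F →ₗ[ℂ] M) : b.tensor c →ₗ[ℂ] M :=
  ∑ q : ι × κ, B.flip (c.vec q.2) ∘ₗ E.lact.flip (b.vec q.1) ∘ₗ b.tensorCoord c q

theorem tensorLift_apply {M : Type*} [AddCommGroup M] [Module ℂ M]
    (B : E →ₗ[ℂ] F →ₗ[ℂ] M) (t : b.tensor c) :
    b.tensorLift c B t = ∑ q : ι × κ, B (b.tensorCoord c q t • b.vec q.1) (c.vec q.2) := by
  simp [tensorLift]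

theorem tensorLift_tmul {M : Type*} [AddCommGroup M] [Module ℂ M] (B : E →ₗ[ℂ] F →ₗ[ℂ] M)
    (hB : ∀ (a : Ω) x y, B (op a • x) y = B x (a • y)) (x : E) (y : F) :
    b.tensorLift c B (b.tmul c x y) = B x y := by
  rw [tensorLift_apply, b.balanced_eq_sum c B hB x y]
  rfl

theorem tensor_induction {P : b.tensor c → Prop} (zero : P 0)
    (tmul : ∀ x y, P (b.tmul c x y)) (add : ∀ s t, P s → P t → P (s + t)) (t : b.tensor c) : P t := by
  rw [← b.sum_tensorCoord c t]
  simp only [← smul_tmul]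
  exact Finset.sum_induction _ P add zero fun q _ => tmul _ _

theorem tensor_ext {M : Type*} [AddCommGroup M] [Module ℂ M] {f g : b.tensor c →ₗ[ℂ] M}
    (h : ∀ x y, f (b.tmul c x y) = g (b.tmul c x y)) (t : b.tensor c) : f t = g t := by
  induction t using b.tensor_induction c with
  | zero => simp
  | tmul x y => exact h x y
  | add s t hs ht => rw [map_add, map_add, hs, ht]

theorem par_tmul (x : E) (y : F) :
    (b.tensor c).par (b.tmul c x y) = b.tmul c (E.par x) (F.par y) := by
  refine eq_of_homogeneous E.gr (f := (b.tensor c).par ∘ₗ (b.tmul c).flip y)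
    (g := (b.tmul c).flip (F.par y) ∘ₗ E.par) (fun k x hx => ?_) x
  refine eq_of_homogeneous F.gr (f := (b.tensor c).par ∘ₗ b.tmul c x)
    (g := b.tmul c (E.par x) ∘ₗ F.par) (fun l y hy => ?_) y
  simp only [LinearMap.comp_apply]
  rw [parity_of_mem hx, parity_of_mem hy, parity_of_mem (b.tmul_mem c hx hy), map_smul, map_smul,
    LinearMap.smul_apply, smul_smul, pow_add, mul_comm]

theorem tensor_surjective : Function.Surjective (TensorProduct.lift (b.tmul c)) := fun t => by
  refine ⟨∑ q : ι × κ, (b.tensorCoord c q t • b.vec q.1) ⊗ₜ c.vec q.2, ?_⟩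
  rw [map_sum]
  simp only [TensorProduct.lift.tmul, smul_tmul]
  exact b.sum_tensorCoord c t

/-- The quotient map of E ⊗_ℂ F by the balancing relations is balanced, so it factors through the
model of the tensor product; whatever dies in the model dies in the quotient. -/
theorem ker_tensor : LinearMap.ker (TensorProduct.lift (b.tmul c)) =
    Submodule.span ℂ {t | ∃ (x : E) (a : Ω) (y : F),
      t = (op a • x) ⊗ₜ[ℂ] y - x ⊗ₜ[ℂ] (a • y)} := by
  set S := Submodule.span ℂ {t | ∃ (x : E) (a : Ω) (y : F),
      t = (op a • x) ⊗ₜ[ℂ] y - x ⊗ₜ[ℂ] (a • y)}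
  apply le_antisymm
  · intro t ht
    let B : E →ₗ[ℂ] F →ₗ[ℂ] (E ⊗[ℂ] F) ⧸ S := (TensorProduct.mk ℂ E F).compr₂ S.mkQ
    have hB : ∀ (a : Ω) x y, B (op a • x) y = B x (a • y) := fun a x y => by
      rw [← sub_eq_zero]
      change S.mkQ _ - S.mkQ _ = 0
      rw [← map_sub, Submodule.mkQ_apply, Submodule.Quotient.mk_eq_zero]
      exact Submodule.subset_span ⟨x, a, y, rfl⟩
    have h : b.tensorLift c B ∘ₗ TensorProduct.lift (b.tmul c) = S.mkQ := by
      ext x y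
      exact b.tensorLift_tmul c B hB x y
    have h2 := LinearMap.congr_fun h t
    rw [LinearMap.comp_apply, LinearMap.mem_ker.1 ht, map_zero, Submodule.mkQ_apply] at h2
    exact (Submodule.Quotient.mk_eq_zero S).1 h2.symm
  · rw [Submodule.span_le]
    rintro _ ⟨x, a, y, rfl⟩
    rw [SetLike.mem_coe, LinearMap.mem_ker, map_sub, TensorProduct.lift.tmul,
      TensorProduct.lift.tmul, op_smul_tmul, sub_self]

end GradedBimodule.DualBasis

open GradedBimodule

variable {Ω : DGAlgebra.{u}}

namespace FlatConn

variable {X X' X'' Y Y' Y'' Z W : FlatConn Ω}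

/-! ### The tensor product of flat connections -/

/-- The bilinear map `(x, y) ↦ ∇ x ⊗ y + (-1) ^ |x| x ⊗ ∇ y`. -/
noncomputable def tensorConnMap (X Y : FlatConn Ω) : X →ₗ[ℂ] Y →ₗ[ℂ] X.basis.tensor Y.basis :=
  X.basis.tmul Y.basis ∘ₗ X.conn + (X.basis.tmul Y.basis).compl₁₂ X.par Y.conn

theorem tensorConnMap_apply (x : X) (y : Y) : tensorConnMap X Y x y =
    X.basis.tmul Y.basis (X.conn x) y + X.basis.tmul Y.basis (X.par x) (Y.conn y) := rfl

/-- The right Leibniz rule on x a and the left Leibniz rule on a y produce the same term ±x da ⊗ y.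
This is where a connection has to satisfy both rules. -/
theorem tensorConnMap_balanced (a : Ω) (x : X) (y : Y) :
    tensorConnMap X Y (op a • x) y = tensorConnMap X Y x (a • y) := by
  simp only [tensorConnMap_apply, conn_op_smul, conn_smul, par_op_smul, map_add,
    LinearMap.add_apply, DualBasis.op_smul_tmul]
  abel

/-- The connection on the tensor product. -/
noncomputable def tensorConn (X Y : FlatConn Ω) :
    X.basis.tensor Y.basis →ₗ[ℂ] X.basis.tensor Y.basis :=
  X.basis.tensorLift Y.basis (tensorConnMap X Y)

theorem tensorConn_tmul (x : X) (y : Y) : tensorConn X Y (X.basis.tmul Y.basis x y) =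
    X.basis.tmul Y.basis (X.conn x) y + X.basis.tmul Y.basis (X.par x) (Y.conn y) :=
  X.basis.tensorLift_tmul Y.basis _ tensorConnMap_balanced x y

theorem tensorConn_smul (a : Ω) (t : X.basis.tensor Y.basis) :
    tensorConn X Y (a • t) = Ω.d a • t + Ω.par a • tensorConn X Y t := by
  induction t using X.basis.tensor_induction Y.basis with
  | zero => simp
  | add s t hs ht =>
    rw [smul_add, map_add, map_add, hs, ht, smul_add, smul_add]
    abel
  | tmul x y =>
    rw [← DualBasis.smul_tmul, tensorConn_tmul, tensorConn_tmul, conn_smul, par_smul, map_add,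
      LinearMap.add_apply, smul_add]
    simp only [DualBasis.smul_tmul]
    abel

theorem tensorConn_op_smul (a : Ω) (t : X.basis.tensor Y.basis) :
    tensorConn X Y (op a • t) = op a • tensorConn X Y t +
      op (Ω.d a) • (X.basis.tensor Y.basis).par t := by
  induction t using X.basis.tensor_induction Y.basis with
  | zero => simp
  | add s t hs ht =>
    rw [smul_add, map_add, map_add, hs, ht, smul_add, map_add, smul_add]
    abel
  | tmul x y =>
    rw [← DualBasis.tmul_op_smul, tensorConn_tmul, tensorConn_tmul, conn_op_smul,
      DualBasis.par_tmul, map_add, smul_add]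
    simp only [DualBasis.tmul_op_smul]
    abel

/-- The tensor product of two flat connections. -/
noncomputable def tensor (X Y : FlatConn Ω) : FlatConn Ω where
  toGradedBimodule := X.basis.tensor Y.basis
  isFGP := (X.basis.tensorBasis Y.basis).isFGP
  conn := tensorConn X Y
  conn_mem {n t} ht := by
    rw [← X.basis.sum_tensorCoord Y.basis t, map_sum]
    refine Submodule.sum_mem _ fun q _ => ?_
    have hq : X.basis.tensorCoord Y.basis q t ∈ Ω.gr n :=
      (X.basis.tensorBasis Y.basis).coord_mem q n t ht
    have hv : X.basis.tmul Y.basis (X.basis.vec q.1) (Y.basis.vec q.2) ∈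
        (X.basis.tensor Y.basis).gr 0 := ((X.basis.tensorBasis Y.basis).vec_mem q).1
    rw [tensorConn_smul]
    refine add_mem ?_ ?_
    · simpa using GradedBimodule.smul_mem _ (Ω.d_mem hq) hv
    · refine GradedBimodule.smul_mem _ (parity_mem hq) ?_
      rw [tensorConn_tmul]
      refine add_mem ?_ ?_
      · simpa using X.basis.tmul_mem Y.basis (X.conn_mem (X.basis.vec_mem q.1).1)
          (Y.basis.vec_mem q.2).1
      · simpa using X.basis.tmul_mem Y.basis (parity_mem (X.basis.vec_mem q.1).1)
          (Y.conn_mem (Y.basis.vec_mem q.2).1)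
  conn_right {n t} ht a := by
    rw [tensorConn_op_smul, parity_of_mem ht, smul_comm (op (Ω.d a))]
  conn_left {n a} ha t := by
    rw [tensorConn_smul, parity_of_mem ha, smul_assoc]
  flat t := by
    refine X.basis.tensor_ext Y.basis (f := tensorConn X Y ∘ₗ tensorConn X Y) (g := 0)
      (fun x y => ?_) t
    -- The two cross terms in ∇x ⊗ ∇y cancel because the connection anticommutes with parity.
    rw [LinearMap.comp_apply, tensorConn_tmul, map_add, tensorConn_tmul, tensorConn_tmul, X.flat,
      Y.flat, par_conn, parity_parity]
    simp

/-- The tensor product of two elements. -/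
noncomputable def tmul (X Y : FlatConn Ω) : X →ₗ[ℂ] Y →ₗ[ℂ] tensor X Y := X.basis.tmul Y.basis

theorem smul_tmul (a : Ω) (x : X) (y : Y) : tmul X Y (a • x) y = a • tmul X Y x y :=
  X.basis.smul_tmul Y.basis a x y

theorem tmul_op_smul (a : Ω) (x : X) (y : Y) : tmul X Y x (op a • y) = op a • tmul X Y x y :=
  X.basis.tmul_op_smul Y.basis a x y

theorem op_smul_tmul (a : Ω) (x : X) (y : Y) : tmul X Y (op a • x) y = tmul X Y x (a • y) :=
  X.basis.op_smul_tmul Y.basis a x y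

theorem tmul_mem {i j : ℕ} {x : X} {y : Y} (hx : x ∈ X.gr i) (hy : y ∈ Y.gr j) :
    tmul X Y x y ∈ (tensor X Y).gr (i + j) := X.basis.tmul_mem Y.basis hx hy

theorem tmul_mem_centreGr {x : X} {y : Y} (hx : x ∈ X.centreGr 0) (hy : y ∈ Y.centreGr 0) :
    tmul X Y x y ∈ (tensor X Y).centreGr 0 := X.basis.tmul_mem_centreGr Y.basis hx hy

theorem conn_tmul (x : X) (y : Y) : (tensor X Y).conn (tmul X Y x y) =
    tmul X Y (X.conn x) y + tmul X Y (X.par x) (Y.conn y) := tensorConn_tmul x y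

theorem par_tmul (x : X) (y : Y) :
    (tensor X Y).par (tmul X Y x y) = tmul X Y (X.par x) (Y.par y) :=
  X.basis.par_tmul Y.basis x y

theorem tensor_induction {P : tensor X Y → Prop} (zero : P 0)
    (tmul : ∀ x y, P (tmul X Y x y)) (add : ∀ s t, P s → P t → P (s + t)) (t : tensor X Y) : P t :=
  X.basis.tensor_induction Y.basis zero tmul add t

/-- The dual basis of the tensor product given by the chosen dual bases of the factors. -/
noncomputable def tensorBasis (X Y : FlatConn Ω) :
    DualBasis (tensor X Y).toGradedBimodule (Fin X.rank × Fin Y.rank) :=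
  X.basis.tensorBasis Y.basis

theorem tensorBasis_vec (q : Fin X.rank × Fin Y.rank) :
    (tensorBasis X Y).vec q = tmul X Y (X.basis.vec q.1) (Y.basis.vec q.2) := rfl

theorem tensor_ext {M : Type*} [AddCommGroup M] [Module ℂ M] {f g : tensor X Y →ₗ[ℂ] M}
    (h : ∀ x y, f (tmul X Y x y) = g (tmul X Y x y)) (t : tensor X Y) : f t = g t :=
  X.basis.tensor_ext Y.basis h t

/-- The linear map on the tensor product given by a balanced bilinear map. -/
noncomputable def tensorLift {M : Type*} [AddCommGroup M] [Module ℂ M]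
    (B : X →ₗ[ℂ] Y →ₗ[ℂ] M) : tensor X Y →ₗ[ℂ] M := X.basis.tensorLift Y.basis B

theorem tensorLift_tmul {M : Type*} [AddCommGroup M] [Module ℂ M] (B : X →ₗ[ℂ] Y →ₗ[ℂ] M)
    (hB : ∀ (a : Ω) x y, B (op a • x) y = B x (a • y)) (x : X) (y : Y) :
    tensorLift B (tmul X Y x y) = B x y := X.basis.tensorLift_tmul Y.basis B hB x y

/-- The bilinear maps `X × Y → Z` which correspond to morphisms `X ⊗ Y → Z`. -/
structure IsTensorMap (B : X →ₗ[ℂ] Y →ₗ[ℂ] Z) : Prop where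
  balanced : ∀ (a : Ω) x y, B (op a • x) y = B x (a • y)
  smul : ∀ (a : Ω) x y, B (a • x) y = a • B x y
  op_smul : ∀ (a : Ω) x y, B x (op a • y) = op a • B x y
  mem : ∀ {i j : ℕ} {x : X} {y : Y}, x ∈ X.gr i → y ∈ Y.gr j → B x y ∈ Z.gr (i + j)
  conn : ∀ x y, Z.conn (B x y) = B (X.conn x) y + B (X.par x) (Y.conn y)

/-- The morphism on the tensor product given by a bilinear map. -/
noncomputable def tensorDesc (B : X →ₗ[ℂ] Y →ₗ[ℂ] Z) (hB : IsTensorMap B) : tensor X Y ⟶ Z :=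
  homOfBimodMap (tensorLift B)
    { smul a t := tensor_ext (f := tensorLift B ∘ₗ (tensor X Y).lact a)
        (g := Z.lact a ∘ₗ tensorLift B) (fun x y => by
          simp only [LinearMap.comp_apply, lact_apply, ← smul_tmul, tensorLift_tmul B hB.balanced,
            hB.smul]) t
      op_smul a t := tensor_ext (f := tensorLift B ∘ₗ (tensor X Y).ract a)
        (g := Z.ract a ∘ₗ tensorLift B) (fun x y => by
          simp only [LinearMap.comp_apply, ract_apply, ← tmul_op_smul,
            tensorLift_tmul B hB.balanced, hB.op_smul]) t
      mem n t ht := by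
        rw [← (tensorBasis X Y).sum_coord t, map_sum]
        refine Submodule.sum_mem _ fun q _ => ?_
        rw [tensorBasis_vec, ← smul_tmul, tensorLift_tmul B hB.balanced, hB.smul]
        exact GradedBimodule.smul_mem _ ((tensorBasis X Y).coord_mem q n t ht)
          (hB.mem (X.basis.vec_mem q.1).1 (Y.basis.vec_mem q.2).1) }
    (fun t => tensor_ext (f := tensorLift B ∘ₗ (tensor X Y).conn)
        (g := Z.conn ∘ₗ tensorLift B) (fun x y => by
          simp only [LinearMap.comp_apply, conn_tmul, map_add, tensorLift_tmul B hB.balanced,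
            hB.conn]) t)

@[simp] theorem tensorDesc_tmul (B : X →ₗ[ℂ] Y →ₗ[ℂ] Z) (hB : IsTensorMap B) (x : X) (y : Y) :
    lin (tensorDesc B hB) (tmul X Y x y) = B x y := tensorLift_tmul B hB.balanced x y

theorem tensor_hom_ext {f g : tensor X Y ⟶ Z}
    (h : ∀ x y, lin f (tmul X Y x y) = lin g (tmul X Y x y)) : f = g :=
  hom_ext (tensor_ext h)

theorem lin_smul_apply (f : X ⟶ Y) (a : Ω) (x : X) : lin f (a • x) = a • lin f x :=
  Hom.map_smul f a x

theorem lin_op_smul_apply (f : X ⟶ Y) (a : Ω) (x : X) : lin f (op a • x) = op a • lin f x :=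
  Hom.map_op_smul f a x

theorem lin_par (f : X ⟶ Y) (x : X) : lin f (X.par x) = Y.par (lin f x) :=
  (isBimodMap_lin f).par x

theorem lin_mem (f : X ⟶ Y) {n : ℕ} {x : X} (hx : x ∈ X.gr n) : lin f x ∈ Y.gr n :=
  Hom.map_mem f hx

/-- The tensor product of two morphisms. -/
noncomputable def tensorMap (f : X ⟶ X') (g : Y ⟶ Y') : tensor X Y ⟶ tensor X' Y' :=
  tensorDesc ((tmul X' Y').compl₁₂ (lin f) (lin g))
    { balanced a x y := by
        simp only [LinearMap.compl₁₂_apply, lin_smul_apply, lin_op_smul_apply, op_smul_tmul]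
      smul a x y := by simp only [LinearMap.compl₁₂_apply, lin_smul_apply, smul_tmul]
      op_smul a x y := by simp only [LinearMap.compl₁₂_apply, lin_op_smul_apply, tmul_op_smul]
      mem hx hy := tmul_mem (lin_mem f hx) (lin_mem g hy)
      conn x y := by simp only [LinearMap.compl₁₂_apply, conn_tmul, lin_conn, lin_par] }

@[simp] theorem tensorMap_tmul (f : X ⟶ X') (g : Y ⟶ Y') (x : X) (y : Y) :
    lin (tensorMap f g) (tmul X Y x y) = tmul X' Y' (lin f x) (lin g y) := tensorDesc_tmul _ _ _ _

/-- The bilinear map underlying the associator. -/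
noncomputable def assocMap (X Y Z : FlatConn Ω) :
    tensor X Y →ₗ[ℂ] Z →ₗ[ℂ] tensor X (tensor Y Z) :=
  tensorLift (LinearMap.mk₂ ℂ (fun x y => tmul X (tensor Y Z) x ∘ₗ tmul Y Z y)
    (fun _ _ _ => by ext; simp) (fun _ _ _ => by ext; simp) (fun _ _ _ => by ext; simp)
    (fun _ _ _ => by ext; simp))

theorem assocMap_tmul (x : X) (y : Y) (z : Z) :
    assocMap X Y Z (tmul X Y x y) z = tmul X (tensor Y Z) x (tmul Y Z y z) := by
  rw [assocMap, tensorLift_tmul]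
  · rfl
  · intro a x y
    ext z
    simp [op_smul_tmul, smul_tmul]

/-- Every condition is additive in the first argument and can be tested on pure tensors, except the
one on degrees, which uses the dual basis of `tensor X Y`. This and its mirror image serve the
associator and its inverse. -/
theorem isTensorMap_of_tmul {B : tensor X Y →ₗ[ℂ] Z →ₗ[ℂ] W}
    (balanced : ∀ (a : Ω) x y z, B (tmul X Y x (op a • y)) z = B (tmul X Y x y) (a • z))
    (smul : ∀ (a : Ω) x y z, B (tmul X Y (a • x) y) z = a • B (tmul X Y x y) z)
    (op_smul : ∀ (a : Ω) x y z, B (tmul X Y x y) (op a • z) = op a • B (tmul X Y x y) z)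
    (mem : ∀ {i j k : ℕ} {x : X} {y : Y} {z : Z}, x ∈ X.gr i → y ∈ Y.gr j → z ∈ Z.gr k →
      B (tmul X Y x y) z ∈ W.gr (i + j + k))
    (conn : ∀ x y z, W.conn (B (tmul X Y x y) z) = B (tmul X Y (X.conn x) y) z +
      B (tmul X Y (X.par x) (Y.conn y)) z + B (tmul X Y (X.par x) (Y.par y)) (Z.conn z)) :
    IsTensorMap B where
  balanced a t z := by
    induction t using tensor_induction with
    | zero => simp
    | add s t hs ht => simp only [smul_add, map_add, LinearMap.add_apply, hs, ht]
    | tmul x y => rw [← tmul_op_smul, balanced]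
  smul a t z := by
    induction t using tensor_induction with
    | zero => simp
    | add s t hs ht => simp only [smul_add, map_add, LinearMap.add_apply, hs, ht]
    | tmul x y => rw [← smul_tmul, smul]
  op_smul a t z := by
    induction t using tensor_induction with
    | zero => simp
    | add s t hs ht => simp only [smul_add, map_add, LinearMap.add_apply, hs, ht]
    | tmul x y => rw [op_smul]
  mem {i k t z} ht hz := by
    rw [← (tensorBasis X Y).sum_coord t, map_sum, LinearMap.sum_apply]
    refine Submodule.sum_mem _ fun q _ => ?_
    rw [tensorBasis_vec, ← smul_tmul]
    have hx := X.smul_mem ((tensorBasis X Y).coord_mem q i t ht) (X.basis.vec_mem q.1).1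
    simpa using mem hx (Y.basis.vec_mem q.2).1 hz
  conn t z := by
    induction t using tensor_induction with
    | zero => simp
    | add s t hs ht =>
      simp only [map_add, LinearMap.add_apply, hs, ht]
      abel
    | tmul x y => rw [conn, conn_tmul, par_tmul, map_add, LinearMap.add_apply]

theorem isTensorMap_of_tmul' {B : X →ₗ[ℂ] tensor Y Z →ₗ[ℂ] W}
    (balanced : ∀ (a : Ω) x y z, B (op a • x) (tmul Y Z y z) = B x (tmul Y Z (a • y) z))
    (smul : ∀ (a : Ω) x y z, B (a • x) (tmul Y Z y z) = a • B x (tmul Y Z y z))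
    (op_smul : ∀ (a : Ω) x y z, B x (tmul Y Z y (op a • z)) = op a • B x (tmul Y Z y z))
    (mem : ∀ {i j k : ℕ} {x : X} {y : Y} {z : Z}, x ∈ X.gr i → y ∈ Y.gr j → z ∈ Z.gr k →
      B x (tmul Y Z y z) ∈ W.gr (i + j + k))
    (conn : ∀ x y z, W.conn (B x (tmul Y Z y z)) = B (X.conn x) (tmul Y Z y z) +
      B (X.par x) (tmul Y Z (Y.conn y) z) + B (X.par x) (tmul Y Z (Y.par y) (Z.conn z))) :
    IsTensorMap B where
  balanced a x t := by
    induction t using tensor_induction with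
    | zero => simp
    | add s t hs ht => simp only [smul_add, map_add, hs, ht]
    | tmul y z => rw [← smul_tmul, balanced]
  smul a x t := by
    induction t using tensor_induction with
    | zero => simp
    | add s t hs ht => simp only [smul_add, map_add, hs, ht]
    | tmul y z => rw [smul]
  op_smul a x t := by
    induction t using tensor_induction with
    | zero => simp
    | add s t hs ht => simp only [smul_add, map_add, hs, ht]
    | tmul y z => rw [← tmul_op_smul, op_smul]
  mem {i k x t} hx ht := by
    rw [← (tensorBasis Y Z).sum_coord t, map_sum]
    refine Submodule.sum_mem _ fun q _ => ?_
    rw [tensorBasis_vec, ← smul_tmul]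
    have hy := Y.smul_mem ((tensorBasis Y Z).coord_mem q k t ht) (Y.basis.vec_mem q.1).1
    simpa using mem hx hy (Z.basis.vec_mem q.2).1
  conn x t := by
    induction t using tensor_induction with
    | zero => simp
    | add s t hs ht =>
      simp only [map_add, hs, ht]
      abel
    | tmul y z => rw [conn, conn_tmul, map_add, add_assoc]

/-- The bilinear map underlying the inverse of the associator. -/
noncomputable def assocInvMap (X Y Z : FlatConn Ω) :
    X →ₗ[ℂ] tensor Y Z →ₗ[ℂ] tensor (tensor X Y) Z :=
  (tensorLift (LinearMap.mk₂ ℂ (fun y z => (tmul (tensor X Y) Z).flip z ∘ₗ (tmul X Y).flip y)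
    (fun _ _ _ => by ext; simp) (fun _ _ _ => by ext; simp) (fun _ _ _ => by ext; simp)
    (fun _ _ _ => by ext; simp))).flip

theorem assocInvMap_tmul (x : X) (y : Y) (z : Z) :
    assocInvMap X Y Z x (tmul Y Z y z) = tmul (tensor X Y) Z (tmul X Y x y) z := by
  rw [assocInvMap, LinearMap.flip_apply, tensorLift_tmul]
  · rfl
  · intro a y z
    ext x
    simp [op_smul_tmul, tmul_op_smul]

/-- The associator. -/
noncomputable def assocHom (X Y Z : FlatConn Ω) : tensor (tensor X Y) Z ⟶ tensor X (tensor Y Z) :=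
  tensorDesc (assocMap X Y Z) <| isTensorMap_of_tmul
    (fun a x y z => by rw [assocMap_tmul, assocMap_tmul, op_smul_tmul])
    (fun a x y z => by rw [assocMap_tmul, assocMap_tmul, smul_tmul])
    (fun a x y z => by rw [assocMap_tmul, assocMap_tmul, tmul_op_smul, tmul_op_smul])
    (fun hx hy hz => by
      rw [assocMap_tmul, add_assoc]
      exact tmul_mem hx (tmul_mem hy hz))
    (fun x y z => by
      simp only [assocMap_tmul, conn_tmul, map_add, add_assoc])

@[simp] theorem assocHom_tmul (x : X) (y : Y) (z : Z) :
    lin (assocHom X Y Z) (tmul (tensor X Y) Z (tmul X Y x y) z) =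
      tmul X (tensor Y Z) x (tmul Y Z y z) := by
  rw [assocHom, tensorDesc_tmul, assocMap_tmul]

/-- The inverse of the associator. -/
noncomputable def assocInv (X Y Z : FlatConn Ω) : tensor X (tensor Y Z) ⟶ tensor (tensor X Y) Z :=
  tensorDesc (assocInvMap X Y Z) <| isTensorMap_of_tmul'
    (fun a x y z => by rw [assocInvMap_tmul, assocInvMap_tmul, op_smul_tmul])
    (fun a x y z => by rw [assocInvMap_tmul, assocInvMap_tmul, smul_tmul, smul_tmul])
    (fun a x y z => by rw [assocInvMap_tmul, assocInvMap_tmul, tmul_op_smul])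
    (fun hx hy hz => by
      rw [assocInvMap_tmul]
      exact tmul_mem (tmul_mem hx hy) hz)
    (fun x y z => by
      simp only [assocInvMap_tmul, conn_tmul, map_add, LinearMap.add_apply, par_tmul])

@[simp] theorem assocInv_tmul (x : X) (y : Y) (z : Z) :
    lin (assocInv X Y Z) (tmul X (tensor Y Z) x (tmul Y Z y z)) =
      tmul (tensor X Y) Z (tmul X Y x y) z := by
  rw [assocInv, tensorDesc_tmul, assocInvMap_tmul]

theorem tensor_hom_ext₃ {f g : tensor (tensor X Y) Z ⟶ W}
    (h : ∀ x y z, lin f (tmul (tensor X Y) Z (tmul X Y x y) z) =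
      lin g (tmul (tensor X Y) Z (tmul X Y x y) z)) : f = g := by
  refine tensor_hom_ext fun t z => ?_
  exact tensor_ext (f := lin f ∘ₗ (tmul (tensor X Y) Z).flip z)
    (g := lin g ∘ₗ (tmul (tensor X Y) Z).flip z) (fun x y => h x y z) t

theorem tensor_hom_ext₃' {f g : tensor X (tensor Y Z) ⟶ W}
    (h : ∀ x y z, lin f (tmul X (tensor Y Z) x (tmul Y Z y z)) =
      lin g (tmul X (tensor Y Z) x (tmul Y Z y z))) : f = g := by
  refine tensor_hom_ext fun x t => ?_
  exact tensor_ext (f := lin f ∘ₗ tmul X (tensor Y Z) x) (g := lin g ∘ₗ tmul X (tensor Y Z) x)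
    (fun y z => h x y z) t

theorem tensor_hom_ext₄ {V : FlatConn Ω} {f g : tensor (tensor (tensor X Y) Z) W ⟶ V}
    (h : ∀ x y z w, lin f (tmul _ W (tmul (tensor X Y) Z (tmul X Y x y) z) w) =
      lin g (tmul _ W (tmul (tensor X Y) Z (tmul X Y x y) z) w)) : f = g := by
  refine tensor_hom_ext₃ fun t z w => ?_
  exact tensor_ext (f := lin f ∘ₗ (tmul _ W).flip w ∘ₗ (tmul (tensor X Y) Z).flip z)
    (g := lin g ∘ₗ (tmul _ W).flip w ∘ₗ (tmul (tensor X Y) Z).flip z)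
    (fun x y => h x y z w) t

/-- An element of the unit object as an element of `Ω`. -/
def unitVal (a : unit Ω) : Ω := a

/-- The left unitor. -/
noncomputable def leftUnitorHom (X : FlatConn Ω) : tensor (unit Ω) X ⟶ X :=
  tensorDesc (show (unit Ω).carrier →ₗ[ℂ] X →ₗ[ℂ] X from X.lact)
    { balanced a x y := mul_smul (unitVal x) a y
      smul a x y := mul_smul a (unitVal x) y
      op_smul a x y := smul_comm (unitVal x) (op a) y
      mem hx hy := X.smul_mem hx hy
      conn x y := conn_smul X (unitVal x) y }

@[simp] theorem leftUnitorHom_tmul (a : unit Ω) (x : X) :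
    lin (leftUnitorHom X) (tmul (unit Ω) X a x) = unitVal a • x :=
  tensorDesc_tmul _ _ _ _

/-- The right unitor. -/
noncomputable def rightUnitorHom (X : FlatConn Ω) : tensor X (unit Ω) ⟶ X :=
  tensorDesc (show X →ₗ[ℂ] (unit Ω).carrier →ₗ[ℂ] X from X.ract.flip)
    { balanced a x y := (mul_smul (op (unitVal y)) (op a) x).symm
      smul a x y := (smul_comm a (op (unitVal y)) x).symm
      op_smul a x y := mul_smul (op a) (op (unitVal y)) x
      mem hx hy := X.op_smul_mem hx hy
      conn x y := conn_op_smul X (unitVal y) x }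

@[simp] theorem rightUnitorHom_tmul (x : X) (a : unit Ω) :
    lin (rightUnitorHom X) (tmul X (unit Ω) x a) = op (unitVal a) • x :=
  tensorDesc_tmul _ _ _ _

end FlatConn

/-! ### Unitors, coherence and the monoidal structure -/

open GradedBimodule

variable {Ω : DGAlgebra.{u}}

namespace FlatConn

variable {X X' X'' Y Y' Y'' Z W : FlatConn Ω}

/-- The unit of `Ω` as an element of the unit object. -/
noncomputable def unitOne (Ω : DGAlgebra.{u}) : unit Ω := (1 : Ω)

theorem unitOne_mem : unitOne Ω ∈ (unit Ω).centreGr 0 :=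
  mem_centreGr_zero (E := (unit Ω).toGradedBimodule) (SetLike.one_mem_graded Ω.gr)
    fun a => by
      change 1 * a = a * 1
      rw [one_mul, mul_one]

theorem smul_unitOne (a : unit Ω) : unitVal a • unitOne Ω = a := mul_one (unitVal a)

theorem op_smul_unitOne (a : unit Ω) : op (unitVal a) • unitOne Ω = a := one_mul (unitVal a)

theorem smul_unitOne_eq (a : Ω) : a • unitOne Ω = op a • unitOne Ω :=
  (mul_one a).trans (one_mul a).symm

theorem unitVal_unitOne : unitVal (unitOne Ω) = 1 := rfl

theorem conn_unitOne : (unit Ω).conn (unitOne Ω) = 0 := DGAlgebra.d_one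

/-- The inverse of the left unitor. -/
noncomputable def leftUnitorInv (X : FlatConn Ω) : X ⟶ tensor (unit Ω) X :=
  homOfBimodMap (tmul (unit Ω) X (unitOne Ω))
    { smul a x := by rw [← op_smul_tmul, ← smul_unitOne_eq, smul_tmul]
      op_smul a x := tmul_op_smul _ _ _
      mem k x hx := by simpa using tmul_mem unitOne_mem.1 hx }
    fun x => by
      rw [conn_tmul, conn_unitOne, map_zero, LinearMap.zero_apply, zero_add,
        parity_of_mem_zero unitOne_mem.1]

/-- The inverse of the right unitor. -/
noncomputable def rightUnitorInv (X : FlatConn Ω) : X ⟶ tensor X (unit Ω) :=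
  homOfBimodMap ((tmul X (unit Ω)).flip (unitOne Ω))
    { smul a x := smul_tmul _ _ _
      op_smul a x := by
        rw [LinearMap.flip_apply, LinearMap.flip_apply, op_smul_tmul, smul_unitOne_eq,
          tmul_op_smul]
      mem k x hx := by simpa using tmul_mem hx unitOne_mem.1 }
    fun x => by
      rw [LinearMap.flip_apply, LinearMap.flip_apply, conn_tmul, conn_unitOne, map_zero, add_zero]

theorem leftUnitorInv_apply (x : X) :
    lin (leftUnitorInv X) x = tmul (unit Ω) X (unitOne Ω) x := rfl

theorem rightUnitorInv_apply (x : X) :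
    lin (rightUnitorInv X) x = tmul X (unit Ω) x (unitOne Ω) := rfl

/-- The associator as an isomorphism. -/
noncomputable def assocIso (X Y Z : FlatConn Ω) :
    tensor (tensor X Y) Z ≅ tensor X (tensor Y Z) where
  hom := assocHom X Y Z
  inv := assocInv X Y Z
  hom_inv_id := tensor_hom_ext₃ fun x y z => by simp
  inv_hom_id := tensor_hom_ext₃' fun x y z => by simp

/-- The left unitor as an isomorphism. -/
noncomputable def leftUnitorIso (X : FlatConn Ω) : tensor (unit Ω) X ≅ X where
  hom := leftUnitorHom X
  inv := leftUnitorInv X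
  hom_inv_id := tensor_hom_ext fun a x => by
    rw [lin_comp, leftUnitorHom_tmul, leftUnitorInv_apply, ← op_smul_tmul, op_smul_unitOne, lin_id]
  inv_hom_id := hom_ext fun x => by
    rw [lin_comp, leftUnitorInv_apply, leftUnitorHom_tmul, unitVal_unitOne, one_smul, lin_id]

/-- The right unitor as an isomorphism. -/
noncomputable def rightUnitorIso (X : FlatConn Ω) : tensor X (unit Ω) ≅ X where
  hom := rightUnitorHom X
  inv := rightUnitorInv X
  hom_inv_id := tensor_hom_ext fun x a => by
    rw [lin_comp, rightUnitorHom_tmul, rightUnitorInv_apply, op_smul_tmul, smul_unitOne, lin_id]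
  inv_hom_id := hom_ext fun x => by
    rw [lin_comp, rightUnitorInv_apply, rightUnitorHom_tmul, unitVal_unitOne, op_one, one_smul,
      lin_id]

theorem tensorMap_id : tensorMap (𝟙 X) (𝟙 Y) = 𝟙 (tensor X Y) :=
  tensor_hom_ext fun x y => by simp

theorem tensorMap_comp (f : X ⟶ X') (f' : X' ⟶ X'') (g : Y ⟶ Y') (g' : Y' ⟶ Y'') :
    tensorMap f g ≫ tensorMap f' g' = tensorMap (f ≫ f') (g ≫ g') :=
  tensor_hom_ext fun x y => by simp

theorem assocHom_naturality {Z' : FlatConn Ω} (f : X ⟶ X') (g : Y ⟶ Y') (h : Z ⟶ Z') :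
    tensorMap (tensorMap f g) h ≫ assocHom X' Y' Z' =
      assocHom X Y Z ≫ tensorMap f (tensorMap g h) :=
  tensor_hom_ext₃ fun x y z => by simp

theorem leftUnitorHom_naturality (f : X ⟶ Y) :
    tensorMap (𝟙 (unit Ω)) f ≫ leftUnitorHom Y = leftUnitorHom X ≫ f :=
  tensor_hom_ext fun a x => by simp [lin_smul_apply]

theorem rightUnitorHom_naturality (f : X ⟶ Y) :
    tensorMap f (𝟙 (unit Ω)) ≫ rightUnitorHom Y = rightUnitorHom X ≫ f :=
  tensor_hom_ext fun x a => by simp [lin_op_smul_apply]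

theorem assocHom_pentagon (W X Y Z : FlatConn Ω) :
    tensorMap (assocHom W X Y) (𝟙 Z) ≫ assocHom W (tensor X Y) Z ≫
        tensorMap (𝟙 W) (assocHom X Y Z) =
      assocHom (tensor W X) Y Z ≫ assocHom W X (tensor Y Z) :=
  tensor_hom_ext₄ fun w x y z => by simp

theorem assocHom_triangle (X Y : FlatConn Ω) :
    assocHom X (unit Ω) Y ≫ tensorMap (𝟙 X) (leftUnitorHom Y) =
      tensorMap (rightUnitorHom X) (𝟙 Y) :=
  tensor_hom_ext₃ fun x a y => by simp [op_smul_tmul]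

noncomputable instance : MonoidalCategoryStruct (FlatConn Ω) where
  tensorObj := tensor
  whiskerLeft X _ _ f := tensorMap (𝟙 X) f
  whiskerRight f Y := tensorMap f (𝟙 Y)
  tensorHom := tensorMap
  tensorUnit := unit Ω
  associator := assocIso
  leftUnitor := leftUnitorIso
  rightUnitor := rightUnitorIso

noncomputable instance : MonoidalCategory (FlatConn Ω) :=
  MonoidalCategory.ofTensorHom
    (id_tensorHom_id := fun _ _ => tensorMap_id)
    (id_tensorHom := fun _ _ _ _ => rfl)
    (tensorHom_id := fun _ _ => rfl)
    (tensorHom_comp_tensorHom := fun f₁ f₂ g₁ g₂ => tensorMap_comp f₁ g₁ f₂ g₂)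
    (associator_naturality := assocHom_naturality)
    (leftUnitor_naturality := leftUnitorHom_naturality)
    (rightUnitor_naturality := rightUnitorHom_naturality)
    (pentagon := assocHom_pentagon)
    (triangle := assocHom_triangle)

theorem tensorMap_zero (X : FlatConn Ω) : tensorMap (𝟙 X) (0 : Y ⟶ Z) = 0 :=
  tensor_hom_ext fun x y => by simp

theorem zero_tensorMap (X : FlatConn Ω) : tensorMap (0 : Y ⟶ Z) (𝟙 X) = 0 :=
  tensor_hom_ext fun x y => by simp

theorem tensorMap_add (X : FlatConn Ω) (f g : Y ⟶ Z) :
    tensorMap (𝟙 X) (f + g) = tensorMap (𝟙 X) f + tensorMap (𝟙 X) g :=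
  tensor_hom_ext fun x y => by simp

theorem add_tensorMap (X : FlatConn Ω) (f g : Y ⟶ Z) :
    tensorMap (f + g) (𝟙 X) = tensorMap f (𝟙 X) + tensorMap g (𝟙 X) :=
  tensor_hom_ext fun x y => by simp

theorem tensorMap_smul (X : FlatConn Ω) (c : ℂ) (f : Y ⟶ Z) :
    tensorMap (𝟙 X) (c • f) = c • tensorMap (𝟙 X) f :=
  tensor_hom_ext fun x y => by simp

theorem smul_tensorMap (X : FlatConn Ω) (c : ℂ) (f : Y ⟶ Z) :
    tensorMap (c • f) (𝟙 X) = c • tensorMap f (𝟙 X) :=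
  tensor_hom_ext fun x y => by simp

instance : MonoidalPreadditive (FlatConn Ω) where
  whiskerLeft_zero := tensorMap_zero _
  zero_whiskerRight := zero_tensorMap _
  whiskerLeft_add := tensorMap_add _
  add_whiskerRight := add_tensorMap _

instance : MonoidalLinear ℂ (FlatConn Ω) where
  whiskerLeft_smul X _ _ := tensorMap_smul X
  smul_whiskerRight c _ _ f X := smul_tensorMap X c f

end FlatConn

open GradedBimodule

variable {Ω : DGAlgebra.{u}}

namespace FlatConn

variable {X X' Y Y' Z W : FlatConn Ω}

/-! ### The symmetry -/

/-- The tensors of dual basis vectors are central of degree zero and generate the tensor product as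
a left module. Identities for the symmetry thus reduce to arguments for which the Koszul sign is 1.
-/
theorem tensor_hom_ext_central {f g : tensor X Y ⟶ Z}
    (h : ∀ x ∈ X.centreGr 0, ∀ y ∈ Y.centreGr 0,
      lin f (tmul X Y x y) = lin g (tmul X Y x y)) : f = g := by
  refine hom_ext fun t => ?_
  rw [(tensorBasis X Y).map_eq_sum (lin_smul_apply f),
    (tensorBasis X Y).map_eq_sum (lin_smul_apply g)]
  exact Finset.sum_congr rfl fun q _ => by
    rw [tensorBasis_vec, h _ (X.basis.vec_mem _) _ (Y.basis.vec_mem _)]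

theorem tensor_hom_ext_central₃ {f g : tensor (tensor X Y) Z ⟶ W}
    (h : ∀ x ∈ X.centreGr 0, ∀ y ∈ Y.centreGr 0, ∀ z ∈ Z.centreGr 0,
      lin f (tmul (tensor X Y) Z (tmul X Y x y) z) =
        lin g (tmul (tensor X Y) Z (tmul X Y x y) z)) : f = g := by
  refine tensor_hom_ext_central fun t _ z hz => ?_
  rw [← (tensorBasis X Y).sum_coord t]
  simp only [map_sum, LinearMap.sum_apply, smul_tmul, lin_smul_apply]
  exact Finset.sum_congr rfl fun q _ => by
    rw [tensorBasis_vec, h _ (X.basis.vec_mem _) _ (Y.basis.vec_mem _) _ hz]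

theorem tensor_hom_ext_central₃' {f g : tensor X (tensor Y Z) ⟶ W}
    (h : ∀ x ∈ X.centreGr 0, ∀ y ∈ Y.centreGr 0, ∀ z ∈ Z.centreGr 0,
      lin f (tmul X (tensor Y Z) x (tmul Y Z y z)) =
        lin g (tmul X (tensor Y Z) x (tmul Y Z y z))) : f = g := by
  have h' : assocHom X Y Z ≫ f = assocHom X Y Z ≫ g :=
    tensor_hom_ext_central₃ fun x hx y hy z hz => by simpa using h x hx y hy z hz
  exact (cancel_epi (assocIso X Y Z).hom).1 h'

theorem tmul_coord_sum (x : X) (y : Y) :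
    tmul X Y x y = ∑ k, X.basis.coord k x • tmul X Y (X.basis.vec k) y := by
  conv_lhs => rw [← X.basis.sum_coord x]
  simp only [map_sum, LinearMap.sum_apply, smul_tmul]

/-- The bimodule map underlying the symmetry. -/
noncomputable def braidMap (X Y : FlatConn Ω) : tensor X Y →ₗ[ℂ] tensor Y X :=
  DualBasis.ofCentral (fun q : Fin X.rank × Fin Y.rank =>
    tmul Y X (Y.basis.vec q.2) (X.basis.vec q.1)) ∘ₗ (tensorBasis X Y).toFree

theorem isBimodMap_braidMap : IsBimodMap (braidMap X Y) :=
  (DualBasis.isBimodMap_ofCentral _ fun _ =>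
    tmul_mem_centreGr (Y.basis.vec_mem _) (X.basis.vec_mem _)).comp
      (tensorBasis X Y).isBimodMap_toFree

theorem braidMap_tmul (x : X) (y : Y) : braidMap X Y (tmul X Y x y) =
    ∑ q : Fin X.rank × Fin Y.rank, (X.basis.coord q.1 x * Y.basis.coord q.2 y) •
      tmul Y X (Y.basis.vec q.2) (X.basis.vec q.1) := rfl

/-- In coordinates x ⊗ y has coefficients x_k y_l, while y ⊗ x has y_l x_k on the exchanged basis
tensors. The coordinates of a graded central element are graded central, and exchanging them
produces the sign. -/
theorem braidMap_tmul_of_mem {i j : ℕ} {x : X} {y : Y} (hx : x ∈ X.centreGr i)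
    (hy : y ∈ Y.centreGr j) :
    braidMap X Y (tmul X Y x y) = (-1 : ℂ) ^ (i * j) • tmul Y X y x := by
  have h1 : tmul Y X y x = ∑ k, ∑ l, (Y.basis.coord l y * X.basis.coord k x) •
      tmul Y X (Y.basis.vec l) (X.basis.vec k) := by
    conv_lhs => rw [← X.basis.sum_coord x, map_sum]
    refine Finset.sum_congr rfl fun k _ => ?_
    rw [← op_smul_tmul, tmul_coord_sum]
    refine Finset.sum_congr rfl fun l _ => ?_
    rw [Y.basis.coord_op_smul]
  rw [braidMap_tmul, h1, Fintype.sum_prod_type, Finset.smul_sum]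
  refine Finset.sum_congr rfl fun k _ => ?_
  rw [Finset.smul_sum]
  refine Finset.sum_congr rfl fun l _ => ?_
  rw [(X.basis.coord_mem_centreGr k hx).2 j _ (Y.basis.coord_mem_centreGr l hy).1, smul_assoc]

theorem braidMap_tmul_of_mem_zero {x : X} {y : Y} (hx : x ∈ X.centreGr 0)
    (hy : y ∈ Y.centreGr 0) : braidMap X Y (tmul X Y x y) = tmul Y X y x := by
  simpa using braidMap_tmul_of_mem hx hy

/-- A bimodule map commutes with the connections if it does so on a dual basis. -/
theorem map_conn_of_vec {ι : Type} [Fintype ι] (b : DualBasis X.toGradedBimodule ι)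
    {f : X →ₗ[ℂ] Y} (hf : IsBimodMap f)
    (h : ∀ i, f (X.conn (b.vec i)) = Y.conn (f (b.vec i))) (x : X) :
    f (X.conn x) = Y.conn (f x) := by
  rw [← b.sum_coord x]
  simp only [map_sum, conn_smul, map_add, hf.smul, h]

/-- On tensors of basis vectors, each Leibniz term pairs a central element of degree one with one of
degree zero. The sign is trivial, and the symmetry merely exchanges the two terms. -/
theorem braidMap_conn (t : tensor X Y) :
    braidMap X Y ((tensor X Y).conn t) = (tensor Y X).conn (braidMap X Y t) := by
  refine map_conn_of_vec (tensorBasis X Y) isBimodMap_braidMap (fun q => ?_) t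
  have hx := X.basis.vec_mem q.1
  have hy := Y.basis.vec_mem q.2
  rw [tensorBasis_vec, conn_tmul, braidMap_tmul_of_mem_zero hx hy, conn_tmul,
    parity_of_mem_zero hx.1, parity_of_mem_zero hy.1, map_add,
    braidMap_tmul_of_mem (X.conn_mem_centreGr_one hx) hy,
    braidMap_tmul_of_mem hx (Y.conn_mem_centreGr_one hy), add_comm]
  simp

/-- The symmetry. -/
noncomputable def braidHom (X Y : FlatConn Ω) : tensor X Y ⟶ tensor Y X :=
  homOfBimodMap (braidMap X Y) isBimodMap_braidMap braidMap_conn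

theorem braidHom_tmul {i j : ℕ} {x : X} {y : Y} (hx : x ∈ X.centreGr i) (hy : y ∈ Y.centreGr j) :
    lin (braidHom X Y) (tmul X Y x y) = (-1 : ℂ) ^ (i * j) • tmul Y X y x :=
  braidMap_tmul_of_mem hx hy

theorem braidHom_tmul_zero {x : X} {y : Y} (hx : x ∈ X.centreGr 0) (hy : y ∈ Y.centreGr 0) :
    lin (braidHom X Y) (tmul X Y x y) = tmul Y X y x := braidMap_tmul_of_mem_zero hx hy

theorem braidHom_braidHom (X Y : FlatConn Ω) : braidHom X Y ≫ braidHom Y X = 𝟙 (tensor X Y) :=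
  tensor_hom_ext_central fun x hx y hy => by
    rw [lin_comp, braidHom_tmul_zero hx hy, braidHom_tmul_zero hy hx, lin_id]

/-- The symmetry as an isomorphism. -/
noncomputable def braidIso (X Y : FlatConn Ω) : tensor X Y ≅ tensor Y X :=
  ⟨braidHom X Y, braidHom Y X, braidHom_braidHom X Y, braidHom_braidHom Y X⟩

theorem braidHom_naturality (f : X ⟶ X') (g : Y ⟶ Y') :
    tensorMap f g ≫ braidHom X' Y' = braidHom X Y ≫ tensorMap g f :=
  tensor_hom_ext_central fun x hx y hy => by
    rw [lin_comp, lin_comp, tensorMap_tmul, braidHom_tmul_zero hx hy, tensorMap_tmul,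
      braidHom_tmul_zero (lin_mem_centreGr f hx) (lin_mem_centreGr g hy)]

theorem braidHom_hexagon (X Y Z : FlatConn Ω) :
    assocHom X Y Z ≫ braidHom X (tensor Y Z) ≫ assocHom Y Z X =
      tensorMap (braidHom X Y) (𝟙 Z) ≫ assocHom Y X Z ≫ tensorMap (𝟙 Y) (braidHom X Z) :=
  tensor_hom_ext_central₃ fun x hx y hy z hz => by
    simp only [lin_comp, assocHom_tmul, tensorMap_tmul, lin_id, braidHom_tmul_zero hx hy,
      braidHom_tmul_zero hx hz, braidHom_tmul_zero hx (tmul_mem_centreGr hy hz)]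

theorem braidHom_hexagon' (X Y Z : FlatConn Ω) :
    assocInv X Y Z ≫ braidHom (tensor X Y) Z ≫ assocInv Z X Y =
      tensorMap (𝟙 X) (braidHom Y Z) ≫ assocInv X Z Y ≫ tensorMap (braidHom X Z) (𝟙 Y) :=
  tensor_hom_ext_central₃' fun x hx y hy z hz => by
    simp only [lin_comp, assocInv_tmul, tensorMap_tmul, lin_id, braidHom_tmul_zero hy hz,
      braidHom_tmul_zero hx hz, braidHom_tmul_zero (tmul_mem_centreGr hx hy) hz]

noncomputable instance : SymmetricCategory (FlatConn Ω) where
  braiding := braidIso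
  braiding_naturality_right X _ _ f := braidHom_naturality (𝟙 X) f
  braiding_naturality_left f Z := braidHom_naturality f (𝟙 Z)
  hexagon_forward := braidHom_hexagon
  hexagon_reverse := braidHom_hexagon'
  symmetry := braidHom_braidHom

variable (Ω) in
/-- The tensor structure is the usual one. -/
noncomputable def standardTensor : StandardTensor Ω where
  unitIso := Iso.refl (unit Ω)
  tmul := tmul
  tmul_surjective X Y := X.basis.tensor_surjective Y.basis
  ker_tmul X Y := X.basis.ker_tensor Y.basis
  smul_tmul X Y a x y := (smul_tmul a x y).symm
  op_smul_tmul X Y a x y := (tmul_op_smul a x y).symm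
  tmul_mem X Y _ _ _ _ hx hy := tmul_mem hx hy
  conn_tmul X Y i x hx y := by
    refine (conn_tmul x y).trans ?_
    rw [parity_of_mem hx, map_smul, LinearMap.smul_apply]
  tensorHom_tmul := tensorMap_tmul
  associator_tmul X Y W := assocHom_tmul
  leftUnitor_tmul X a x := leftUnitorHom_tmul (show (unit Ω).carrier from a) x
  rightUnitor_tmul X x a := rightUnitorHom_tmul x (show (unit Ω).carrier from a)
  braiding_tmul X Y _ _ _ _ hx hy := braidHom_tmul hx hy

end FlatConn

open GradedBimodule

variable {Ω : DGAlgebra.{u}}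

namespace GradedBimodule.DualBasis

/-! ### Duals -/

variable {E : GradedBimodule Ω} {ι : Type} [Fintype ι] (b : DualBasis E ι)

/-- The values of a coordinate function on the dual basis. -/
noncomputable def row (i : ι) : GradedBimodule.free Ω ι := (fun j => b.coord i (b.vec j) : ι → Ω)

theorem coord_vec_mem (i j : ι) : b.coord i (b.vec j) ∈ Ω.centreGr 0 :=
  b.coord_mem_centreGr i (b.vec_mem j)

theorem row_mem_centreGr (i : ι) : b.row i ∈ (GradedBimodule.free Ω ι).centreGr 0 :=
  mem_centreGr_zero (fun j _ => (b.coord_vec_mem i j).1) fun a => funext fun j =>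
    DGAlgebra.comm_of_mem_centreGr_zero (b.coord_vec_mem i j) a

/-- The idempotent endomorphism of a free bimodule whose image is the dual. -/
noncomputable def dualIdem : GradedBimodule.free Ω ι →ₗ[ℂ] GradedBimodule.free Ω ι :=
  ofCentral b.row

theorem isBimodMap_dualIdem : IsBimodMap b.dualIdem := isBimodMap_ofCentral _ b.row_mem_centreGr

theorem dualIdem_apply (v : ι → Ω) (j : ι) :
    (show ι → Ω from b.dualIdem (show GradedBimodule.free Ω ι from v)) j =
      ∑ i, v i * b.coord i (b.vec j) :=
  Finset.sum_apply j Finset.univ fun i => v i • (show ι → Ω from b.row i)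

/-- The matrix e = (coord_k(vec_i)) has central entries and fixes coordinate columns; for x = vec_j
this is e² = e. The dual consists of the rows v with v e = v. -/
theorem sum_coord_vec_mul (k : ι) (x : E) :
    ∑ i, b.coord k (b.vec i) * b.coord i x = b.coord k x := by
  conv_rhs => rw [← b.sum_coord x, map_sum]
  refine Finset.sum_congr rfl fun i _ => ?_
  rw [b.coord_smul, DGAlgebra.comm_of_mem_centreGr_zero (b.coord_vec_mem k i)]

theorem dualIdem_row (k : ι) : b.dualIdem (b.row k) = b.row k :=
  funext fun j => (b.dualIdem_apply _ j).trans (b.sum_coord_vec_mul k (b.vec j))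

/-- The dual of a graded bimodule with a dual basis. -/
noncomputable def dual : GradedBimodule Ω :=
  ker (LinearMap.id - b.dualIdem) ((IsBimodMap.id _).sub b.isBimodMap_dualIdem)

/-- The inclusion of the dual in a free bimodule. -/
noncomputable def dualIncl : b.dual →ₗ[ℂ] GradedBimodule.free Ω ι := kerIncl _ _

theorem isBimodMap_dualIncl : IsBimodMap b.dualIncl := isBimodMap_kerIncl _ _

theorem dualIncl_injective : Function.Injective b.dualIncl := kerIncl_injective _ _

/-- The coordinate functions as elements of the dual. -/
noncomputable def dualVec (i : ι) : b.dual :=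
  (⟨b.row i, by
    rw [LinearMap.mem_ker, LinearMap.sub_apply, dualIdem_row, LinearMap.id_apply, sub_self]⟩ :
      LinearMap.ker (LinearMap.id - b.dualIdem))

theorem dualIncl_dualVec (i : ι) : b.dualIncl (b.dualVec i) = b.row i := rfl

/-- The value of an element of the dual at a vector of the dual basis. -/
noncomputable def dualCoord (i : ι) : b.dual →ₗ[ℂ] Ω :=
  (LinearMap.proj i : (ι → Ω) →ₗ[ℂ] Ω) ∘ₗ b.dualIncl

/-- The dual basis of the dual. -/
noncomputable def dualBasis : DualBasis b.dual ι where
  vec := b.dualVec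
  vec_mem i := mem_centreGr_zero (b.row_mem_centreGr i).1 fun a => b.dualIncl_injective <| by
    rw [b.isBimodMap_dualIncl.op_smul, b.isBimodMap_dualIncl.smul, dualIncl_dualVec,
      op_smul_of_mem_centreGr_zero (b.row_mem_centreGr i)]
  coord := b.dualCoord
  coord_smul i a v := congrFun (b.isBimodMap_dualIncl.smul a v) i
  coord_op_smul i a v := congrFun (b.isBimodMap_dualIncl.op_smul a v) i
  coord_mem i k v hv := b.isBimodMap_dualIncl.mem k v hv i trivial
  sum_coord v := by
    apply b.dualIncl_injective
    have h : b.dualIncl v - b.dualIdem (b.dualIncl v) = 0 := kerIncl_mem _ _ v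
    rw [sub_eq_zero] at h
    rw [h, map_sum]
    simp only [b.isBimodMap_dualIncl.smul]
    rfl

theorem dualBasis_coord_vec (i j : ι) :
    b.dualBasis.coord j (b.dualBasis.vec i) = b.coord i (b.vec j) := rfl

/-- The pairing of the dual with a bimodule. -/
noncomputable def pairing : b.dual →ₗ[ℂ] E →ₗ[ℂ] Ω :=
  ∑ i, (LinearMap.mul ℂ Ω).compl₁₂ (b.dualBasis.coord i) (b.coord i)

theorem pairing_apply (v : b.dual) (x : E) :
    b.pairing v x = ∑ i, b.dualBasis.coord i v * b.coord i x := by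
  simp [pairing]

theorem pairing_smul (a : Ω) (v : b.dual) (x : E) : b.pairing (a • v) x = a * b.pairing v x := by
  simp only [pairing_apply, b.dualBasis.coord_smul, Finset.mul_sum, mul_assoc]

theorem pairing_op_smul (a : Ω) (v : b.dual) (x : E) :
    b.pairing v (op a • x) = b.pairing v x * a := by
  simp only [pairing_apply, b.coord_op_smul, Finset.sum_mul, mul_assoc]

theorem pairing_balanced (a : Ω) (v : b.dual) (x : E) :
    b.pairing (op a • v) x = b.pairing v (a • x) := by
  simp only [pairing_apply, b.dualBasis.coord_op_smul, b.coord_smul, mul_assoc]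

theorem pairing_mem {i j : ℕ} {v : b.dual} {x : E} (hv : v ∈ b.dual.gr i) (hx : x ∈ E.gr j) :
    b.pairing v x ∈ Ω.gr (i + j) := by
  rw [pairing_apply]
  exact Submodule.sum_mem _ fun k _ =>
    SetLike.mul_mem_graded (b.dualBasis.coord_mem k i v hv) (b.coord_mem k j x hx)

theorem pairing_dualVec (i : ι) (x : E) : b.pairing (b.dualBasis.vec i) x = b.coord i x := by
  simp only [pairing_apply, dualBasis_coord_vec, sum_coord_vec_mul]

theorem pairing_vec (v : b.dual) (i : ι) : b.pairing v (b.vec i) = b.dualBasis.coord i v := by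
  conv_rhs => rw [← b.dualBasis.sum_coord v, map_sum]
  simp only [pairing_apply, b.dualBasis.coord_smul, dualBasis_coord_vec]

theorem pairing_ext {v w : b.dual} (h : ∀ x, b.pairing v x = b.pairing w x) : v = w :=
  b.dualBasis.ext_coord fun i => by rw [← pairing_vec, ← pairing_vec, h]

theorem sum_coord_op_smul_vec (x : E) : ∑ i, op (b.coord i x) • b.vec i = x := by
  simp only [op_smul_vec, b.sum_coord]

end GradedBimodule.DualBasis

namespace FlatConn

variable {X Y Z W : FlatConn Ω}

theorem sum_conn_vec (X : FlatConn Ω) (x : X) :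
    ∑ i, (op (X.basis.coord i x) • X.conn (X.basis.vec i) +
      op (Ω.d (X.basis.coord i x)) • X.basis.vec i) = X.conn x := by
  conv_rhs => rw [← X.basis.sum_coord_op_smul_vec x, map_sum]
  simp only [conn_op_smul, DualBasis.par_vec]

/-- The connection on the dual. -/
noncomputable def dualConn (X : FlatConn Ω) : X.basis.dual →ₗ[ℂ] X.basis.dual :=
  ∑ i, ((X.basis.dual.lact.flip (X.basis.dualBasis.vec i)) ∘ₗ
    (Ω.d ∘ₗ X.basis.dualBasis.coord i -
      X.basis.pairing.flip (X.conn (X.basis.vec i)) ∘ₗ X.basis.dual.par))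

theorem dualConn_apply (v : X.basis.dual) : X.dualConn v =
    ∑ i, (Ω.d (X.basis.dualBasis.coord i v) -
      X.basis.pairing (X.basis.dual.par v) (X.conn (X.basis.vec i))) • X.basis.dualBasis.vec i := by
  simp [dualConn, sub_smul, Finset.sum_sub_distrib]

/-- The definition of the dual connection prescribes this value at the basis vectors. It extends to
all x = ∑ vec_i x_i because the derivatives of x_i in the two terms on the right cancel. Every
property of the dual connection is then checked by pairing with x. -/
theorem pairing_dualConn (v : X.basis.dual) (x : X) : X.basis.pairing (X.dualConn v) x =
    Ω.d (X.basis.pairing v x) - X.basis.pairing (X.basis.dual.par v) (X.conn x) := by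
  rw [dualConn_apply]
  simp only [map_sum, LinearMap.sum_apply, DualBasis.pairing_smul, DualBasis.pairing_dualVec]
  rw [DualBasis.pairing_apply X.basis v x, ← sum_conn_vec X x]
  simp only [map_sum, map_add, DualBasis.pairing_op_smul, DualBasis.pairing_vec,
    DualBasis.coord_par, DGAlgebra.d_mul]
  rw [← Finset.sum_sub_distrib]
  exact Finset.sum_congr rfl fun i _ => by noncomm_ring

theorem dualConn_mem {n : ℕ} {v : X.basis.dual} (hv : v ∈ X.basis.dual.gr n) :
    X.dualConn v ∈ X.basis.dual.gr (n + 1) := by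
  rw [dualConn_apply]
  refine Submodule.sum_mem _ fun i _ => ?_
  refine GradedBimodule.smul_mem (j := 0) _ (sub_mem (Ω.d_mem (X.basis.dualBasis.coord_mem i n v hv)) ?_)
    (X.basis.dualBasis.vec_mem i).1
  exact X.basis.pairing_mem (parity_mem hv) (X.conn_mem (X.basis.vec_mem i).1)

/-- The dual of a flat connection. -/
noncomputable def dual (X : FlatConn Ω) : FlatConn Ω where
  toGradedBimodule := X.basis.dual
  isFGP := X.basis.dualBasis.isFGP
  conn := X.dualConn
  conn_mem := dualConn_mem
  conn_right {n v} hv a := X.basis.pairing_ext fun x => by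
    rw [map_add, LinearMap.add_apply, LinearMap.map_smul X.basis.pairing ((-1 : ℂ) ^ n),
      LinearMap.smul_apply, pairing_dualConn,
      DualBasis.pairing_balanced, DualBasis.pairing_balanced, pairing_dualConn, par_op_smul,
      DualBasis.pairing_balanced, DualBasis.pairing_balanced, conn_smul, map_add,
      parity_of_mem hv, LinearMap.map_smul X.basis.pairing ((-1 : ℂ) ^ n), LinearMap.smul_apply,
      LinearMap.smul_apply]
    abel
  conn_left {n a} ha v := X.basis.pairing_ext fun x => by
    rw [map_add, LinearMap.add_apply, LinearMap.map_smul X.basis.pairing ((-1 : ℂ) ^ n),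
      LinearMap.smul_apply, pairing_dualConn,
      DualBasis.pairing_smul, DualBasis.pairing_smul, DualBasis.pairing_smul, pairing_dualConn,
      par_smul, DualBasis.pairing_smul, DGAlgebra.d_mul, DGAlgebra.par, parity_of_mem ha]
    simp only [smul_mul_assoc, mul_sub, smul_sub]
    abel
  flat v := X.basis.pairing_ext fun x => by
    have h : X.basis.dual.par (X.dualConn v) = -X.dualConn (X.basis.dual.par v) :=
      parity_map_of_degree_one (fun _ _ h => dualConn_mem h) v
    rw [pairing_dualConn, pairing_dualConn, h, map_neg, LinearMap.neg_apply, pairing_dualConn,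
      parity_parity, X.flat, map_sub, Ω.d_d]
    simp

/-- The dual basis of the dual. -/
noncomputable def dualBasis (X : FlatConn Ω) : DualBasis X.dual.toGradedBimodule (Fin X.rank) :=
  X.basis.dualBasis

/-- The pairing of the dual with a flat connection. -/
noncomputable def pairing (X : FlatConn Ω) : X.dual →ₗ[ℂ] X →ₗ[ℂ] Ω := X.basis.pairing

theorem pairing_op_smul (a : Ω) (v : X.dual) (x : X) :
    X.pairing v (op a • x) = X.pairing v x * a := X.basis.pairing_op_smul a v x

theorem pairing_balanced (a : Ω) (v : X.dual) (x : X) :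
    X.pairing (op a • v) x = X.pairing v (a • x) := X.basis.pairing_balanced a v x

theorem pairing_dualBasis_vec (i : Fin X.rank) (x : X) :
    X.pairing (X.dualBasis.vec i) x = X.basis.coord i x := X.basis.pairing_dualVec i x

theorem sum_pairing_smul (v : X.dual) :
    ∑ i, X.pairing v (X.basis.vec i) • X.dualBasis.vec i = v := by
  conv_rhs => rw [← X.dualBasis.sum_coord v]
  exact Finset.sum_congr rfl fun i _ => congrArg (· • _) (X.basis.pairing_vec v i)

theorem conn_pairing (v : X.dual) (x : X) : Ω.d (X.pairing v x) =
    X.pairing (X.dual.conn v) x + X.pairing (X.dual.par v) (X.conn x) :=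
  eq_add_of_sub_eq (pairing_dualConn v x).symm

/-- The evaluation of the dual. -/
noncomputable def evalHom (X : FlatConn Ω) : tensor X.dual X ⟶ unit Ω :=
  tensorDesc (show X.dual →ₗ[ℂ] X →ₗ[ℂ] (unit Ω).carrier from X.pairing)
    { balanced := pairing_balanced
      smul := X.basis.pairing_smul
      op_smul := pairing_op_smul
      mem := X.basis.pairing_mem
      conn := conn_pairing }

theorem unitVal_evalHom (v : X.dual) (x : X) :
    unitVal (lin (evalHom X) (tmul X.dual X v x)) = X.pairing v x :=
  tensorDesc_tmul _ _ _ _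

/-- The canonical element of the tensor product of a flat connection with its dual. -/
noncomputable def coevalElem (X : FlatConn Ω) : tensor X X.dual :=
  ∑ i, tmul X X.dual (X.basis.vec i) (X.dualBasis.vec i)

theorem coevalElem_mem (X : FlatConn Ω) : X.coevalElem ∈ (tensor X X.dual).centreGr 0 :=
  Submodule.sum_mem _ fun i _ => tmul_mem_centreGr (X.basis.vec_mem i) (X.dualBasis.vec_mem i)

theorem tmul_dual_eq_sum (x : X) (v : X.dual) : tmul X X.dual x v =
    ∑ k, tmul X X.dual (op (X.pairing v (X.basis.vec k)) • x) (X.dualBasis.vec k) := by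
  conv_lhs => rw [← sum_pairing_smul v, map_sum]
  exact Finset.sum_congr rfl fun k _ => (op_smul_tmul _ _ _).symm

theorem pairing_conn_dualBasis_vec (i : Fin X.rank) (x : X) :
    X.pairing (X.dual.conn (X.dualBasis.vec i)) x =
      Ω.d (X.basis.coord i x) - X.basis.coord i (X.conn x) := by
  rw [eq_sub_iff_add_eq, ← pairing_dualBasis_vec, ← pairing_dualBasis_vec, conn_pairing,
    DualBasis.par_vec]

/-- Since the dual connection pairs to d coord_i(x) - coord_i(∇x), the sum is ∇x minus the dual
basis expansion of ∇x. For x = vec_k this is a coefficient in the derivative of the coevaluation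
element. -/
theorem sum_conn_add_pairing (x : X) :
    ∑ i, (op (X.basis.coord i x) • X.conn (X.basis.vec i) +
      op (X.pairing (X.dual.conn (X.dualBasis.vec i)) x) • X.basis.vec i) = 0 := by
  have h1 := sum_conn_vec X x
  rw [← X.basis.sum_coord_op_smul_vec (X.conn x), ← sub_eq_zero, ← Finset.sum_sub_distrib] at h1
  refine Eq.trans (Finset.sum_congr rfl fun i _ => ?_) h1
  rw [pairing_conn_dualBasis_vec, MulOpposite.op_sub, sub_smul, add_sub_assoc]

/-- Expand the dual factors in the dual basis and move the coefficients into the left factor. The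
factor in front of the k-th dual vector is then the sum in `sum_conn_add_pairing` at vec_k. -/
theorem conn_coevalElem (X : FlatConn Ω) : (tensor X X.dual).conn X.coevalElem = 0 := by
  have h : ∀ i, (tensor X X.dual).conn (tmul X X.dual (X.basis.vec i) (X.dualBasis.vec i)) =
      ∑ k, tmul X X.dual (op (X.basis.coord i (X.basis.vec k)) • X.conn (X.basis.vec i) +
      op (X.pairing (X.dual.conn (X.dualBasis.vec i)) (X.basis.vec k)) •
        X.basis.vec i) (X.dualBasis.vec k) := by
    intro i
    rw [conn_tmul, DualBasis.par_vec, tmul_dual_eq_sum, tmul_dual_eq_sum (X.basis.vec i),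
      ← Finset.sum_add_distrib]
    refine Finset.sum_congr rfl fun k _ => ?_
    rw [pairing_dualBasis_vec, map_add, LinearMap.add_apply]
  rw [coevalElem, map_sum, Finset.sum_congr rfl fun i _ => h i, Finset.sum_comm]
  refine Finset.sum_eq_zero fun k _ => ?_
  rw [← LinearMap.sum_apply, ← map_sum, sum_conn_add_pairing, map_zero, LinearMap.zero_apply]

/-- The morphism from the unit object given by a parallel central element of degree zero. -/
noncomputable def ofUnit (x : X) (hx : x ∈ X.centreGr 0) (h : X.conn x = 0) : unit Ω ⟶ X :=
  homOfBimodMap (show (unit Ω).carrier →ₗ[ℂ] X from X.lact.flip x)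
    { smul a c := mul_smul a (unitVal c) x
      op_smul a c := by
        change (unitVal c * a) • x = op a • unitVal c • x
        rw [mul_smul, ← op_smul_of_mem_centreGr_zero hx, smul_comm]
      mem k c hc := by
        have h := X.smul_mem (show unitVal c ∈ Ω.gr k from hc) hx.1
        rwa [add_zero] at h }
    fun c => by
      change Ω.d (unitVal c) • x = X.conn (unitVal c • x)
      rw [conn_smul, h, smul_zero, add_zero]

@[simp] theorem ofUnit_apply (x : X) (hx : x ∈ X.centreGr 0) (h : X.conn x = 0) (a : unit Ω) :
    lin (ofUnit x hx h) a = unitVal a • x := rfl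

/-- The coevaluation of the dual. -/
noncomputable def coevalHom (X : FlatConn Ω) : unit Ω ⟶ tensor X X.dual :=
  ofUnit X.coevalElem X.coevalElem_mem X.conn_coevalElem

theorem coevalHom_apply (a : unit Ω) : lin (coevalHom X) a =
    ∑ i, tmul X X.dual (unitVal a • X.basis.vec i) (X.dualBasis.vec i) := by
  rw [coevalHom, ofUnit_apply, coevalElem, Finset.smul_sum]
  simp only [smul_tmul]

/-- This triangle identity amounts to the expansion of v in the coordinate functions with
coefficients ⟨v, vec_i⟩; the other one to the expansion x = ∑ vec_i coord_i(x). -/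
theorem coeval_eval (X : FlatConn Ω) :
    tensorMap (𝟙 X.dual) (coevalHom X) ≫ assocInv X.dual X X.dual ≫
        tensorMap (evalHom X) (𝟙 X.dual) =
      rightUnitorHom X.dual ≫ leftUnitorInv X.dual := by
  refine tensor_hom_ext fun v a => ?_
  simp only [lin_comp, tensorMap_tmul, lin_id, coevalHom_apply, map_sum, assocInv_tmul,
    rightUnitorHom_tmul, leftUnitorInv_apply]
  conv_rhs => rw [← sum_pairing_smul (op (unitVal a) • v), map_sum]
  refine Finset.sum_congr rfl fun i _ => ?_
  rw [pairing_balanced, ← unitVal_evalHom, ← op_smul_tmul _ (unitOne Ω), op_smul_unitOne]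

theorem eval_coeval (X : FlatConn Ω) :
    tensorMap (coevalHom X) (𝟙 X) ≫ assocHom X X.dual X ≫ tensorMap (𝟙 X) (evalHom X) =
      leftUnitorHom X ≫ rightUnitorInv X := by
  refine tensor_hom_ext fun a x => ?_
  simp only [lin_comp, tensorMap_tmul, lin_id, coevalHom_apply, map_sum,
    LinearMap.sum_apply, assocHom_tmul, leftUnitorHom_tmul, rightUnitorInv_apply]
  conv_rhs => rw [← X.basis.sum_coord_op_smul_vec x, Finset.smul_sum, map_sum, LinearMap.sum_apply]
  refine Finset.sum_congr rfl fun i _ => ?_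
  rw [smul_comm, op_smul_tmul, ← pairing_dualBasis_vec, ← unitVal_evalHom, smul_unitOne]

noncomputable instance (X : FlatConn Ω) : ExactPairing X X.dual where
  coevaluation' := coevalHom X
  evaluation' := evalHom X
  coevaluation_evaluation' := coeval_eval X
  evaluation_coevaluation' := eval_coeval X

noncomputable instance : RightRigidCategory (FlatConn Ω) where
  rightDual X := ⟨X.dual⟩

end FlatConn

open GradedBimodule

variable {Ω : DGAlgebra.{u}}

/-! ### Central elements of degree zero -/

namespace GradedBimodule

variable {E F G : GradedBimodule Ω}

@[simp] theorem coe_smul_centreGr (z : CentreZero Ω) (x : E.centreGr 0) :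
    ((z • x : E.centreGr 0) : E) = z.val • (x : E) := rfl

/-- The action of a bimodule map on central elements of degree zero. -/
def IsBimodMap.centreLin {f : E →ₗ[ℂ] F} (hf : IsBimodMap f) : E.centreGr 0 →ₗ[ℂ] F.centreGr 0 :=
  f.restrict fun _ hx => hf.mem_centreGr hx

@[simp] theorem IsBimodMap.coe_centreLin {f : E →ₗ[ℂ] F} (hf : IsBimodMap f) (x : E.centreGr 0) :
    (hf.centreLin x : F) = f x := rfl

theorem IsBimodMap.centreLin_smul {f : E →ₗ[ℂ] F} (hf : IsBimodMap f) (z : CentreZero Ω)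
    (x : E.centreGr 0) : hf.centreLin (z • x) = z • hf.centreLin x := Subtype.ext (hf.smul z.val x)

namespace DualBasis

variable {ι : Type} [Fintype ι] (b : DualBasis E ι)

/-- The vectors of a dual basis as central elements. -/
def centreVec (i : ι) : E.centreGr 0 := ⟨b.vec i, b.vec_mem i⟩

/-- The coordinates of a central element of degree zero. -/
def centreCoord (i : ι) : E.centreGr 0 →ₗ[ℂ] CentreZero Ω where
  toFun x := CentreZero.mk (b.coord i x) (b.coord_mem_centreGr i x.2)
  map_add' x y := CentreZero.val_injective (map_add (b.coord i) (x : E) y)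
  map_smul' c x := CentreZero.val_injective (map_smul (b.coord i) c (x : E))

@[simp] theorem val_centreCoord (i : ι) (x : E.centreGr 0) :
    (b.centreCoord i x).val = b.coord i x := rfl

theorem centreCoord_smul (i : ι) (z : CentreZero Ω) (x : E.centreGr 0) :
    b.centreCoord i (z • x) = z * b.centreCoord i x :=
  CentreZero.val_injective (b.coord_smul i z.val x)

theorem sum_centreCoord (x : E.centreGr 0) : ∑ i, b.centreCoord i x • b.centreVec i = x :=
  Subtype.ext <| by
    rw [AddSubmonoidClass.coe_finsetSum]
    exact b.sum_coord x

end DualBasis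

end GradedBimodule

namespace FlatConn

variable {X X' Y Y' Z : FlatConn Ω}

theorem smul_centreGr (c : ℂ) (x : X.centreGr 0) : c • x = (c • (1 : CentreZero Ω)) • x :=
  Subtype.ext <| by
    rw [coe_smul_centreGr, CentreZero.val_smul, CentreZero.val_one, smul_assoc, one_smul]
    rfl

/-- The tensor product of central elements of degree zero. -/
noncomputable def centreTensor (X Y : FlatConn Ω) :
    X.centreGr 0 →ₗ[ℂ] Y.centreGr 0 →ₗ[ℂ] (tensor X Y).centreGr 0 :=
  LinearMap.mk₂ ℂ (fun x y => ⟨tmul X Y x y, tmul_mem_centreGr x.2 y.2⟩)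
    (fun x x' y => Subtype.ext (by simp)) (fun c x y => Subtype.ext (by simp))
    (fun x y y' => Subtype.ext (by simp)) (fun c x y => Subtype.ext (by simp))

@[simp] theorem coe_centreTensor (x : X.centreGr 0) (y : Y.centreGr 0) :
    (centreTensor X Y x y : tensor X Y) = tmul X Y x y := rfl

theorem centreTensor_smul_left (z : CentreZero Ω) (x : X.centreGr 0) (y : Y.centreGr 0) :
    centreTensor X Y (z • x) y = z • centreTensor X Y x y := Subtype.ext (smul_tmul z.val _ _)

theorem centreTensor_smul_right (z : CentreZero Ω) (x : X.centreGr 0) (y : Y.centreGr 0) :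
    centreTensor X Y x (z • y) = z • centreTensor X Y x y :=
  Subtype.ext <| by
    rw [coe_centreTensor, coe_smul_centreGr, ← op_smul_tmul, op_smul_of_mem_centreGr_zero x.2,
      smul_tmul]
    rfl

/-! ### Fibres -/

variable (p : CentreZero Ω →ₐ[ℂ] ℂ)

/-- The fibre at a character `p`: the image of the idempotent matrix `p (coord i (vec j))`. -/
noncomputable def fibre (X : FlatConn Ω) : Submodule ℂ (Fin X.rank → ℂ) where
  carrier := {v | ∀ i, ∑ j, v j * p (X.basis.centreCoord i (X.basis.centreVec j)) = v i}
  zero_mem' i := by simp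
  add_mem' hv hw i := by simp only [Pi.add_apply, add_mul, Finset.sum_add_distrib, hv i, hw i]
  smul_mem' c v hv i := by
    simp only [Pi.smul_apply, smul_eq_mul, mul_assoc, ← Finset.mul_sum]
    rw [hv i]

/-- The value at `p` of a central element of degree zero. -/
noncomputable def eval (X : FlatConn Ω) : X.centreGr 0 →ₗ[ℂ] fibre p X :=
  LinearMap.codRestrict (fibre p X) (LinearMap.pi fun i => p.toLinearMap ∘ₗ X.basis.centreCoord i)
    fun x i => by
      have h := congrArg (fun y => p (X.basis.centreCoord i y)) (X.basis.sum_centreCoord x)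
      simpa [DualBasis.centreCoord_smul] using h

theorem eval_apply (x : X.centreGr 0) (i : Fin X.rank) :
    (eval p X x : Fin X.rank → ℂ) i = p (X.basis.centreCoord i x) := rfl

theorem eval_smul (z : CentreZero Ω) (x : X.centreGr 0) : eval p X (z • x) = p z • eval p X x :=
  Subtype.ext <| funext fun i => by
    rw [eval_apply, DualBasis.centreCoord_smul, map_mul]
    rfl

/-- A section of the evaluation at `p`. -/
noncomputable def evalSection (X : FlatConn Ω) : fibre p X →ₗ[ℂ] X.centreGr 0 :=
  ∑ i, (LinearMap.proj i ∘ₗ (fibre p X).subtype).smulRight (X.basis.centreVec i)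

theorem evalSection_apply (v : fibre p X) : evalSection p X v =
    ∑ i, (v : Fin X.rank → ℂ) i • X.basis.centreVec i := by
  simp [evalSection]

@[simp] theorem eval_evalSection (v : fibre p X) : eval p X (evalSection p X v) = v :=
  Subtype.ext <| funext fun i => by
    rw [eval_apply, evalSection_apply, map_sum, map_sum]
    simpa using v.2 i

theorem eval_surjective (X : FlatConn Ω) : Function.Surjective (eval p X) :=
  fun v => ⟨_, eval_evalSection p v⟩

/-- A linear map on the central elements of degree zero which factors through the fibre. -/
def IsLocal {M : Type*} [AddCommGroup M] [Module ℂ M] (g : X.centreGr 0 →ₗ[ℂ] M) : Prop :=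
  ∀ z x, g (z • x) = p z • g x

variable {p}

/-- The section of the evaluation replaces each coordinate x_i in x = ∑ x_i vec_i by the number
p(x_i), and a local map cannot see the difference. Hence maps on fibres defined through the section
are given by the expected formula on values of central elements. -/
theorem IsLocal.apply_evalSection_eval {M : Type*} [AddCommGroup M] [Module ℂ M]
    {g : X.centreGr 0 →ₗ[ℂ] M} (hg : IsLocal p g) (x : X.centreGr 0) :
    g (evalSection p X (eval p X x)) = g x := by
  conv_rhs => rw [← X.basis.sum_centreCoord x, map_sum]
  rw [evalSection_apply, map_sum]
  refine Finset.sum_congr rfl fun i _ => ?_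
  rw [hg, map_smul, eval_apply]

variable (p)

theorem fibre_ext {M : Type*} [AddCommGroup M] [Module ℂ M] {f g : fibre p X →ₗ[ℂ] M}
    (h : ∀ x, f (eval p X x) = g (eval p X x)) : f = g :=
  LinearMap.ext fun v => by
    obtain ⟨x, rfl⟩ := eval_surjective p X v
    exact h x

/-- The action of a bimodule map on the fibres at `p`. -/
noncomputable def fibreMap {f : X →ₗ[ℂ] Y} (hf : IsBimodMap f) : fibre p X →ₗ[ℂ] fibre p Y :=
  eval p Y ∘ₗ hf.centreLin ∘ₗ evalSection p X

@[simp] theorem fibreMap_eval {f : X →ₗ[ℂ] Y} (hf : IsBimodMap f) (x : X.centreGr 0) :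
    fibreMap p hf (eval p X x) = eval p Y (hf.centreLin x) :=
  IsLocal.apply_evalSection_eval (g := eval p Y ∘ₗ hf.centreLin) (fun z x => by
    rw [LinearMap.comp_apply, IsBimodMap.centreLin_smul, eval_smul]
    rfl) x

theorem fibreMap_comp {f : X →ₗ[ℂ] Y} (hf : IsBimodMap f) {g : Y →ₗ[ℂ] Z} (hg : IsBimodMap g) :
    fibreMap p (hg.comp hf) = fibreMap p hg ∘ₗ fibreMap p hf :=
  fibre_ext p fun x => by
    rw [LinearMap.comp_apply, fibreMap_eval, fibreMap_eval, fibreMap_eval]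
    rfl

theorem fibreMap_id (X : FlatConn Ω) :
    fibreMap p (X := X) (Y := X) (IsBimodMap.id X.toGradedBimodule) = LinearMap.id :=
  fibre_ext p fun x => by
    rw [fibreMap_eval]
    rfl

/-- The bilinear map on fibres given by the tensor product of central elements. -/
noncomputable def fibreMul (X Y : FlatConn Ω) :
    fibre p X →ₗ[ℂ] fibre p Y →ₗ[ℂ] fibre p (tensor X Y) :=
  ((centreTensor X Y).compl₁₂ (evalSection p X) (evalSection p Y)).compr₂ (eval p (tensor X Y))

@[simp] theorem fibreMul_eval (x : X.centreGr 0) (y : Y.centreGr 0) :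
    fibreMul p X Y (eval p X x) (eval p Y y) = eval p (tensor X Y) (centreTensor X Y x y) := by
  have h1 : ∀ y, IsLocal p (eval p (tensor X Y) ∘ₗ (centreTensor X Y).flip y) := fun y z x => by
    simp only [LinearMap.comp_apply, LinearMap.flip_apply, centreTensor_smul_left, eval_smul]
  have h2 : ∀ x, IsLocal p (eval p (tensor X Y) ∘ₗ centreTensor X Y x) := fun x z y => by
    simp only [LinearMap.comp_apply, centreTensor_smul_right, eval_smul]
  exact ((h1 _).apply_evalSection_eval x).trans ((h2 _).apply_evalSection_eval y)

/-- The inverse of the multiplication of fibres. -/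
noncomputable def fibreMulInv (X Y : FlatConn Ω) :
    fibre p (tensor X Y) →ₗ[ℂ] fibre p X ⊗[ℂ] fibre p Y :=
  (∑ q, (p.toLinearMap ∘ₗ (tensorBasis X Y).centreCoord q).smulRight
    (eval p X (X.basis.centreVec q.1) ⊗ₜ eval p Y (Y.basis.centreVec q.2))) ∘ₗ
      evalSection p (tensor X Y)

theorem fibreMulInv_eval (t : (tensor X Y).centreGr 0) :
    fibreMulInv p X Y (eval p (tensor X Y) t) = ∑ q, p ((tensorBasis X Y).centreCoord q t) •
      (eval p X (X.basis.centreVec q.1) ⊗ₜ eval p Y (Y.basis.centreVec q.2)) := by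
  refine (IsLocal.apply_evalSection_eval (p := p) (g := ∑ q, (p.toLinearMap ∘ₗ
    (tensorBasis X Y).centreCoord q).smulRight (eval p X (X.basis.centreVec q.1) ⊗ₜ
      eval p Y (Y.basis.centreVec q.2))) (fun z x => ?_) t).trans ?_
  · simp [DualBasis.centreCoord_smul, Finset.smul_sum, mul_smul]
  · simp

theorem sum_smul_eval_centreVec (x : X.centreGr 0) :
    ∑ i, p (X.basis.centreCoord i x) • eval p X (X.basis.centreVec i) = eval p X x := by
  conv_rhs => rw [← X.basis.sum_centreCoord x, map_sum]
  simp only [eval_smul]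

/-- The multiplication of fibres as an isomorphism. -/
noncomputable def fibreMulEquiv (X Y : FlatConn Ω) :
    fibre p X ⊗[ℂ] fibre p Y ≃ₗ[ℂ] fibre p (tensor X Y) :=
  LinearEquiv.ofLinearMap (TensorProduct.lift (fibreMul p X Y)) (fibreMulInv p X Y)
    (fibre_ext p fun t => by
      rw [LinearMap.comp_apply, fibreMulInv_eval, map_sum, LinearMap.id_apply]
      conv_rhs => rw [← (tensorBasis X Y).sum_centreCoord t, map_sum]
      refine Finset.sum_congr rfl fun q _ => ?_
      rw [map_smul, TensorProduct.lift.tmul, fibreMul_eval, eval_smul]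
      rfl)
    (TensorProduct.ext' fun v w => by
      obtain ⟨x, rfl⟩ := eval_surjective p X v
      obtain ⟨y, rfl⟩ := eval_surjective p Y w
      rw [LinearMap.comp_apply, TensorProduct.lift.tmul, fibreMul_eval, fibreMulInv_eval,
        LinearMap.id_apply, ← sum_smul_eval_centreVec p x, ← sum_smul_eval_centreVec p y,
        TensorProduct.sum_tmul, Fintype.sum_prod_type]
      refine Finset.sum_congr rfl fun i _ => ?_
      rw [TensorProduct.tmul_sum]
      refine Finset.sum_congr rfl fun j _ => ?_
      rw [TensorProduct.smul_tmul_smul, ← map_mul]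
      rfl)

variable (Ω) in
/-- The unit as a central element of the unit object. -/
noncomputable def centreUnitOne : (unit Ω).centreGr 0 := ⟨unitOne Ω, unitOne_mem⟩

/-- A central element of the unit object as an element of the centre. -/
def centreUnitVal : (unit Ω).centreGr 0 →ₗ[ℂ] CentreZero Ω where
  toFun x := CentreZero.mk (unitVal x) x.2
  map_add' _ _ := rfl
  map_smul' _ _ := rfl

theorem centreUnitVal_smul (z : CentreZero Ω) (x : (unit Ω).centreGr 0) :
    centreUnitVal (z • x) = z * centreUnitVal x := rfl

theorem centreUnitVal_one : centreUnitVal (centreUnitOne Ω) = 1 := rfl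

theorem centreUnitVal_smul_one (x : (unit Ω).centreGr 0) :
    centreUnitVal x • centreUnitOne Ω = x := Subtype.ext (smul_unitOne _)

/-- The fibre of the unit object. -/
noncomputable def fibreUnitEquiv : ℂ ≃ₗ[ℂ] fibre p (unit Ω) :=
  LinearEquiv.ofLinearMap (LinearMap.toSpanSingleton ℂ _ (eval p (unit Ω) (centreUnitOne Ω)))
    (p.toLinearMap ∘ₗ centreUnitVal ∘ₗ evalSection p (unit Ω))
    (fibre_ext p fun x => by
      have h : IsLocal p (p.toLinearMap ∘ₗ centreUnitVal) := fun z x => by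
        simp [centreUnitVal_smul]
      rw [LinearMap.comp_apply, LinearMap.id_apply]
      conv_rhs => rw [← centreUnitVal_smul_one x, eval_smul]
      exact congrArg (· • eval p (unit Ω) (centreUnitOne Ω)) (h.apply_evalSection_eval x))
    (LinearMap.ext_ring <| by
      have h : IsLocal p (p.toLinearMap ∘ₗ centreUnitVal) := fun z x => by
        simp [centreUnitVal_smul]
      rw [LinearMap.comp_apply, LinearMap.toSpanSingleton_apply, one_smul]
      refine (h.apply_evalSection_eval _).trans ?_
      simp [centreUnitVal_one])

theorem fibreUnitEquiv_one : fibreUnitEquiv p 1 = eval p (unit Ω) (centreUnitOne Ω) :=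
  one_smul ℂ _

/-! ### Comparison with the localisation -/

/-- The scalar z passes across the tensor product to ℂ_p, where it acts as p(z). So the germ is
local and factors through `fibre`, the model in `Type` that a functor to `FGModuleCat.{0}` requires;
the localisation itself lives in `Type u`. -/
theorem germ_smul (z : CentreZero Ω) (x : X.centreGr 0) :
    germ p X (z • x) = p z • germ p X x := by
  have h : z • (1 : CharField p) = p z • (1 : CharField p) := rfl
  rw [germ, germ, ← TensorProduct.smul_tmul, h, TensorProduct.smul_tmul']

/-- The value at `p` of central elements, as a linear map to the localisation. -/
noncomputable def germLin (X : FlatConn Ω) : X.centreGr 0 →ₗ[ℂ] LocalFibre p X where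
  toFun := germ p X
  map_add' x y := TensorProduct.tmul_add _ x y
  map_smul' c x := by
    rw [smul_centreGr, germ_smul, map_smul, map_one]
    simp

/-- The comparison of the fibre with the localisation. -/
noncomputable def fibreToLocal (X : FlatConn Ω) : fibre p X →ₗ[ℂ] LocalFibre p X :=
  germLin p X ∘ₗ evalSection p X

@[simp] theorem fibreToLocal_eval (x : X.centreGr 0) :
    fibreToLocal p X (eval p X x) = germ p X x :=
  IsLocal.apply_evalSection_eval (g := germLin p X) (germ_smul p) x

theorem tmul_eq_smul_germ (c : ℂ) (x : X.centreGr 0) :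
    (show CharField p from c) ⊗ₜ[CentreZero Ω] x = c • germ p X x := by
  rw [germ, TensorProduct.smul_tmul']
  exact congrArg (· ⊗ₜ[CentreZero Ω] x) (mul_one c).symm

/-- The comparison of the localisation with the fibre. -/
noncomputable def localToFibre (X : FlatConn Ω) : LocalFibre p X →+ fibre p X :=
  TensorProduct.liftAddHom
    (AddMonoidHom.mk' (fun c : CharField p => ((show ℂ from c) • eval p X).toAddMonoidHom)
      fun c c' => AddMonoidHom.ext fun x => add_smul (show ℂ from c) (show ℂ from c') _)
    fun z c x => by
      change (p z * (show ℂ from c)) • eval p X x = (show ℂ from c) • eval p X (z • x)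
      rw [eval_smul, smul_smul, mul_comm]

theorem localToFibre_smul_germ (c : ℂ) (x : X.centreGr 0) :
    localToFibre p X (c • germ p X x) = c • eval p X x := by
  rw [← tmul_eq_smul_germ]
  rfl

theorem local_induction {P : LocalFibre p X → Prop} (smul_germ : ∀ (c : ℂ) x, P (c • germ p X x))
    (add : ∀ s t, P s → P t → P (s + t)) (t : LocalFibre p X) : P t := by
  induction t using TensorProduct.induction_on with
  | zero => simpa using smul_germ 0 0
  | tmul c x => exact (tmul_eq_smul_germ p c x).symm ▸ smul_germ c x
  | add s t hs ht => exact add s t hs ht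

/-- The isomorphism of the fibre with the localisation. -/
noncomputable def fibreEquivLocal (X : FlatConn Ω) : fibre p X ≃ₗ[ℂ] LocalFibre p X :=
  { fibreToLocal p X with
    invFun := localToFibre p X
    left_inv := fun v => by
      obtain ⟨x, rfl⟩ := eval_surjective p X v
      have h := localToFibre_smul_germ p 1 x
      rw [one_smul, one_smul] at h
      exact (congrArg _ (fibreToLocal_eval p x)).trans h
    right_inv := fun t => by
      refine local_induction p (P := fun t => fibreToLocal p X (localToFibre p X t) = t)
        (fun c x => ?_) (fun s t hs ht => ?_) t
      · rw [localToFibre_smul_germ, map_smul, fibreToLocal_eval]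
      · rw [map_add, map_add, hs, ht] }

@[simp] theorem fibreEquivLocal_eval (x : X.centreGr 0) :
    fibreEquivLocal p X (eval p X x) = germ p X x := fibreToLocal_eval p x

@[simp] theorem fibreEquivLocal_symm_germ (x : X.centreGr 0) :
    (fibreEquivLocal p X).symm (germ p X x) = eval p X x := by
  rw [LinearEquiv.symm_apply_eq, fibreEquivLocal_eval]

end FlatConn

open GradedBimodule Limits

variable {Ω : DGAlgebra.{u}}

namespace FlatConn

variable {X X' Y Y' Z : FlatConn Ω} (p : CentreZero Ω →ₐ[ℂ] ℂ)

/-! ### The fibre functor -/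

/-- The action of a morphism on the fibres at `p`. -/
noncomputable abbrev fibreHom (f : X ⟶ Y) : fibre p X →ₗ[ℂ] fibre p Y :=
  fibreMap p (isBimodMap_lin f)

theorem fibreHom_eval (f : X ⟶ Y) (x : X.centreGr 0) :
    fibreHom p f (eval p X x) = eval p Y (centreMap f x) := fibreMap_eval p _ x

theorem fibreHom_id (X : FlatConn Ω) : fibreHom p (𝟙 X) = LinearMap.id := fibreMap_id p X

theorem fibreHom_comp (f : X ⟶ Y) (g : Y ⟶ Z) :
    fibreHom p (f ≫ g) = fibreHom p g ∘ₗ fibreHom p f := fibreMap_comp p _ _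

theorem fibreHom_add (f g : X ⟶ Y) : fibreHom p (f + g) = fibreHom p f + fibreHom p g :=
  fibre_ext p fun x => by
    simp only [LinearMap.add_apply, fibreHom_eval, ← map_add]
    rfl

theorem fibreHom_smul (c : ℂ) (f : X ⟶ Y) : fibreHom p (c • f) = c • fibreHom p f :=
  fibre_ext p fun x => by
    simp only [LinearMap.smul_apply, fibreHom_eval, ← map_smul]
    rfl

/-- The coordinates of the fibre map on the values of the basis vectors are the matrix entries of f
evaluated at p, so differential simplicity applies through `eq_zero_of_matrix_character`. -/
theorem eq_zero_of_fibreHom (hΩ : Ω.IsDiffSimple) (f : X ⟶ Y) (h : fibreHom p f = 0) : f = 0 :=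
  eq_zero_of_matrix_character hΩ p f fun j i => by
    have h1 := congrArg (fun g : fibre p X →ₗ[ℂ] fibre p Y =>
      (g (eval p X (X.basis.centreVec i)) : Fin Y.rank → ℂ) j) h
    simp only [fibreHom_eval, eval_apply] at h1
    exact h1

/-- The fibre functor at the character `p`. -/
noncomputable def fibreFunctor : FlatConn Ω ⥤ FGModuleCat.{0} ℂ where
  obj X := FGModuleCat.of ℂ (fibre p X)
  map f := FGModuleCat.ofHom (fibreHom p f)
  map_id X := FGModuleCat.hom_ext (fibreHom_id p X)
  map_comp f g := FGModuleCat.hom_ext (fibreHom_comp p f g)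

instance : (fibreFunctor p).Additive where
  map_add {_ _ f g} := FGModuleCat.hom_ext (fibreHom_add p f g)

instance : (fibreFunctor p).Linear ℂ where
  map_smul f c := FGModuleCat.hom_ext (fibreHom_smul p c f)

theorem faithful_fibreFunctor (hΩ : Ω.IsDiffSimple) : (fibreFunctor p).Faithful where
  map_injective {X Y f g} h := by
    rw [← sub_eq_zero]
    refine eq_zero_of_fibreHom p hΩ _ ?_
    rw [← sub_eq_zero, ← (fibreFunctor p).map_sub] at h
    exact congrArg (fun k : (fibreFunctor p).obj X ⟶ (fibreFunctor p).obj Y => k.hom.hom) h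

theorem fibreMul_naturality (f : X ⟶ X') (g : Y ⟶ Y') (v : fibre p X) (w : fibre p Y) :
    fibreMul p X' Y' (fibreHom p f v) (fibreHom p g w) =
      fibreHom p (tensorMap f g) (fibreMul p X Y v w) := by
  obtain ⟨x, rfl⟩ := eval_surjective p X v
  obtain ⟨y, rfl⟩ := eval_surjective p Y w
  rw [fibreHom_eval, fibreHom_eval, fibreMul_eval, fibreMul_eval, fibreHom_eval]
  exact congrArg _ (Subtype.ext (tensorMap_tmul f g _ _).symm)

theorem fibreMul_assoc (u : fibre p X) (v : fibre p Y) (w : fibre p Z) :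
    fibreHom p (assocHom X Y Z) (fibreMul p (tensor X Y) Z (fibreMul p X Y u v) w) =
      fibreMul p X (tensor Y Z) u (fibreMul p Y Z v w) := by
  obtain ⟨x, rfl⟩ := eval_surjective p X u
  obtain ⟨y, rfl⟩ := eval_surjective p Y v
  obtain ⟨z, rfl⟩ := eval_surjective p Z w
  simp only [fibreMul_eval, fibreHom_eval]
  exact congrArg _ (Subtype.ext (assocHom_tmul _ _ _))

theorem fibreMul_unit_left (c : ℂ) (v : fibre p X) :
    fibreHom p (leftUnitorHom X) (fibreMul p (unit Ω) X (fibreUnitEquiv p c) v) = c • v := by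
  obtain ⟨x, rfl⟩ := eval_surjective p X v
  rw [← mul_one c, ← smul_eq_mul, map_smul, fibreUnitEquiv_one, map_smul, LinearMap.smul_apply,
    fibreMul_eval, map_smul, fibreHom_eval, smul_eq_mul, mul_one]
  refine congrArg (fun y => c • eval p X y) (Subtype.ext ?_)
  exact (leftUnitorHom_tmul _ _).trans (one_smul _ _)

theorem fibreMul_unit_right (c : ℂ) (v : fibre p X) :
    fibreHom p (rightUnitorHom X) (fibreMul p X (unit Ω) v (fibreUnitEquiv p c)) = c • v := by
  obtain ⟨x, rfl⟩ := eval_surjective p X v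
  rw [← mul_one c, ← smul_eq_mul, map_smul, fibreUnitEquiv_one, map_smul,
    fibreMul_eval, map_smul, fibreHom_eval, smul_eq_mul, mul_one]
  refine congrArg (fun y => c • eval p X y) (Subtype.ext ?_)
  exact (rightUnitorHom_tmul _ _).trans (one_smul Ωᵐᵒᵖ _)

theorem fibreMul_braid (v : fibre p X) (w : fibre p Y) :
    fibreHom p (braidHom X Y) (fibreMul p X Y v w) = fibreMul p Y X w v := by
  obtain ⟨x, rfl⟩ := eval_surjective p X v
  obtain ⟨y, rfl⟩ := eval_surjective p Y w
  rw [fibreMul_eval, fibreMul_eval, fibreHom_eval]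
  exact congrArg _ (Subtype.ext (braidHom_tmul_zero x.2 y.2))

/-- The multiplication of fibres as an isomorphism of vector spaces. -/
noncomputable def fibreMu (X Y : FlatConn Ω) :
    (fibreFunctor p).obj X ⊗ (fibreFunctor p).obj Y ≅ (fibreFunctor p).obj (X ⊗ Y) :=
  (fibreMulEquiv p X Y).toFGModuleCatIso

theorem fibreMu_natural_left (f : X ⟶ Y) (Z : FlatConn Ω) :
    (fibreFunctor p).map f ▷ (fibreFunctor p).obj Z ≫ (fibreMu p Y Z).hom =
      (fibreMu p X Z).hom ≫ (fibreFunctor p).map (f ▷ Z) :=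
  FGModuleCat.hom_ext <| TensorProduct.ext' fun v w => by
    have h := fibreMul_naturality p f (𝟙 Z) v w
    rw [fibreHom_id] at h
    exact h

theorem fibreMu_natural_right (Z : FlatConn Ω) (f : X ⟶ Y) :
    (fibreFunctor p).obj Z ◁ (fibreFunctor p).map f ≫ (fibreMu p Z Y).hom =
      (fibreMu p Z X).hom ≫ (fibreFunctor p).map (Z ◁ f) :=
  FGModuleCat.hom_ext <| TensorProduct.ext' fun v w => by
    have h := fibreMul_naturality p (𝟙 Z) f v w
    rw [fibreHom_id] at h
    exact h

theorem fibreMu_left_unitality (X : FlatConn Ω) : (λ_ ((fibreFunctor p).obj X)).hom =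
    (fibreUnitEquiv p).toFGModuleCatIso.hom ▷ (fibreFunctor p).obj X ≫
      (fibreMu p (𝟙_ (FlatConn Ω)) X).hom ≫ (fibreFunctor p).map (λ_ X).hom :=
  FGModuleCat.hom_ext <| TensorProduct.ext' fun c v => (fibreMul_unit_left p c v).symm

theorem fibreMu_right_unitality (X : FlatConn Ω) : (ρ_ ((fibreFunctor p).obj X)).hom =
    (fibreFunctor p).obj X ◁ (fibreUnitEquiv p).toFGModuleCatIso.hom ≫
      (fibreMu p X (𝟙_ (FlatConn Ω))).hom ≫ (fibreFunctor p).map (ρ_ X).hom :=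
  FGModuleCat.hom_ext <| TensorProduct.ext' fun v c => (fibreMul_unit_right p c v).symm

theorem fibreMu_braid (X Y : FlatConn Ω) :
    (fibreMu p X Y).hom ≫ (fibreFunctor p).map (β_ X Y).hom =
      (β_ ((fibreFunctor p).obj X) ((fibreFunctor p).obj Y)).hom ≫ (fibreMu p Y X).hom :=
  FGModuleCat.hom_ext <| TensorProduct.ext' fun v w => fibreMul_braid p v w

theorem fibreMu_assoc (X Y Z : FlatConn Ω) :
    (fibreMu p X Y).hom ▷ (fibreFunctor p).obj Z ≫ (fibreMu p (X ⊗ Y) Z).hom ≫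
        (fibreFunctor p).map (α_ X Y Z).hom =
      (α_ ((fibreFunctor p).obj X) ((fibreFunctor p).obj Y) ((fibreFunctor p).obj Z)).hom ≫
        (fibreFunctor p).obj X ◁ (fibreMu p Y Z).hom ≫ (fibreMu p X (Y ⊗ Z)).hom :=
  FGModuleCat.hom_ext <| TensorProduct.ext_threefold fun u v w => fibreMul_assoc p u v w

end FlatConn

open GradedBimodule Limits

variable {Ω : DGAlgebra.{u}}

namespace FlatConn

variable {X X' Y Y' Z : FlatConn Ω} (p : CentreZero Ω →ₐ[ℂ] ℂ)

/-- The tensor structure of the fibre functor. -/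
noncomputable def fibreCoreMonoidal : (fibreFunctor p).CoreMonoidal where
  εIso := (fibreUnitEquiv p).toFGModuleCatIso
  μIso := fibreMu p
  μIso_hom_natural_left := fibreMu_natural_left p
  μIso_hom_natural_right := fibreMu_natural_right p
  associativity := fibreMu_assoc p
  left_unitality := fibreMu_left_unitality p
  right_unitality := fibreMu_right_unitality p

noncomputable instance : (fibreFunctor p).Monoidal := (fibreCoreMonoidal p).toMonoidal

noncomputable instance : (fibreFunctor p).Braided where
  braided := fibreMu_braid p

/-! ### Exactness -/

section Exact

variable (f : X ⟶ Y) (g : Y →ₗ[ℂ] X) (hg : IsBimodMap g)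
  (h : ∀ x, lin f (g (lin f x)) = lin f x)

/-- The projection to the kernel as a bimodule map. -/
noncomputable abbrev kernelProj : X →ₗ[ℂ] kernelObj f g hg h :=
  cornerProj X (g ∘ₗ lin f) (hg.comp (isBimodMap_lin f)) (fun x => by simp [h])
    (conn_kernelObj f g h)

theorem isBimodMap_kernelProj : IsBimodMap (kernelProj f g hg h) := isBimodMap_cornerProj _ _ _ _ _

/-- The projection and g are not morphisms of the category, but `fibreMap` is functorial for all
bimodule maps, so the splitting identity passes to fibres. -/
theorem fibreHom_kernelIncl_kernelProj (v : fibre p X) :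
    fibreHom p (kernelIncl f g hg h) (fibreMap p (isBimodMap_kernelProj f g hg h) v) =
      v - fibreMap p hg (fibreHom p f v) := by
  obtain ⟨x, rfl⟩ := eval_surjective p X v
  simp only [fibreMap_eval, ← map_sub]
  rfl

theorem fibreMap_kernelProj_kernelIncl (v : fibre p (kernelObj f g hg h)) :
    fibreMap p (isBimodMap_kernelProj f g hg h) (fibreHom p (kernelIncl f g hg h) v) = v := by
  obtain ⟨x, rfl⟩ := eval_surjective p _ v
  simp only [fibreMap_eval]
  exact congrArg _ (Subtype.ext (cornerProj_cornerIncl _ _ _ _ _ _))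

-- On fibres the kernel inclusion i and its retraction r satisfy i r = 1 - g f and r i = 1. These
-- identities exhibit i as a kernel of the fibre map of f: a map k killed by f factors as r k.
include hg h in
theorem preservesLimit_of_generalised_inverse :
    PreservesLimit (parallelPair f 0) (fibreFunctor p) := by
  refine preservesLimit_of_preserves_limit_cone (kernelIsLimit f g hg h)
    ((KernelFork.isLimitMapConeEquiv _ _).symm ?_)
  have h0 : (fibreFunctor p).map (kernelIncl f g hg h) ≫ (fibreFunctor p).map f = 0 := by
    rw [← Functor.map_comp, kernelIncl_comp, Functor.map_zero]
  let r : (fibreFunctor p).obj X ⟶ (fibreFunctor p).obj (kernelObj f g hg h) :=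
    FGModuleCat.ofHom (fibreMap p (isBimodMap_kernelProj f g hg h))
  let s : (fibreFunctor p).obj Y ⟶ (fibreFunctor p).obj X := FGModuleCat.ofHom (fibreMap p hg)
  have h1 : r ≫ (fibreFunctor p).map (kernelIncl f g hg h) = 𝟙 _ - (fibreFunctor p).map f ≫ s :=
    FGModuleCat.hom_ext <| LinearMap.ext fun v => fibreHom_kernelIncl_kernelProj p f g hg h v
  have h2 : (fibreFunctor p).map (kernelIncl f g hg h) ≫ r = 𝟙 _ :=
    FGModuleCat.hom_ext <| LinearMap.ext fun v => fibreMap_kernelProj_kernelIncl p f g hg h v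
  exact KernelFork.IsLimit.ofι _ h0 (fun {W} k _ => k ≫ r)
    (fun {W} k hk => by
      rw [Category.assoc, h1, Preadditive.comp_sub, reassoc_of% hk]
      simp)
    (fun {W} k hk m hm => by rw [← hm, Category.assoc, h2, Category.comp_id])

/-- The inclusion of the cokernel as a bimodule map. -/
noncomputable abbrev cokernelIncl : cokernelObj f g hg h →ₗ[ℂ] Y :=
  cornerIncl Y (lin f ∘ₗ g) ((isBimodMap_lin f).comp hg) (fun x => by simp [h])
    (conn_cokernelObj f g h)

theorem isBimodMap_cokernelIncl : IsBimodMap (cokernelIncl f g hg h) :=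
  isBimodMap_cornerIncl _ _ _ _ _

theorem fibreMap_cokernelIncl_cokernelProj (v : fibre p Y) :
    fibreMap p (isBimodMap_cokernelIncl f g hg h) (fibreHom p (cokernelProj f g hg h) v) =
      v - fibreHom p f (fibreMap p hg v) := by
  obtain ⟨x, rfl⟩ := eval_surjective p Y v
  simp only [fibreMap_eval, ← map_sub]
  rfl

theorem fibreHom_cokernelProj_cokernelIncl (v : fibre p (cokernelObj f g hg h)) :
    fibreHom p (cokernelProj f g hg h) (fibreMap p (isBimodMap_cokernelIncl f g hg h) v) = v := by
  obtain ⟨x, rfl⟩ := eval_surjective p _ v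
  simp only [fibreMap_eval]
  exact congrArg _ (Subtype.ext (cornerProj_cornerIncl _ _ _ _ _ _))

-- Dual to the kernel case: the projection q to the cokernel and its section s satisfy s q = 1 - f g
-- and q s = 1 on fibres.
include hg h in
theorem preservesColimit_of_generalised_inverse :
    PreservesColimit (parallelPair f 0) (fibreFunctor p) := by
  refine preservesColimit_of_preserves_colimit_cocone (cokernelIsColimit f g hg h)
    ((CokernelCofork.isColimitMapCoconeEquiv _ _).symm ?_)
  have h0 : (fibreFunctor p).map f ≫ (fibreFunctor p).map (cokernelProj f g hg h) = 0 := by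
    rw [← Functor.map_comp, comp_cokernelProj, Functor.map_zero]
  let r : (fibreFunctor p).obj (cokernelObj f g hg h) ⟶ (fibreFunctor p).obj Y :=
    FGModuleCat.ofHom (fibreMap p (isBimodMap_cokernelIncl f g hg h))
  let s : (fibreFunctor p).obj Y ⟶ (fibreFunctor p).obj X := FGModuleCat.ofHom (fibreMap p hg)
  have h1 : (fibreFunctor p).map (cokernelProj f g hg h) ≫ r = 𝟙 _ - s ≫ (fibreFunctor p).map f :=
    FGModuleCat.hom_ext <| LinearMap.ext fun v => fibreMap_cokernelIncl_cokernelProj p f g hg h v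
  have h2 : r ≫ (fibreFunctor p).map (cokernelProj f g hg h) = 𝟙 _ :=
    FGModuleCat.hom_ext <| LinearMap.ext fun v => fibreHom_cokernelProj_cokernelIncl p f g hg h v
  exact CokernelCofork.IsColimit.ofπ _ h0 (fun {W} k _ => r ≫ k)
    (fun {W} k hk => by
      rw [← Category.assoc, h1, Preadditive.sub_comp, Category.assoc, hk]
      simp)
    (fun {W} k hk m hm => by rw [← hm, ← Category.assoc, h2, Category.id_comp])

end Exact

theorem preservesFiniteLimits_fibreFunctor (hΩ : Ω.IsDiffSimple) :
    PreservesFiniteLimits (fibreFunctor p) := by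
  -- A unital character can exist only on a nonzero ring; nontriviality is needed for generalised
  -- inverses.
  have := p.toRingHom.domain_nontrivial
  have := hasKernels hΩ
  have := Preadditive.hasEqualizers_of_hasKernels (C := FlatConn Ω)
  have : ∀ {X Y : FlatConn Ω} (f : X ⟶ Y), PreservesLimit (parallelPair f 0) (fibreFunctor p) :=
    fun f => by
      obtain ⟨g, hg, h⟩ := exists_generalised_inverse hΩ f
      exact preservesLimit_of_generalised_inverse p f g hg h
  exact Functor.preservesFiniteLimits_of_preservesKernels _

theorem preservesFiniteColimits_fibreFunctor (hΩ : Ω.IsDiffSimple) :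
    PreservesFiniteColimits (fibreFunctor p) := by
  have := p.toRingHom.domain_nontrivial
  have := hasCokernels hΩ
  have := HasFiniteBiproducts.of_hasFiniteProducts (C := FlatConn Ω)
  have := Preadditive.hasCoequalizers_of_hasCokernels (C := FlatConn Ω)
  have : ∀ {X Y : FlatConn Ω} (f : X ⟶ Y), PreservesColimit (parallelPair f 0) (fibreFunctor p) :=
    fun f => by
      obtain ⟨g, hg, h⟩ := exists_generalised_inverse hΩ f
      exact preservesColimit_of_generalised_inverse p f g hg h
  exact Functor.preservesFiniteColimits_of_preservesCokernels _

/-- Localisation at a character as a fibre functor. -/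
noncomputable def localisation (hΩ : Ω.IsDiffSimple) : FibreFunctor (FlatConn Ω) where
  functor := fibreFunctor p
  faithful := faithful_fibreFunctor p hΩ
  preservesFiniteLimits := preservesFiniteLimits_fibreFunctor p hΩ
  preservesFiniteColimits := preservesFiniteColimits_fibreFunctor p hΩ

theorem isLocalisationAt_localisation (hΩ : Ω.IsDiffSimple) :
    (standardTensor Ω).IsLocalisationAt p (localisation p hΩ) := by
  refine ⟨fibreEquivLocal p, fun X Y f x => ?_, fun X Y x y => ?_, ?_⟩
  · exact (congrArg (fun v => fibreEquivLocal p Y (fibreHom p f v))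
      (fibreEquivLocal_symm_germ p x)).trans ((congrArg (fibreEquivLocal p Y)
        (fibreHom_eval p f x)).trans (fibreEquivLocal_eval p _))
  · exact (congrArg₂ (fun v w => fibreEquivLocal p (tensor X Y) (fibreMul p X Y v w))
      (fibreEquivLocal_symm_germ p x) (fibreEquivLocal_symm_germ p y)).trans
        ((congrArg (fibreEquivLocal p _) (fibreMul_eval p x y)).trans (fibreEquivLocal_eval p _))
  · exact (congrArg (fibreEquivLocal p _) (fibreUnitEquiv_one p)).trans (fibreEquivLocal_eval p _)

/-! ### The category of flat connections is Tannakian -/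

-- An endomorphism of the unit is determined by the central element u = f(1). The difference f -
-- p(u) vanishes on the fibre at p, hence is zero; distinct scalars give distinct maps since Z ≠ 0.
include p in
theorem end_unit_bijective (hΩ : Ω.IsDiffSimple) :
    Function.Bijective (fun c : ℂ => c • 𝟙 (𝟙_ (FlatConn Ω))) := by
  have := p.toRingHom.domain_nontrivial
  constructor
  · intro c c' h
    have h1 : c • (1 : CentreZero Ω) = c' • (1 : CentreZero Ω) :=
      CentreZero.val_injective (lin_congr h (unitOne Ω))
    exact smul_left_injective ℂ (one_ne_zero (α := CentreZero Ω)) h1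
  · intro f
    let u : CentreZero Ω := centreUnitVal (centreMap f (centreUnitOne Ω))
    refine ⟨p u, Eq.symm (sub_eq_zero.1 (eq_zero_of_fibreHom p hΩ
      (X := unit Ω) (Y := unit Ω) (f - p u • 𝟙 (unit Ω)) (fibre_ext p fun x => ?_)))⟩
    have h1 : centreMap (f - p u • 𝟙 (unit Ω)) (centreUnitOne Ω) =
        u • centreUnitOne Ω - p u • centreUnitOne Ω :=
      (Subtype.ext rfl : _ = centreMap f (centreUnitOne Ω) - p u • centreUnitOne Ω).trans
        (congrArg (· - p u • centreUnitOne Ω) (centreUnitVal_smul_one _).symm)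
    rw [← centreUnitVal_smul_one x, eval_smul, map_smul, fibreHom_eval, h1, map_sub, eval_smul,
      map_smul, sub_self, smul_zero, LinearMap.zero_apply]

end FlatConn

/-! ### Isomorphic fibre functors have isomorphic automorphism groups -/

namespace FibreFunctor

variable {C : Type w} [Category.{u} C] [Preadditive C] [Linear ℂ C] [MonoidalCategory C]
  [SymmetricCategory C] {ω ω' : FibreFunctor C}

/-- A family of isomorphisms of fibres which is natural and compatible with tensor products. -/
structure IsTensorIso (e : ∀ X : C, ω.fib X ≃ₗ[ℂ] ω'.fib X) : Prop where
  map : ∀ {X Y : C} (f : X ⟶ Y) (x : ω.fib X), e Y (ω.map f x) = ω'.map f (e X x)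
  mul : ∀ (X Y : C) (x : ω.fib X) (y : ω.fib Y),
    e _ (ω.mul X Y x y) = ω'.mul X Y (e X x) (e Y y)
  one : e _ ω.one = ω'.one

variable {e : ∀ X : C, ω.fib X ≃ₗ[ℂ] ω'.fib X}

theorem IsTensorIso.symm (he : IsTensorIso e) :
    IsTensorIso (ω := ω') (ω' := ω) fun X => (e X).symm where
  map f x := by rw [LinearEquiv.symm_apply_eq, he.map, LinearEquiv.apply_symm_apply]
  mul X Y x y := by
    rw [LinearEquiv.symm_apply_eq, he.mul, LinearEquiv.apply_symm_apply,
      LinearEquiv.apply_symm_apply]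
  one := by rw [LinearEquiv.symm_apply_eq, he.one]

variable (e) (R : Type v) [CommRing R] [Algebra ℂ R]

/-- The extension of scalars of an isomorphism of fibres. -/
noncomputable def extend (X : C) : (R ⊗[ℂ] ω.fib X) ≃ₗ[R] (R ⊗[ℂ] ω'.fib X) :=
  (e X).baseChange ℂ R _ _

theorem extend_tmul (X : C) (r : R) (x : ω.fib X) : extend e R X (r ⊗ₜ x) = r ⊗ₜ e X x := rfl

theorem extend_symm (X : C) :
    extend (ω := ω') (ω' := ω) (fun X => (e X).symm) R X = (extend e R X).symm := by
  refine LinearEquiv.ext fun u => ?_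
  rw [LinearEquiv.eq_symm_apply]
  induction u using TensorProduct.induction_on with
  | zero => simp
  | add u v hu hv => rw [map_add, map_add, hu, hv]
  | tmul r x => rw [extend_tmul, extend_tmul, LinearEquiv.apply_symm_apply]

variable {e}

theorem extend_map (he : IsTensorIso e) {X Y : C} (f : X ⟶ Y) (u : R ⊗[ℂ] ω.fib X) :
    extend e R Y ((ω.map f).baseChange R u) = (ω'.map f).baseChange R (extend e R X u) := by
  induction u using TensorProduct.induction_on with
  | zero => simp
  | add u v hu hv => simp only [map_add, hu, hv]
  | tmul r x => simp only [LinearMap.baseChange_tmul, extend_tmul, he.map]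

theorem extend_mul (he : IsTensorIso e) (X Y : C) (u : R ⊗[ℂ] ω.fib X) (v : R ⊗[ℂ] ω.fib Y) :
    extend e R _ (ω.mulBaseChange R X Y u v) =
      ω'.mulBaseChange R X Y (extend e R X u) (extend e R Y v) := by
  induction u using TensorProduct.induction_on with
  | zero => simp
  | add u u' hu hu' => simp only [map_add, LinearMap.add_apply, hu, hu']
  | tmul r x =>
    induction v using TensorProduct.induction_on with
    | zero => simp
    | add v v' hv hv' => simp only [map_add, hv, hv']
    | tmul s y => rw [mulBaseChange_tmul, extend_tmul, extend_tmul, extend_tmul,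
        mulBaseChange_tmul, he.mul]

theorem extend_scalarMap {S : Type v} [CommRing S] [Algebra ℂ S] (φ : R →ₐ[ℂ] S) (X : C)
    (u : R ⊗[ℂ] ω.fib X) :
    extend e S X (scalarMap _ φ u) = scalarMap _ φ (extend e R X u) := by
  induction u using TensorProduct.induction_on with
  | zero => simp
  | add u v hu hv => simp only [map_add, hu, hv]
  | tmul r x => rfl

/-- Conjugation with an isomorphism of fibre functors. -/
noncomputable def conjHom (he : IsTensorIso e) :
    ω.tensorAutSubgroup R →* ω'.tensorAutSubgroup R where
  toFun g := ⟨fun X => (extend e R X).symm.trans ((g.1 X).trans (extend e R X)), by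
    obtain ⟨g, g1, g2, g3⟩ := g
    have he' := he.symm
    refine ⟨fun X Y f u => ?_, fun X Y x y => ?_, ?_⟩
    · simp only [LinearEquiv.trans_apply, ← extend_symm, extend_map R he', g1, extend_map R he]
    · simp only [LinearEquiv.trans_apply, ← extend_symm, extend_mul R he', g2, extend_mul R he]
    · simp only [LinearEquiv.trans_apply, ← extend_symm, extend_tmul, he'.one, g3, he.one]⟩
  map_one' := Subtype.ext <| funext fun X => LinearEquiv.ext fun u =>
    (extend e R X).apply_symm_apply u
  map_mul' g h := Subtype.ext <| funext fun X => LinearEquiv.ext fun u => by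
    change extend e R X (g.1 X (h.1 X ((extend e R X).symm u))) =
      extend e R X (g.1 X ((extend e R X).symm (extend e R X (h.1 X ((extend e R X).symm u)))))
    rw [LinearEquiv.symm_apply_apply]

theorem conjHom_apply (he : IsTensorIso e) (g : ω.tensorAutSubgroup R) (X : C)
    (u : R ⊗[ℂ] ω'.fib X) :
    (conjHom R he g).1 X u = extend e R X (g.1 X ((extend e R X).symm u)) := rfl

theorem conjHom_symm_conjHom (he : IsTensorIso e) (g : ω.tensorAutSubgroup R) :
    conjHom R he.symm (conjHom R he g) = g :=
  Subtype.ext <| funext fun X => LinearEquiv.ext fun u => by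
    rw [conjHom_apply, conjHom_apply, extend_symm, LinearEquiv.symm_symm,
      LinearEquiv.symm_apply_apply, LinearEquiv.symm_apply_apply]

/-- Both sides are S-linear, so it is enough to compare them on the image of R ⊗ ω'(X), which
generates S ⊗ ω'(X) over S. -/
theorem conjHom_tensorAutMap {R S : Type v} [CommRing R] [Algebra ℂ R] [CommRing S]
    [Algebra ℂ S] (φ : R →ₐ[ℂ] S) (he : IsTensorIso e) (g : ω.tensorAutSubgroup R) :
    conjHom S he (ω.tensorAutMap φ g) = ω'.tensorAutMap φ (conjHom R he g) :=
  Subtype.ext <| funext fun X => linearEquiv_ext_scalarMap φ fun u => by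
    have h1 : ∀ u, (ω.tensorAutMap φ g).1 X (scalarMap _ φ u) = scalarMap _ φ (g.1 X u) :=
      extendScalarsEquiv_scalarMap φ (g.1 X)
    have h2 : (ω'.tensorAutMap φ (conjHom R he g)).1 X (scalarMap _ φ u) =
        scalarMap _ φ ((conjHom R he g).1 X u) := extendScalarsEquiv_scalarMap φ _ u
    rw [h2, conjHom_apply, conjHom_apply, ← extend_symm, ← extend_symm, extend_scalarMap, h1,
      extend_scalarMap]

theorem tensorAut_map_conj (he : IsTensorIso e) {R S : CommAlgCat.{v} ℂ} (φ : R ⟶ S) :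
    ω.tensorAut.map φ ≫ GrpCat.ofHom (conjHom S he) =
      GrpCat.ofHom (conjHom R he) ≫ ω'.tensorAut.map φ := by
  apply GrpCat.hom_ext
  apply MonoidHom.ext
  intro g
  exact conjHom_tensorAutMap φ.hom he g

/-- Isomorphic fibre functors have isomorphic functors of tensor automorphisms. -/
noncomputable def tensorAutIso (he : IsTensorIso e) :
    (ω.tensorAut : CommAlgCat.{v} ℂ ⥤ _) ≅ ω'.tensorAut :=
  NatIso.ofComponents (fun R =>
    { hom := GrpCat.ofHom (conjHom R he)
      inv := GrpCat.ofHom (conjHom R he.symm)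
      hom_inv_id := GrpCat.hom_ext <| MonoidHom.ext (conjHom_symm_conjHom R he)
      inv_hom_id := GrpCat.hom_ext <| MonoidHom.ext (conjHom_symm_conjHom R he.symm) })
    fun φ => tensorAut_map_conj he φ

end FibreFunctor

/-! ### Independence of the realisation, and the theorem -/

variable {Ω : DGAlgebra.{u}}

namespace FlatConn

theorem induction_of_local {p : CentreZero Ω →ₐ[ℂ] ℂ} {X : FlatConn Ω} {V : Type*}
    [AddCommGroup V] [Module ℂ V] (θ : V ≃ₗ[ℂ] LocalFibre p X) {P : V → Prop}
    (smul_germ : ∀ (c : ℂ) x, P (c • θ.symm (germ p X x)))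
    (add : ∀ s t, P s → P t → P (s + t)) (u : V) : P u := by
  rw [← θ.symm_apply_apply u]
  refine local_induction p (P := fun t => P (θ.symm t)) (fun c x => ?_) (fun s t hs ht => ?_) (θ u)
  · rw [map_smul]
    exact smul_germ c x
  · rw [map_add]
    exact add _ _ hs ht

/-- Compose one comparison with the inverse of the other. The compatibilities are known only on
germs, but germs span the localisation over ℂ and all maps involved are linear or bilinear. -/
theorem exists_isTensorIso [MonoidalCategory (FlatConn Ω)] [SymmetricCategory (FlatConn Ω)]
    {T : StandardTensor Ω} {p : CentreZero Ω →ₐ[ℂ] ℂ} {ω ω' : FibreFunctor (FlatConn Ω)}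
    (h : T.IsLocalisationAt p ω) (h' : T.IsLocalisationAt p ω') :
    ∃ e : ∀ X : FlatConn Ω, ω.fib X ≃ₗ[ℂ] ω'.fib X, FibreFunctor.IsTensorIso e := by
  obtain ⟨θ, h1, h2, h3⟩ := h
  obtain ⟨θ', h1', h2', h3'⟩ := h'
  refine ⟨fun X => (θ X).trans (θ' X).symm, ⟨fun {X Y} f u => ?_, fun X Y u v => ?_, ?_⟩⟩
  · induction u using induction_of_local (θ X) with
    | smul_germ c x =>
      simp only [map_smul, LinearEquiv.trans_apply, h1, LinearEquiv.apply_symm_apply]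
      rw [← h1', LinearEquiv.symm_apply_apply]
    | add s t hs ht => simp only [map_add, hs, ht]
  · induction u using induction_of_local (θ X) with
    | smul_germ c x =>
      induction v using induction_of_local (θ Y) with
      | smul_germ c' y =>
        simp only [map_smul, LinearMap.smul_apply, LinearEquiv.trans_apply, h2,
          LinearEquiv.apply_symm_apply]
        rw [← h2', LinearEquiv.symm_apply_apply]
      | add s t hs ht => simp only [map_add, hs, ht]
    | add s t hs ht => simp only [map_add, LinearMap.add_apply, hs, ht]
  · rw [LinearEquiv.trans_apply, h3, ← h3', LinearEquiv.symm_apply_apply]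

end FlatConn

theorem isNeutralTannakian_flatConn {Ω : DGAlgebra.{u}} (hΩ : Ω.IsDiffSimple)
    (p : CentreZero Ω →ₐ[ℂ] ℂ) : IsNeutralTannakian (FlatConn Ω) where
  abelian := by
    have := p.toRingHom.domain_nontrivial
    exact FlatConn.exists_abelian hΩ
  -- Only right duals were constructed; the braiding turns them into left duals.
  rigid := ⟨BraidedCategory.rigidCategoryOfRightRigidCategory⟩
  monoidalPreadditive := inferInstance
  monoidalLinear := inferInstance
  end_unit := FlatConn.end_unit_bijective p hΩ
  fibreFunctor := ⟨FlatConn.localisation p hΩ⟩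

end FlatBimod

theorem mainTheorem1 (Ω : FlatBimod.StarDGAlgebra.{u}) (B : Type v) [CommCStarAlgebra B]
    [PartialOrder B] [StarOrderedRing B] [Nontrivial B]
    (ι : Ω.gradedCentre.degZero →⋆ₐ[ℂ] B)
    (hι : FlatBimod.StarDGAlgebra.IsDenseEmbedding ι)
    (hQ : FlatBimod.StarDGAlgebra.PropertyQ ι) :
    ∃ (_ : MonoidalCategory (FlatBimod.FlatConn Ω.toDGAlgebra))
      (_ : SymmetricCategory (FlatBimod.FlatConn Ω.toDGAlgebra))
      (T : FlatBimod.FlatConn.StandardTensor Ω.toDGAlgebra),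
      FlatBimod.IsNeutralTannakian (FlatBimod.FlatConn Ω.toDGAlgebra) ∧
      ∀ p : WeakDual.characterSpace ℂ B,
        (∃ ω : FlatBimod.FibreFunctor (FlatBimod.FlatConn Ω.toDGAlgebra),
          T.IsLocalisationAt (FlatBimod.charAt ι p) ω) ∧
        ∀ ω ω' : FlatBimod.FibreFunctor (FlatBimod.FlatConn Ω.toDGAlgebra),
          T.IsLocalisationAt (FlatBimod.charAt ι p) ω →
          T.IsLocalisationAt (FlatBimod.charAt ι p) ω' →
          Nonempty ((ω.tensorAut : CommAlgCat.{w} ℂ ⥤ _) ≅ ω'.tensorAut) := by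
  have hΩ := FlatBimod.isDiffSimple_of_propertyQ ι hι.injective hQ
  -- A nonzero commutative unital C*-algebra has a character. One such point supplies the fibre
  -- functor in the Tannakian property; the remaining claims are proved for each point separately.
  obtain ⟨p₀⟩ : Nonempty (WeakDual.characterSpace ℂ B) := inferInstance
  refine ⟨inferInstance, inferInstance, FlatBimod.FlatConn.standardTensor _,
    FlatBimod.isNeutralTannakian_flatConn hΩ (FlatBimod.charAt ι p₀), fun p => ⟨⟨_,
      FlatBimod.FlatConn.isLocalisationAt_localisation _ hΩ⟩, fun ω ω' h h' => ?_⟩⟩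
  obtain ⟨e, he⟩ := FlatBimod.FlatConn.exists_isTensorIso h h'
  exact ⟨FlatBimod.FibreFunctor.tensorAutIso he⟩
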